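/- **Setting.** For $N\in\mathbb N\cup\{\infty\}$ with $N\ge 2$, let $\bigwedge=\bigwedge_N$ be the complex Grassmann algebra on generators $\zeta_1,\zeta_2,\dots$ ($N$ of them), $\bigwedge=\bigwedge^0\oplus\bigwedge^1$ its even and odd parts, $z_B\in\mathbb C$ the body of $z\in\bigwedge$, $z_S=z-z_B$, and let $\bigwedge_{N-2}$ be the subalgebra on the first $N-2$ generators ($\bigwedge_{\infty-2}=\bigwedge_\infty$). A function $g$ analytic near $z_B$ is extended to even $z$ by $g(z)=\sum_l \frac{z_S^l}{l!}g^{(l)}(z_B)$. A superanalytic function over an open set $V\subseteq\mathbb C$ of bodies is $f_0(z)+\theta^+f_1(z)+\theta^-f_2(z)+\theta^+\theta^-f_3(z)$, where each $f_i$ is a sum of products of analytic functions on $V$ with monomials of $\bigwedge_{N-2}$. With $D^\pm=\partial_{\theta^\pm}+\theta^\mp\partial_z$, a superanalytic map $(z,\theta^+,\theta^-)\mapsto(\tilde z,\tilde\theta^+,\tilde\theta^-)$ of $\bigwedge^0\oplus(\bigwedge^1)^2$ is N=2 superconformal if $D^\pm\tilde\theta^\mp=0$, $D^\pm\tilde z=\tilde\theta^\mp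 D^\pm\tilde\theta^\pm$, and $D^\pm\tilde\theta^\pm$ are not identically zero. For $n\in\mathbb Z$, $S^2\hat{\mathbb C}(n)$ is obtained from a southern and a northern copy of $\bigwedge^0\oplus(\bigwedge^1)^2$ by identifying the northern point $(z,\theta^+,\theta^-)$, $z_B\ne0$, with the southern point $(z^{-1},\,i\theta^+z^{n-1},\,i\theta^-z^{-n-1})$. Let $\mathrm{Aut}(S^2\hat{\mathbb C}(n))$ be the set of bijections of $S^2\hat{\mathbb C}(n)$ onto itself that are N=2 superconformal in the charts. A vector field $W$ in the southern coordinates is *tangent to* $\mathrm{Aut}(S^2\hat{\mathbb C}(n))$ if it is the velocity at $t=0$ of a family $T_t$, $t\in\mathbb C$, of bijections of $S^2\hat{\mathbb C}(n)$ with $T_0=\mathrm{id}$ and $T_t\in\mathrm{Aut}(S^2\hat{\mathbb C}(n))$ for $t$ near $0$, that is given in both charts, locally near $t=0$ and each body point, by superfunctions whose coefficients are jointly analytic in $(t,z)$. Let $\mathfrak g_n=Lie(\mathrm{Aut}(S^2\hat{\mathbb C}(n)))$, the Lie superalgebra of infinitesimal automorphisms, be the set of all vector fields $X=X_0+X_1$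 ($X_0$ even, $X_1$ odd) in the southern coordinates whose coefficients are entire complex-valued functions and such that, for $j=0,1$ and every $c$ in $\bigwedge_{N-2}$ of parity $j$, the even field $cX_j$ is tangent to $\mathrm{Aut}(S^2\hat{\mathbb C}(n))$. The N=2 Neveu–Schwarz algebra has the basis $d$ (central), $L_m,J_m$ (even), $G^\pm_{m+1/2}$ (odd), $m\in\mathbb Z$, with $$[L_m,L_k]=(m-k)L_{m+k}+\tfrac1{12}(m^3-m)\delta_{m+k,0}\,d,\quad [J_m,J_k]=\tfrac13m\,\delta_{m+k,0}\,d,\quad [L_m,J_k]=-kJ_{m+k},$$ $$[L_m,G^\pm_{k+1/2}]=\left(\tfrac m2-k-\tfrac12\right)G^\pm_{m+k+1/2},\quad [J_m,G^\pm_{k+1/2}]=\pm G^\pm_{m+k+1/2},\quad [G^\pm_{m+1/2},G^\pm_{k+1/2}]=0,$$ $$[G^+_{m+1/2},G^-_{k-1/2}]=2L_{m+k}+(m-k+1)J_{m+k}+\tfrac13(m^2+m)\delta_{m+k,0}\,d.$$ Its elements act on functions of $(x,\varphi^+,\varphi^-)$, $x\neq 0$, by superderivations: $d\mapsto0$, $$L_m\mapsto-\left(x^{m+1}\partial_x+\tfrac{m+1}2x^m(\varphi^+\partial_{\varphi^+}+\varphi^-\partial_{\varphi^-})\right),\qquad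 J_m\mapsto-x^m(\varphi^+\partial_{\varphi^+}-\varphi^-\partial_{\varphi^-}),$$ $$G^\pm_{m-1/2}\mapsto-\left(x^m(\partial_{\varphi^\pm}-\varphi^\mp\partial_x)\pm m\,x^{m-1}\varphi^+\varphi^-\partial_{\varphi^\pm}\right).$$ **Theorem 5.1.** Let $n\in\mathbb Z$. In the N=2 Neveu–Schwarz algebra let $\mathfrak s_n=\mathfrak s_n^0\oplus\mathfrak s_n^1$, where $\mathfrak s_n^0$ is spanned by $$L_{-1},\quad L_0-\tfrac n2J_0,\quad L_1-nJ_1,\quad J_0,$$ and $\mathfrak s_n^1$ is spanned by - $G^+_{-1/2},G^+_{1/2},G^-_{-1/2},G^-_{1/2}$ if $n=0$; - $G^\pm_{-1/2},\ G^\mp_{-1/2},\ G^\mp_{1/2},\ G^\mp_{3/2}$ if $n=\pm1$; - $G^-_{k-1/2}$, $k=0,\dots,n+1$, if $n\ge2$; - $G^+_{k-1/2}$, $k=0,\dots,-n+1$, if $n\le-2$. Then $\mathfrak s_n$ is a Lie sub-superalgebra of the N=2 Neveu–Schwarz algebra. The action above, which on $\mathfrak s_n$ has coefficients that are polynomial in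 $x$, restricts to an injective homomorphism of Lie superalgebras from $\mathfrak s_n$ to vector fields in the southern coordinates (with the supercommutator). The listed vectors are mapped to a linearly independent family, and the images of $\mathfrak s_n^0$ and $\mathfrak s_n^1$ have dimensions $4$ and $\max(4,|n|+2)$. The image of $\mathfrak s_n^0$ is the even part of $\mathfrak g_n$. If moreover $N\ge3$ (so that $\bigwedge_{N-2}$ contains nonzero odd constants), then the image of $\mathfrak s_n$ is $\mathfrak g_n$ and the image of $\mathfrak s_n^1$ is the odd part of $\mathfrak g_n$. Thus $\mathfrak g_n$ is identified with the subalgebra $\mathfrak s_n$ of the N=2 Neveu–Schwarz algebra, of even dimension $4$ and odd dimension $\max(4,|n|+2)$. -/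

import Mathlib

open scoped Topology

namespace N2Sphere

noncomputable section

/-! ### Grassmann algebras -/

/-- Labels of the generators of the Grassmann algebra on `N` generators (`N = ⊤`: countably many). -/
abbrev Gen (N : ℕ∞) : Type := {i : ℕ // (i : ℕ∞) < N}

/-- The complex Grassmann algebra on `N` generators. -/
abbrev Grassmann (N : ℕ∞) : Type := ExteriorAlgebra ℂ (Gen N →₀ ℂ)

/-- The basis monomial `ζ_{k₁} ⋯ ζ_{kₛ}`, `k₁ < ⋯ < kₛ`, for `K = {k₁, …, kₛ}`. -/
def zeta {N : ℕ∞} (K : Finset (Gen N)) : Grassmann N :=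
  (Finsupp.basisSingleOne (R := ℂ) (ι := Gen N)).ExteriorAlgebra K

/-- `K` only involves the first `N - m` generators (all generators if `N = ⊤`). -/
def IsLow {N : ℕ∞} (m : ℕ) (K : Finset (Gen N)) : Prop :=
  ∀ k ∈ K, ((k.1 : ℕ∞) + m) < N

/-- The part of parity `j` of the Grassmann subalgebra on the first `N - m` generators. -/
def grPart (N : ℕ∞) (m : ℕ) (j : ZMod 2) : Submodule ℂ (Grassmann N) :=
  Submodule.span ℂ {x | ∃ K : Finset (Gen N), IsLow m K ∧ (K.card : ZMod 2) = j ∧ x = zeta K}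

/-- The body of a supernumber. -/
def body {N : ℕ∞} : Grassmann N →ₐ[ℂ] ℂ := ExteriorAlgebra.algebraMapInv

/-- The soul of a supernumber. -/
def soul {N : ℕ∞} (z : Grassmann N) : Grassmann N := z - algebraMap ℂ (Grassmann N) (body z)

/-- The value `∑ₗ z_S ^ l / l! • g⁽ˡ⁾(z_B)` at the supernumber `z` of a function `g` that is analytic
near the body of `z`. The sum is finite, since souls are nilpotent. -/
def ext {N : ℕ∞} (g : ℂ → ℂ) (z : Grassmann N) : Grassmann N :=
  ∑ᶠ l : ℕ, (((l.factorial : ℂ)⁻¹ * iteratedDeriv l g (body z)) • soul z ^ l)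

/-- Points `(z, θ⁺, θ⁻)` of the superspace with one even and two odd coordinates. -/
abbrev Point (N : ℕ∞) : Type :=
  {p : Fin 3 → Grassmann N // p 0 ∈ grPart N 0 0 ∧ p 1 ∈ grPart N 0 1 ∧ p 2 ∈ grPart N 0 1}

/-- The body of a point, that is the body of its even coordinate. -/
def Point.body {N : ℕ∞} (p : Point N) : ℂ := N2Sphere.body (p.1 0)

/-! ### Superfunctions

A superfunction `f₀ + θ⁺ f₁ + θ⁻ f₂ + θ⁺ θ⁻ f₃` is stored as the family `(f₀, f₁, f₂, f₃)` of its
component functions, where the `fᵢ` belong to some additive group `E` of functions of `z`. -/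

section Operators

variable {E : Type} [AddGroup E]

/-- Left derivative `∂/∂θ⁺`. -/
def dThetaP (F : Fin 4 → E) : Fin 4 → E := ![F 1, 0, F 3, 0]

/-- Left derivative `∂/∂θ⁻`. -/
def dThetaM (F : Fin 4 → E) : Fin 4 → E := ![F 2, -F 3, 0, 0]

/-- Left multiplication by `θ⁺`. -/
def mulThetaP (F : Fin 4 → E) : Fin 4 → E := ![0, F 0, 0, F 2]

/-- Left multiplication by `θ⁻`. -/
def mulThetaM (F : Fin 4 → E) : Fin 4 → E := ![0, 0, F 0, -F 1]

end Operators

/-- Formal sums `∑_K g_K ζ_K` with coefficients `g_K` in `E`. -/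
abbrev Comp (N : ℕ∞) (E : Type) [Zero E] : Type := Finset (Gen N) →₀ E

/-- Grassmann algebra valued superfunctions of `(z, θ⁺, θ⁻)`, given by their coefficients. -/
abbrev SuperFn (N : ℕ∞) (E : Type) [Zero E] : Type := Fin 4 → Comp N E

/-- Value of `∑_K g_K ζ_K` at the even supernumber `z`. -/
def Comp.eval {N : ℕ∞} (F : Comp N (ℂ → ℂ)) (z : Grassmann N) : Grassmann N :=
  F.sum fun K g => ext g z * zeta K

/-- Value `f₀(z) + θ⁺ f₁(z) + θ⁻ f₂(z) + θ⁺ θ⁻ f₃(z)` of a superfunction at a point. -/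
def SuperFn.eval {N : ℕ∞} (F : SuperFn N (ℂ → ℂ)) (p : Point N) : Grassmann N :=
  Comp.eval (F 0) (p.1 0) + p.1 1 * Comp.eval (F 1) (p.1 0) + p.1 2 * Comp.eval (F 2) (p.1 0)
    + p.1 1 * p.1 2 * Comp.eval (F 3) (p.1 0)

/-- `∂/∂z`. -/
def SuperFn.dz {N : ℕ∞} (F : SuperFn N (ℂ → ℂ)) : SuperFn N (ℂ → ℂ) :=
  fun i => (F i).mapRange deriv (by funext z; simp [Pi.zero_def])

/-- `D⁺ = ∂/∂θ⁺ + θ⁻ ∂/∂z`. -/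
def SuperFn.Dplus {N : ℕ∞} (F : SuperFn N (ℂ → ℂ)) : SuperFn N (ℂ → ℂ) :=
  dThetaP F + mulThetaM (SuperFn.dz F)

/-- `D⁻ = ∂/∂θ⁻ + θ⁺ ∂/∂z`. -/
def SuperFn.Dminus {N : ℕ∞} (F : SuperFn N (ℂ → ℂ)) : SuperFn N (ℂ → ℂ) :=
  dThetaM F + mulThetaP (SuperFn.dz F)

/-- The coefficients are analytic on `V` and only the monomials in the first `N - 2` generators
occur. -/
def SuperFn.IsSuperanalyticOn {N : ℕ∞} (F : SuperFn N (ℂ → ℂ)) (V : Set ℂ) : Prop :=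
  ∀ i, ∀ K ∈ (F i).support, IsLow 2 K ∧ AnalyticOnNhd ℂ (F i K) V

/-- The triple `(z̃, θ̃⁺, θ̃⁻)` of superfunctions is `N = 2` superconformal over the open set `V`
of bodies: it is superanalytic, `D^± θ̃^∓ = 0`, `D^± z̃ - θ̃^∓ D^± θ̃^± = 0`, and `D^± θ̃^±` do not
vanish identically. -/
def IsSuperconformalOn {N : ℕ∞} (H : Fin 3 → SuperFn N (ℂ → ℂ)) (V : Set ℂ) : Prop :=
  (∀ i, (H i).IsSuperanalyticOn V) ∧
  (∀ p : Point N, p.body ∈ V →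
    (H 2).Dplus.eval p = 0 ∧ (H 1).Dminus.eval p = 0 ∧
    (H 0).Dplus.eval p - (H 2).eval p * (H 1).Dplus.eval p = 0 ∧
    (H 0).Dminus.eval p - (H 1).eval p * (H 2).Dminus.eval p = 0) ∧
  (∃ p : Point N, p.body ∈ V ∧ (H 1).Dplus.eval p ≠ 0) ∧
  (∃ p : Point N, p.body ∈ V ∧ (H 2).Dminus.eval p ≠ 0)

/-! ### The super-Riemann spheres and their automorphisms -/

/-- Gluing of two copies of the superspace (left: southern, right: northern coordinates): the
northern point `(z, θ⁺, θ⁻)` with `z` invertible is the southern point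
`(1 / z, i θ⁺ z ^ (n - 1), i θ⁻ z ^ (- n - 1))`. -/
def Glue (N : ℕ∞) (n : ℤ) : Point N ⊕ Point N → Point N ⊕ Point N → Prop
  | .inr p, .inl q => ∃ u : (Grassmann N)ˣ, (u : Grassmann N) = p.1 0 ∧
      q.1 0 = ((u⁻¹ : (Grassmann N)ˣ) : Grassmann N) ∧
      q.1 1 = Complex.I • (p.1 1 * ((u ^ (n - 1) : (Grassmann N)ˣ) : Grassmann N)) ∧
      q.1 2 = Complex.I • (p.1 2 * ((u ^ (-n - 1) : (Grassmann N)ˣ) : Grassmann N))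
  | _, _ => False

/-- The `N = 2` superconformal super-Riemann sphere with parameter `n`. -/
def Sphere (N : ℕ∞) (n : ℤ) : Type := Quot (Glue N n)

/-- The two charts of the atlas. -/
inductive Chart
  | south
  | north

/-- The inverses of the two coordinate maps. -/
def chartInv {N : ℕ∞} {n : ℤ} : Chart → Point N → Sphere N n
  | .south, p => Quot.mk _ (.inl p)
  | .north, p => Quot.mk _ (.inr p)

/-- A self-map of the sphere is `N = 2` superconformal: in each pair of charts `α`, `β`, its
coordinate expression has a domain that is open in the DeWitt topology (the preimage of an open set
`V` of bodies) and, if this is not empty, is `N = 2` superconformal there. -/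
def IsSuperconformalMap {N : ℕ∞} {n : ℤ} (T : Sphere N n → Sphere N n) : Prop :=
  ∀ α β : Chart, (∃ p q : Point N, T (chartInv α p) = chartInv β q) →
    ∃ V : Set ℂ, IsOpen V ∧
      (∀ p : Point N, (∃ q : Point N, T (chartInv α p) = chartInv β q) ↔ p.body ∈ V) ∧
      ∃ H : Fin 3 → SuperFn N (ℂ → ℂ), IsSuperconformalOn H V ∧
        ∀ p q : Point N, T (chartInv α p) = chartInv β q → ∀ i, q.1 i = (H i).eval p

/-- The `N = 2` superconformal automorphisms of the sphere. -/
def Aut (N : ℕ∞) (n : ℤ) : Set (Equiv.Perm (Sphere N n)) := {T | IsSuperconformalMap T}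

/-! ### Vector fields with complex coefficients on the southern chart

A superderivation `X` of the algebra of superfunctions `f₀ + φ⁺ f₁ + φ⁻ f₂ + φ⁺ φ⁻ f₃` with complex
valued `fᵢ(x)` is stored as the triple `(X x, X φ⁺, X φ⁻)` of its values on the coordinates. -/

/-- Superfunctions with complex coefficients. -/
abbrev CFn : Type := Fin 4 → ℂ → ℂ

/-- Superderivations, by their values on `x`, `φ⁺`, `φ⁻`. -/
abbrev VField : Type := Fin 3 → CFn

/-- Product of superfunctions, with `φ⁺ φ⁻ = - φ⁻ φ⁺`. -/
def CFn.mul (F G : CFn) : CFn :=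
  ![F 0 * G 0, F 0 * G 1 + F 1 * G 0, F 0 * G 2 + F 2 * G 0,
    F 0 * G 3 + F 3 * G 0 + F 1 * G 2 - F 2 * G 1]

/-- Action `(X x) ∂F/∂x + (X φ⁺) ∂F/∂φ⁺ + (X φ⁻) ∂F/∂φ⁻` of a superderivation. -/
def VField.apply (X : VField) (F : CFn) : CFn :=
  CFn.mul (X 0) (fun i => deriv (F i)) + CFn.mul (X 1) (dThetaP F) + CFn.mul (X 2) (dThetaM F)

/-- Parities of the component functions: `1`, `φ⁺`, `φ⁻`, `φ⁺ φ⁻`. -/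
def compParity : Fin 4 → ZMod 2 := ![0, 1, 1, 0]

/-- Parities of the coordinates `x`, `φ⁺`, `φ⁻`. -/
def coordParity : Fin 3 → ZMod 2 := ![0, 1, 1]

/-- The homogeneous part of parity `j` of a superderivation. -/
def VField.part (j : ZMod 2) (X : VField) : VField :=
  fun i k => if compParity k = j + coordParity i then X i k else 0

/-- The Lie superbracket: `[X, Y] = X Y - (-1) ^ (|X| |Y|) Y X` for homogeneous `X`, `Y`, extended
bilinearly. -/
def VField.bracket (X Y : VField) : VField := fun i =>
  ∑ a : ZMod 2, ∑ b : ZMod 2,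
    ((X.part a).apply (Y.part b i) - (-1 : ℂ) ^ (a.val * b.val) • (Y.part b).apply (X.part a i))

/-- The value of a superfunction with complex coefficients at a point of the superspace. -/
def CFn.eval {N : ℕ∞} (F : CFn) (p : Point N) : Grassmann N :=
  SuperFn.eval (fun k => Finsupp.single ∅ (F k)) p

/-! ### Infinitesimal automorphisms -/

/-- A superfunction depending on a complex parameter `t`, at a fixed value of `t`. -/
def SuperFn.at {N : ℕ∞} (F : SuperFn N (ℂ → ℂ → ℂ)) (t : ℂ) : SuperFn N (ℂ → ℂ) :=
  fun i => (F i).mapRange (fun g => g t) rfl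

/-- The derivative at `t = 0` of a superfunction depending on a complex parameter `t`. -/
def SuperFn.dt {N : ℕ∞} (F : SuperFn N (ℂ → ℂ → ℂ)) : SuperFn N (ℂ → ℂ) :=
  fun i => (F i).mapRange (fun g z => deriv (fun t => g t z) 0) (by funext z; simp)

/-- Near `t = 0` and near the body point `z₀` of the chart `α`, the family `T` is given in the chart
`α` by superfunctions `H` whose coefficients are jointly analytic in `(t, z)`. -/
def IsLocalFamily {N : ℕ∞} {n : ℤ} (T : ℂ → Equiv.Perm (Sphere N n)) (α : Chart) (z₀ : ℂ) (r : ℝ)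
    (H : Fin 3 → SuperFn N (ℂ → ℂ → ℂ)) : Prop :=
  0 < r ∧
  (∀ i k, ∀ K ∈ (H i k).support, IsLow 2 K ∧
    AnalyticOnNhd ℂ (fun x : ℂ × ℂ => H i k K x.1 x.2) (Metric.ball ((0 : ℂ), z₀) r)) ∧
  ∀ t : ℂ, ‖t‖ < r → ∀ p : Point N, ‖p.body - z₀‖ < r →
    ∃ q : Point N, T t (chartInv α p) = chartInv α q ∧ ∀ i, q.1 i = ((H i).at t).eval p

/-- Tangent vectors at the identity of the automorphism group: `W`, a triple of functions of the
southern coordinates (its values on the three coordinates), is the velocity at `t = 0` of a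
holomorphic curve `T` of automorphisms with `T 0 = 1`. -/
def IsTangent (N : ℕ∞) (n : ℤ) (W : Fin 3 → Point N → Grassmann N) : Prop :=
  ∃ T : ℂ → Equiv.Perm (Sphere N n), T 0 = 1 ∧ (∀ᶠ t in 𝓝 (0 : ℂ), T t ∈ Aut N n) ∧
    (∀ z₀ : ℂ, ∃ r H, IsLocalFamily T .north z₀ r H) ∧
    (∀ z₀ : ℂ, ∃ r H, IsLocalFamily T .south z₀ r H ∧
      ∀ p : Point N, ‖p.body - z₀‖ < r → ∀ i, (H i).dt.eval p = W i p)

/-- The Lie superalgebra of infinitesimal automorphisms of the sphere. A vector field `X` with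
complex holomorphic coefficients on the southern chart belongs to it if, for its parts `X_j` of
parity `j`, all (even) vector fields `c X_j` with a Grassmann constant `c` of parity `j` are tangent
to the automorphism group at the identity. -/
def infAut (N : ℕ∞) (n : ℤ) : Set VField :=
  {X | (∀ i k, Differentiable ℂ (X i k)) ∧
    ∀ j : ZMod 2, ∀ c ∈ grPart N 2 j, IsTangent N n fun i p => c * (X.part j i).eval p}

/-! ### The `N = 2` Neveu–Schwarz algebra -/

/-- Basis of the `N = 2` Neveu–Schwarz algebra: `d`, `L_m`, `J_m`, and, for `k : ℤ`, the odd elements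
`Gp k = G⁺_{k - 1/2}` and `Gm k = G⁻_{k - 1/2}`. -/
inductive NSBasis
  | d
  | L (m : ℤ)
  | J (m : ℤ)
  | Gp (k : ℤ)
  | Gm (k : ℤ)
  deriving DecidableEq

/-- The underlying vector space of the `N = 2` Neveu–Schwarz algebra. -/
abbrev NS : Type := NSBasis →₀ ℂ

/-- A basis vector. -/
def e (b : NSBasis) : NS := Finsupp.single b 1

open NSBasis in
/-- The bracket on basis vectors. -/
def nsBracketBasis : NSBasis → NSBasis → NS
  | L m, L n => ((m : ℂ) - n) • e (L (m + n))
      + (if m + n = 0 then ((m : ℂ) ^ 3 - m) / 12 else 0) • e d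
  | J m, J n => (if m + n = 0 then (m : ℂ) / 3 else 0) • e d
  | L m, J n => (-(n : ℂ)) • e (J (m + n))
  | J n, L m => (n : ℂ) • e (J (m + n))
  | L m, Gp k => ((m : ℂ) / 2 - k + 1 / 2) • e (Gp (m + k))
  | Gp k, L m => (-((m : ℂ) / 2 - k + 1 / 2)) • e (Gp (m + k))
  | L m, Gm k => ((m : ℂ) / 2 - k + 1 / 2) • e (Gm (m + k))
  | Gm k, L m => (-((m : ℂ) / 2 - k + 1 / 2)) • e (Gm (m + k))
  | J m, Gp k => e (Gp (m + k))
  | Gp k, J m => -e (Gp (m + k))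
  | J m, Gm k => -e (Gm (m + k))
  | Gm k, J m => e (Gm (m + k))
  | Gp k, Gm l => (2 : ℂ) • e (L (k + l - 1)) + ((k : ℂ) - l) • e (J (k + l - 1))
      + (if k + l = 1 then ((k : ℂ) ^ 2 - k) / 3 else 0) • e d
  | Gm l, Gp k => (2 : ℂ) • e (L (k + l - 1)) + ((k : ℂ) - l) • e (J (k + l - 1))
      + (if k + l = 1 then ((k : ℂ) ^ 2 - k) / 3 else 0) • e d
  | Gp _, Gp _ => 0
  | Gm _, Gm _ => 0
  | d, _ => 0
  | _, d => 0

/-- The Lie superbracket of the `N = 2` Neveu–Schwarz algebra. -/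
def nsBracket (u v : NS) : NS :=
  u.sum fun a s => v.sum fun b t => (s * t) • nsBracketBasis a b

/-- The function `x ↦ c x ^ k`. -/
def mono (c : ℂ) (k : ℤ) : ℂ → ℂ := fun x => c * x ^ k

/-- The superderivations representing the basis vectors:
`L_m = -(x^(m+1) ∂_x + (m+1)/2 x^m (φ⁺ ∂₊ + φ⁻ ∂₋))`, `J_m = -x^m (φ⁺ ∂₊ - φ⁻ ∂₋)`,
`G^±_{k-1/2} = -(x^k (∂_± - φ^∓ ∂_x) ± k x^(k-1) φ⁺ φ⁻ ∂_±)`, `d = 0`. -/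
def repBasis : NSBasis → VField
  | .d => 0
  | .L m => ![![mono (-1) (m + 1), 0, 0, 0], ![0, mono (-((m + 1) / 2)) m, 0, 0],
      ![0, 0, mono (-((m + 1) / 2)) m, 0]]
  | .J m => ![0, ![0, mono (-1) m, 0, 0], ![0, 0, mono 1 m, 0]]
  | .Gp k => ![![0, 0, mono 1 k, 0], ![mono (-1) k, 0, 0, mono (-k) (k - 1)], 0]
  | .Gm k => ![![0, mono 1 k, 0, 0], 0, ![mono (-1) k, 0, 0, mono k (k - 1)]]

/-- The representation of central charge zero by superderivations. -/
def rep : NS →ₗ[ℂ] VField := Finsupp.linearCombination ℂ repBasis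

/-! ### The explicit generators -/

/-- `L_{-1}`, `L_0 - (n/2) J_0`, `L_1 - n J_1`, `J_0`. -/
def evenGen (n : ℤ) : Fin 4 → NS :=
  ![e (.L (-1)), e (.L 0) - ((n : ℂ) / 2) • e (.J 0), e (.L 1) - (n : ℂ) • e (.J 1), e (.J 0)]

open NSBasis in
/-- The odd basis vectors. -/
def oddSet (n : ℤ) : Finset NSBasis :=
  if n = 0 then {Gp 0, Gp 1, Gm 0, Gm 1}
  else if n = 1 then {Gp 0, Gm 0, Gm 1, Gm 2}
  else if n = -1 then {Gm 0, Gp 0, Gp 1, Gp 2}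
  else if 2 ≤ n then (Finset.Icc 0 (n + 1)).image Gm
  else (Finset.Icc 0 (-n + 1)).image Gp

/-- All the generators. -/
def gen (n : ℤ) : Fin 4 ⊕ {b // b ∈ oddSet n} → NS :=
  Sum.elim (evenGen n) (fun b => e b.1)

/-- The span of the even generators. -/
def evenSpan (n : ℤ) : Submodule ℂ NS := Submodule.span ℂ (Set.range (evenGen n))

/-- The span of the odd generators. -/
def oddSpan (n : ℤ) : Submodule ℂ NS := Submodule.span ℂ (e '' (oddSet n : Set NSBasis))

end

end N2Sphere

namespace N2Sphere

noncomputable section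

/-! ### Products of basis monomials -/

section Monomials

variable {N : ℕ∞}

/-! Near the identity the superconformal equations become linear, and a field with complex
coefficients that satisfies them is determined by four functions of x, its potentials f, g (even)
and a, b (odd): it sends x to f - φ⁺b - φ⁻a, φ⁺ to a + φ⁺g + φ⁺φ⁻a', and φ⁻ to b + φ⁻(f' - g) -
φ⁺φ⁻b' (`polyField`, `fld`). The theorem then says which potentials remain regular at the northern
pole. In the northern variable w = 1/x, the functions w²f(1/w), g(1/w) + (n-1)w f(1/w), w^(1-n)
a(1/w) and w^(n+1) b(1/w) have to extend continuously to w = 0. For entire functions Liouville's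
theorem turns this into f = A + Bx + Dx², g = E + (1-n)Dx, deg a ≤ 1-n, deg b ≤ n+1, with the zero
polynomial allowed. This leaves four even parameters and max(0, 2-n) + max(0, n+2) = max(4, |n|+2)
odd ones.

Necessity. Superfunctions only involve monomials in the first N-2 generators, so two further
generators can be used as independent values of θ⁺ and θ⁻; hence values determine coefficients
(`coord_ev4_ext`). The superconformal equations thereby become scalar equations
(`IsSuperconformalOn.scalar_equations`), which are differentiated at t = 0. Differentiating the
gluing relation gives the growth conditions (`IsTangent.south_north`), and
`exists_polynomial_of_growth_int` gives polynomials. Even fields are tested with the constant 1 and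
odd fields with a single generator, which lies in the smaller algebra only if N ≥ 3.

Sufficiency. The sphere has homogeneous coordinates (u, v, η₁, η₂), where a unit x acts with weights
1, 1, 1-n, 1+n. A matrix acting on (u, v) together with scale factors r, s on η₁, η₂ descends to a
bijection of the sphere, and it is superconformal when the determinant is rs; a suitable curve of
such maps has any prescribed even potential as velocity (`isTangent_of_even`). For an odd constant c
the maps id + tcX are already bijections with inverse id - tcX, since c² = 0 removes all terms of
second order, and the degree bounds make them polynomial in the northern chart as well
(`isTangent_of_odd`).

Algebra. On potentials the superbracket is an explicit bilinear expression (`bracket_fld`), so that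
the representation respects brackets by comparison of monomials. The span of the generators is
closed because the structure constants vanish exactly at the ends of the ranges of indices, and dual
functionals on the potentials give linear independence. -/

theorem zeta_empty : zeta (∅ : Finset (Gen N)) = 1 := by
  rw [zeta, ExteriorAlgebra.basis_apply_ofCard _ (n := 0) (by simp)]
  simp [ExteriorAlgebra.ιMulti_family]

theorem zeta_mul_zeta_of_disjoint {K L : Finset (Gen N)} (h : Disjoint K L) :
    zeta K * zeta L = zeta (K ∪ L) ∨ zeta K * zeta L = -zeta (K ∪ L) := by
  have key := ExteriorAlgebra.basis_mul_of_disjoint (Finsupp.basisSingleOne (R := ℂ) (ι := Gen N))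
    (⟨K, rfl⟩ : Set.powersetCard (Gen N) K.card) (⟨L, rfl⟩ : Set.powersetCard (Gen N) L.card) h
  have hu : ((Set.powersetCard.disjUnion (s := (⟨K, rfl⟩ : Set.powersetCard (Gen N) K.card))
      (t := (⟨L, rfl⟩ : Set.powersetCard (Gen N) L.card)) h : Set.powersetCard _ _) :
      Finset (Gen N)) = K ∪ L := by
    simp [Set.powersetCard.disjUnion]
  rw [hu] at key
  rcases Int.units_eq_one_or (Equiv.Perm.sign (Set.powersetCard.permOfDisjoint
    (s := (⟨K, rfl⟩ : Set.powersetCard (Gen N) K.card))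
    (t := (⟨L, rfl⟩ : Set.powersetCard (Gen N) L.card)) h)) with h1 | h1
  · rw [h1] at key
    left
    simpa [zeta] using key
  · rw [h1] at key
    right
    simpa [zeta] using key

theorem zeta_mul_zeta_of_not_disjoint {K L : Finset (Gen N)} (h : ¬Disjoint K L) :
    zeta K * zeta L = 0 :=
  ExteriorAlgebra.basis_mul_of_not_disjoint (Finsupp.basisSingleOne (R := ℂ) (ι := Gen N))
    (⟨K, rfl⟩ : Set.powersetCard (Gen N) K.card) (⟨L, rfl⟩ : Set.powersetCard (Gen N) L.card) h

theorem zeta_mul_self {K : Finset (Gen N)} (h : K.Nonempty) : zeta K * zeta K = 0 :=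
  zeta_mul_zeta_of_not_disjoint (by simpa using h.ne_empty)

theorem span_zeta : Submodule.span ℂ (Set.range (zeta : Finset (Gen N) → Grassmann N)) = ⊤ :=
  (Finsupp.basisSingleOne (R := ℂ) (ι := Gen N)).ExteriorAlgebra.span_eq

/-- The coordinate functional of the monomial `ζ_K`. -/
def coord (K : Finset (Gen N)) : Grassmann N →ₗ[ℂ] ℂ :=
  (Finsupp.basisSingleOne (R := ℂ) (ι := Gen N)).ExteriorAlgebra.coord K

theorem coord_zeta (K L : Finset (Gen N)) : coord K (zeta L) = if L = K then 1 else 0 := by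
  rw [coord, zeta, Module.Basis.coord_apply, Module.Basis.repr_self, Finsupp.single_apply]

theorem exists_list_zeta (K : Finset (Gen N)) : ∃ l : List (Gen N →₀ ℂ), l.length = K.card ∧
    zeta K = (l.map (ExteriorAlgebra.ι ℂ)).prod := by
  rw [zeta, ExteriorAlgebra.basis_apply]
  refine ⟨List.ofFn fun i => Finsupp.basisSingleOne (R := ℂ)
    (Set.powersetCard.ofFinEmbEquiv.symm ((Set.powersetCard.prodEquiv.symm K).2) i), by simp, ?_⟩
  change ExteriorAlgebra.ιMulti ℂ _ _ = _
  rw [ExteriorAlgebra.ιMulti_apply, List.map_ofFn]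
  rfl

/-- All commutation signs below come from this: a generator passes through x at the cost of the
grading involution. -/
theorem ι_mul_eq_involute_mul (v : Gen N →₀ ℂ) (x : Grassmann N) :
    ExteriorAlgebra.ι ℂ v * x = CliffordAlgebra.involute x * ExteriorAlgebra.ι ℂ v := by
  induction x using ExteriorAlgebra.induction with
  | algebraMap r => rw [AlgHom.commutes, Algebra.commutes]
  | ι w =>
    have := ExteriorAlgebra.ι_add_mul_swap (R := ℂ) v w
    rw [show CliffordAlgebra.involute (ExteriorAlgebra.ι ℂ w) = -ExteriorAlgebra.ι ℂ w from
      CliffordAlgebra.involute_ι w, neg_mul]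
    exact eq_neg_of_add_eq_zero_left this
  | mul a b ha hb => rw [map_mul, ← mul_assoc, ha, mul_assoc, hb, mul_assoc]
  | add a b ha hb => rw [map_add, mul_add, add_mul, ha, hb]

theorem prod_ι_mul_smul {x : Grassmann N} {k : ℕ}
    (hx : CliffordAlgebra.involute x = (-1 : ℂ) ^ k • x) (l : List (Gen N →₀ ℂ)) :
    (l.map (ExteriorAlgebra.ι ℂ)).prod * x =
      (-1 : ℂ) ^ (l.length * k) • (x * (l.map (ExteriorAlgebra.ι ℂ)).prod) := by
  induction l with
  | nil => simp
  | cons v l ih =>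
    rw [List.map_cons, List.prod_cons, mul_assoc, ih, mul_smul_comm, ← mul_assoc,
      ι_mul_eq_involute_mul, hx, smul_mul_assoc, smul_mul_assoc, smul_smul, mul_assoc,
      List.length_cons, ← pow_add]
    congr 2
    ring

theorem involute_zeta (K : Finset (Gen N)) :
    CliffordAlgebra.involute (zeta K) = (-1 : ℂ) ^ K.card • zeta K := by
  obtain ⟨l, hl, h⟩ := exists_list_zeta K
  rw [h, ← hl]
  clear hl h
  induction l with
  | nil => simp
  | cons v l ih =>
    rw [List.map_cons, List.prod_cons, map_mul, ih,
      show CliffordAlgebra.involute (ExteriorAlgebra.ι ℂ v) = -ExteriorAlgebra.ι ℂ v from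
      CliffordAlgebra.involute_ι v, List.length_cons, pow_succ, mul_smul_comm, neg_mul]
    simp

theorem zeta_mul_comm (K L : Finset (Gen N)) :
    zeta K * zeta L = (-1 : ℂ) ^ (K.card * L.card) • (zeta L * zeta K) := by
  obtain ⟨l, hl, h⟩ := exists_list_zeta K
  rw [h, ← hl]
  exact prod_ι_mul_smul (involute_zeta L) l

/-- The body is a ring homomorphism into a field, so it kills every element of square zero. -/
theorem body_zeta {K : Finset (Gen N)} (h : K.Nonempty) : body (zeta K) = 0 := by
  have := congrArg body (zeta_mul_self h)
  rw [map_mul, map_zero] at this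
  exact mul_self_eq_zero.mp this

end Monomials

/-! ### Even and odd parts -/

section Parity

variable {N : ℕ∞} {m : ℕ}

theorem isLow_zero (K : Finset (Gen N)) : IsLow 0 K := fun k _ => by simpa using k.2

theorem isLow_empty : IsLow m (∅ : Finset (Gen N)) := fun k hk => absurd hk (by simp)

theorem IsLow.union {K L : Finset (Gen N)} (hK : IsLow m K) (hL : IsLow m L) : IsLow m (K ∪ L) := by
  intro k hk
  rcases Finset.mem_union.mp hk with h | h
  exacts [hK k h, hL k h]

theorem grPart_le_zero (j : ZMod 2) : grPart N m j ≤ grPart N 0 j := by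
  refine Submodule.span_mono ?_
  rintro x ⟨K, -, hK, rfl⟩
  exact ⟨K, isLow_zero K, hK, rfl⟩

theorem mul_mem_grPart {i j : ZMod 2} {x y : Grassmann N} (hx : x ∈ grPart N m i)
    (hy : y ∈ grPart N m j) : x * y ∈ grPart N m (i + j) := by
  unfold grPart at hx hy
  induction hx, hy using Submodule.span_induction₂ with
  | mem_mem x y hx hy =>
    obtain ⟨K, hK, rfl, rfl⟩ := hx
    obtain ⟨L, hL, rfl, rfl⟩ := hy
    by_cases h : Disjoint K L
    · have hm : zeta (K ∪ L) ∈ grPart N m (K.card + L.card) :=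
        Submodule.subset_span ⟨K ∪ L, hK.union hL, by rw [Finset.card_union_of_disjoint h]; simp, rfl⟩
      rcases zeta_mul_zeta_of_disjoint h with h | h
      · rwa [h]
      · rw [h]; exact Submodule.neg_mem _ hm
    · rw [zeta_mul_zeta_of_not_disjoint h]; exact Submodule.zero_mem _
  | zero_left y hy => simp
  | zero_right y hy => simp
  | add_left x y z _ _ _ h1 h2 => rw [add_mul]; exact Submodule.add_mem _ h1 h2
  | add_right x y z _ _ _ h1 h2 => rw [mul_add]; exact Submodule.add_mem _ h1 h2
  | smul_left r x y _ _ h => rw [smul_mul_assoc]; exact Submodule.smul_mem _ _ h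
  | smul_right r x y _ _ h => rw [mul_smul_comm]; exact Submodule.smul_mem _ _ h

theorem one_mem_grPart : (1 : Grassmann N) ∈ grPart N m 0 :=
  Submodule.subset_span ⟨∅, isLow_empty, by simp, zeta_empty.symm⟩

theorem algebraMap_mem_grPart (a : ℂ) : algebraMap ℂ (Grassmann N) a ∈ grPart N m 0 := by
  rw [Algebra.algebraMap_eq_smul_one]
  exact Submodule.smul_mem _ _ one_mem_grPart

theorem commute_of_even {x : Grassmann N} (hx : x ∈ grPart N 0 0) (y : Grassmann N) :
    Commute x y := by
  have hy : y ∈ Submodule.span ℂ (Set.range (zeta : Finset (Gen N) → Grassmann N)) := by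
    rw [span_zeta]; trivial
  unfold grPart at hx
  induction hx, hy using Submodule.span_induction₂ with
  | mem_mem x y hx hy =>
    obtain ⟨K, -, hK, rfl⟩ := hx
    obtain ⟨L, rfl⟩ := hy
    rw [Commute, SemiconjBy, zeta_mul_comm, pow_mul, Even.neg_one_pow, one_pow, one_smul]
    exact (ZMod.natCast_eq_zero_iff_even).mp hK
  | zero_left y hy => exact Commute.zero_left _
  | zero_right y hy => exact Commute.zero_right _
  | add_left x y z _ _ _ h1 h2 => exact h1.add_left h2
  | add_right x y z _ _ _ h1 h2 => exact h1.add_right h2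
  | smul_left r x y _ _ h => exact h.smul_left r
  | smul_right r x y _ _ h => exact h.smul_right r

theorem odd_mul_odd {x y : Grassmann N} (hx : x ∈ grPart N 0 1) (hy : y ∈ grPart N 0 1) :
    x * y = -(y * x) := by
  unfold grPart at hx hy
  induction hx, hy using Submodule.span_induction₂ with
  | mem_mem x y hx hy =>
    obtain ⟨K, -, hK, rfl⟩ := hx
    obtain ⟨L, -, hL, rfl⟩ := hy
    rw [zeta_mul_comm, Odd.neg_one_pow, neg_one_smul]
    exact Odd.mul (ZMod.natCast_eq_one_iff_odd.mp hK) (ZMod.natCast_eq_one_iff_odd.mp hL)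
  | zero_left y hy => simp
  | zero_right y hy => simp
  | add_left x y z _ _ _ h1 h2 => rw [add_mul, mul_add, h1, h2, neg_add]
  | add_right x y z _ _ _ h1 h2 => rw [add_mul, mul_add, h1, h2, neg_add]
  | smul_left r x y _ _ h => rw [smul_mul_assoc, mul_smul_comm, h, smul_neg]
  | smul_right r x y _ _ h => rw [smul_mul_assoc, mul_smul_comm, h, smul_neg]

theorem odd_mul_self {x : Grassmann N} (hx : x ∈ grPart N 0 1) : x * x = 0 := by
  have h := odd_mul_odd hx hx
  have h2 : (2 : ℂ) • (x * x) = 0 := by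
    rw [two_smul]; nth_rewrite 1 [h]; exact neg_add_cancel _
  exact (smul_eq_zero.mp h2).resolve_left two_ne_zero

theorem body_odd {x : Grassmann N} (hx : x ∈ grPart N 0 1) : body x = 0 := by
  have := congrArg body (odd_mul_self hx)
  rw [map_mul, map_zero] at this
  exact mul_self_eq_zero.mp this

theorem body_algebraMap (a : ℂ) : body (algebraMap ℂ (Grassmann N) a) = a := by
  rw [AlgHom.commutes]; rfl

theorem soul_mem {x : Grassmann N} (hx : x ∈ grPart N m 0) : soul x ∈ grPart N m 0 :=
  Submodule.sub_mem _ hx (algebraMap_mem_grPart _)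

/-- Monomials other than 1 have square zero, and a finite sum of commuting nilpotents is nilpotent.
For infinitely many generators this relies on supernumbers being finite sums of monomials. -/
theorem isNilpotent_soul {x : Grassmann N} (hx : x ∈ grPart N 0 0) : IsNilpotent (soul x) := by
  have hs : ∀ x y : Grassmann N, soul (x + y) = soul x + soul y := fun x y => by
    simp only [soul, map_add]; abel
  induction hx using Submodule.span_induction with
  | mem x hx =>
    obtain ⟨K, -, hK, rfl⟩ := hx
    rcases K.eq_empty_or_nonempty with rfl | h
    · rw [zeta_empty, soul, map_one, map_one, sub_self]; exact IsNilpotent.zero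
    · refine ⟨2, ?_⟩
      rw [soul, body_zeta h, map_zero, sub_zero, sq, zeta_mul_self h]
  | zero => rw [soul, map_zero, map_zero, sub_zero]; exact IsNilpotent.zero
  | add x y hx hy h1 h2 =>
    rw [hs]
    exact (commute_of_even (soul_mem hx) _).isNilpotent_add h1 h2
  | smul a x _ h =>
    have : soul (a • x) = a • soul x := by
      simp only [soul, Algebra.smul_def, map_mul, body_algebraMap, mul_sub]
    rw [this]
    exact h.smul a

theorem eq_body_add_soul (x : Grassmann N) : x = algebraMap ℂ _ (body x) + soul x := by
  rw [soul]; abel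

/-- The even part of the Grassmann algebra. -/
def evenPart (N : ℕ∞) : Subalgebra ℂ (Grassmann N) where
  carrier := grPart N 0 0
  mul_mem' := fun hx hy => by simpa using mul_mem_grPart hx hy
  add_mem' := fun hx hy => Submodule.add_mem _ hx hy
  algebraMap_mem' := algebraMap_mem_grPart

/-- Commutativity of the even part makes polynomial identities between even supernumbers provable as
in any commutative ring. -/
instance : CommRing (evenPart N) :=
  { (inferInstance : Ring (evenPart N)) with
    mul_comm := fun x y => Subtype.ext (commute_of_even x.2 y.1) }

theorem even_smul_odd (x : evenPart N) {y : Grassmann N} (hy : y ∈ grPart N 0 1) :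
    x • y ∈ grPart N 0 1 := by
  have := mul_mem_grPart x.2 hy
  rwa [zero_add] at this

/-- An even supernumber is its body plus a nilpotent, so the even part is a local ring with residue
field ℂ. -/
theorem isUnit_even_iff {x : evenPart N} : IsUnit x ↔ body (x : Grassmann N) ≠ 0 := by
  constructor
  · intro h
    exact ((h.map (evenPart N).val).map body).ne_zero
  · intro h
    have h1 : IsNilpotent (x - algebraMap ℂ (evenPart N) (body (x : Grassmann N))) := by
      obtain ⟨k, hk⟩ := isNilpotent_soul x.2
      exact ⟨k, Subtype.ext (by simpa [soul] using hk)⟩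
    have h2 : IsUnit (algebraMap ℂ (evenPart N) (body (x : Grassmann N))) :=
      (IsUnit.mk0 _ h).map _
    have := h1.isUnit_add_left_of_commute h2 (Commute.all _ _)
    simpa using this

end Parity

/-! ### Evaluation of analytic functions at even supernumbers -/

section Ext

variable {N : ℕ∞}

theorem ext_eq_sum (g : ℂ → ℂ) {z : Grassmann N} {M : ℕ} (hM : soul z ^ M = 0) :
    ext g z = ∑ l ∈ Finset.range M,
      ((l.factorial : ℂ)⁻¹ * iteratedDeriv l g (body z)) • soul z ^ l := by
  refine finsum_eq_finsetSum_of_support_subset _ fun l hl => ?_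
  simp only [Finset.coe_range, Set.mem_Iio]
  by_contra h
  refine hl ?_
  change _ • soul z ^ l = 0
  rw [pow_eq_zero_of_le (not_lt.mp h) hM, smul_zero]

theorem ext_congr {g h : ℂ → ℂ} {z : Grassmann N} (hgh : g =ᶠ[𝓝 (body z)] h) :
    ext g z = ext h z := by
  unfold ext
  refine finsum_congr fun l => ?_
  rw [(hgh.iteratedDeriv_eq l)]

theorem ext_zero (z : Grassmann N) : ext 0 z = 0 := by
  unfold ext
  simp

theorem ext_const (a : ℂ) (z : Grassmann N) : ext (fun _ => a) z = algebraMap ℂ _ a := by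
  unfold ext
  rw [finsum_eq_single _ 0]
  · simp [Algebra.algebraMap_eq_smul_one]
  · intro l hl
    simp [iteratedDeriv_const, hl]

theorem ext_algebraMap (g : ℂ → ℂ) (a : ℂ) : ext g (algebraMap ℂ (Grassmann N) a) =
    algebraMap ℂ _ (g a) := by
  have hs : soul (algebraMap ℂ (Grassmann N) a) ^ 1 = 0 := by
    rw [pow_one, soul, body_algebraMap, sub_self]
  rw [ext_eq_sum g hs, body_algebraMap]
  simp [Algebra.algebraMap_eq_smul_one]

theorem ext_add {g h : ℂ → ℂ} {z : Grassmann N} (hz : z ∈ grPart N 0 0)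
    (hg : AnalyticAt ℂ g (body z)) (hh : AnalyticAt ℂ h (body z)) :
    ext (g + h) z = ext g z + ext h z := by
  obtain ⟨M, hM⟩ := isNilpotent_soul hz
  rw [ext_eq_sum _ hM, ext_eq_sum _ hM, ext_eq_sum _ hM, ← Finset.sum_add_distrib]
  refine Finset.sum_congr rfl fun l _ => ?_
  rw [iteratedDeriv_add hg.contDiffAt hh.contDiffAt, mul_add, add_smul]

theorem ext_neg {g : ℂ → ℂ} (z : Grassmann N) : ext (-g) z = -ext g z := by
  unfold ext
  rw [← finsum_neg_distrib]
  refine finsum_congr fun l => ?_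
  rw [iteratedDeriv_neg, mul_neg, neg_smul]

theorem ext_id {z : Grassmann N} (hz : z ∈ grPart N 0 0) : ext (fun x => x) z = z := by
  obtain ⟨M, hM⟩ := isNilpotent_soul hz
  have h2 : soul z ^ (M + 2) = 0 := by rw [pow_add, hM, zero_mul]
  rw [ext_eq_sum _ h2, add_comm M 2, Finset.sum_range_add]
  rw [Finset.sum_eq_zero (s := Finset.range M)]
  · conv_rhs => rw [eq_body_add_soul z]
    simp [Finset.sum_range_succ, Algebra.algebraMap_eq_smul_one]
  · intro l _
    have h1 : iteratedDeriv (2 + l) (fun x : ℂ => x) = fun _ => 0 := by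
      rw [add_comm, iteratedDeriv_succ', iteratedDeriv_succ']
      simp only [deriv_id'', deriv_const']
      funext x
      simp
    rw [h1, mul_zero, zero_smul]

/-- Extension is evaluation of a truncated Taylor polynomial at the soul. The coefficients of the
product of two Taylor polynomials below degree M agree with those of the product function by the
Leibniz rule, and the M-th power of the soul vanishes. -/
theorem ext_mul {g h : ℂ → ℂ} {z : Grassmann N} (hz : z ∈ grPart N 0 0)
    (hg : AnalyticAt ℂ g (body z)) (hh : AnalyticAt ℂ h (body z)) :
    ext (g * h) z = ext g z * ext h z := by
  obtain ⟨M, hM⟩ := isNilpotent_soul hz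
  set a : (ℂ → ℂ) → ℕ → ℂ := fun g l => (l.factorial : ℂ)⁻¹ * iteratedDeriv l g (body z) with ha
  set P : (ℂ → ℂ) → Polynomial ℂ := fun g => ∑ l ∈ Finset.range M, Polynomial.monomial l (a g l)
    with hP
  have hPe : ∀ g, Polynomial.aeval (soul z) (P g) = ext g z := fun g => by
    rw [ext_eq_sum g hM, hP, map_sum]
    exact Finset.sum_congr rfl fun l _ => by rw [Polynomial.aeval_monomial, Algebra.smul_def]
  have hPc : ∀ g l, l < M → (P g).coeff l = a g l := fun g l hl => by
    simp [hP, Polynomial.finsetSum_coeff, Polynomial.coeff_monomial, hl]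
  rw [← hPe g, ← hPe h, ← map_mul, ext_eq_sum (g * h) hM,
    Polynomial.aeval_eq_sum_range' (n := (P g * P h).natDegree + 1 + M) (by omega),
    add_comm _ M, Finset.sum_range_add,
    Finset.sum_eq_zero (s := Finset.range ((P g * P h).natDegree + 1)) (fun l _ => ?_), add_zero]
  · refine Finset.sum_congr rfl fun l hl => ?_
    have hl := Finset.mem_range.mp hl
    congr 1
    rw [Polynomial.coeff_mul, show g * h = fun x => g x * h x from rfl,
      iteratedDeriv_fun_mul hg.contDiffAt hh.contDiffAt, Finset.mul_sum,
      Finset.Nat.sum_antidiagonal_eq_sum_range_succ_mk]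
    refine Finset.sum_congr rfl fun i hi => ?_
    have hi : i ≤ l := Nat.lt_succ_iff.mp (Finset.mem_range.mp hi)
    rw [hPc g i (by omega), hPc h (l - i) (by omega), ha]
    have := Nat.choose_mul_factorial_mul_factorial hi
    have h1 : ((l.choose i : ℂ) * i.factorial) * (l - i).factorial = l.factorial := by
      exact_mod_cast this
    have h2 : (l.factorial : ℂ) ≠ 0 := by exact_mod_cast l.factorial_ne_zero
    have h3 : (i.factorial : ℂ) ≠ 0 := by exact_mod_cast i.factorial_ne_zero
    have h4 : ((l - i).factorial : ℂ) ≠ 0 := by exact_mod_cast (l - i).factorial_ne_zero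
    simp only
    field_simp
    rw [← h1]
    ring
  · rw [pow_add, hM, zero_mul, smul_zero]

theorem ext_mem {g : ℂ → ℂ} {z : Grassmann N} (hz : z ∈ grPart N 0 0) : ext g z ∈ grPart N 0 0 := by
  obtain ⟨M, hM⟩ := isNilpotent_soul hz
  rw [ext_eq_sum g hM]
  exact (evenPart N).sum_mem fun l _ => (evenPart N).smul_mem ((evenPart N).pow_mem (soul_mem hz) l) _

end Ext

/-! ### Families of superanalytic functions of the even variable -/

section Families

variable {N : ℕ∞}

/-- The family of functions `f t` is given by a sum `∑_K g_K(t, z) ζ_K` over low `K`, with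
coefficients jointly analytic on `U`; `fz` and `ft` are the corresponding derivatives with respect
to `z`, and with respect to `t` at `t = 0`. -/
def IsSA (U : Set (ℂ × ℂ)) (f fz : ℂ → evenPart N → Grassmann N)
    (ft : evenPart N → Grassmann N) : Prop :=
  ∃ F : Comp N (ℂ → ℂ → ℂ),
    (∀ K ∈ F.support, IsLow 2 K ∧ AnalyticOnNhd ℂ (fun x : ℂ × ℂ => F K x.1 x.2) U) ∧
    (∀ t (z : evenPart N), (t, body (z : Grassmann N)) ∈ U →
      f t z = (F.sum fun K g => ext (g t) z * zeta K) ∧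
      fz t z = F.sum fun K g => ext (deriv (g t)) z * zeta K) ∧
    ∀ z : evenPart N, ((0 : ℂ), body (z : Grassmann N)) ∈ U →
      ft z = F.sum fun K g => ext (fun x => deriv (fun t => g t x) 0) z * zeta K

variable {U : Set (ℂ × ℂ)} {f fz g gz : ℂ → evenPart N → Grassmann N}
  {ft gt : evenPart N → Grassmann N}

theorem analyticAt_snd {h : ℂ → ℂ → ℂ} {t x : ℂ}
    (hh : AnalyticAt ℂ (fun y : ℂ × ℂ => h y.1 y.2) (t, x)) : AnalyticAt ℂ (h t) x :=
  hh.comp_of_eq (f := fun x => (t, x)) (AnalyticAt.prod analyticAt_const analyticAt_id) rfl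

theorem analyticAt_fst {h : ℂ → ℂ → ℂ} {t x : ℂ}
    (hh : AnalyticAt ℂ (fun y : ℂ × ℂ => h y.1 y.2) (t, x)) : AnalyticAt ℂ (fun t => h t x) t :=
  hh.comp_of_eq (f := fun t => (t, x)) (AnalyticAt.prod analyticAt_id analyticAt_const) rfl

theorem analyticAt_clm_apply {h : ℂ × ℂ → ℂ × ℂ →L[ℂ] ℂ} {x : ℂ × ℂ} (hh : AnalyticAt ℂ h x)
    (v : ℂ × ℂ) : AnalyticAt ℂ (fun y => h y v) x :=
  ((ContinuousLinearMap.apply ℂ ℂ v).analyticAt (h x)).comp hh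

theorem deriv_fst_eq {h : ℂ → ℂ → ℂ} {t x : ℂ}
    (hh : AnalyticAt ℂ (fun y : ℂ × ℂ => h y.1 y.2) (t, x)) :
    deriv (fun t => h t x) t = fderiv ℂ (fun y : ℂ × ℂ => h y.1 y.2) (t, x) (1, 0) := by
  have h1 := hh.differentiableAt.hasFDerivAt
  have h2 : HasDerivAt (fun t : ℂ => (t, x)) (1, 0) t :=
    (hasDerivAt_id t).prodMk (hasDerivAt_const t x)
  exact (h1.comp_hasDerivAt t h2).deriv

theorem deriv_snd_eq {h : ℂ → ℂ → ℂ} {t x : ℂ}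
    (hh : AnalyticAt ℂ (fun y : ℂ × ℂ => h y.1 y.2) (t, x)) :
    deriv (h t) x = fderiv ℂ (fun y : ℂ × ℂ => h y.1 y.2) (t, x) (0, 1) := by
  have h1 := hh.differentiableAt.hasFDerivAt
  have h2 : HasDerivAt (fun x : ℂ => (t, x)) (0, 1) x :=
    (hasDerivAt_const x t).prodMk (hasDerivAt_id x)
  exact (h1.comp_hasDerivAt x h2).deriv

theorem analyticAt_deriv_fst {h : ℂ → ℂ → ℂ} {t x : ℂ}
    (hh : AnalyticAt ℂ (fun y : ℂ × ℂ => h y.1 y.2) (t, x)) :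
    AnalyticAt ℂ (fun x => deriv (fun t => h t x) t) x := by
  have h1 : AnalyticAt ℂ (fun y => fderiv ℂ (fun y : ℂ × ℂ => h y.1 y.2) (t, y) (1, 0)) x :=
    analyticAt_snd (h := fun t x => fderiv ℂ (fun y : ℂ × ℂ => h y.1 y.2) (t, x) (1, 0))
      (analyticAt_clm_apply hh.fderiv _)
  refine h1.congr ?_
  have h2 : ∀ᶠ y in 𝓝 x, AnalyticAt ℂ (fun y : ℂ × ℂ => h y.1 y.2) (t, y) :=
    (Continuous.tendsto (by fun_prop : Continuous fun y : ℂ => (t, y)) x).eventually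
      hh.eventually_analyticAt
  filter_upwards [h2] with y hy using (deriv_fst_eq hy).symm

/-- Mixed partial derivatives commute. -/
theorem deriv_deriv_comm {h : ℂ → ℂ → ℂ} {t x : ℂ}
    (hh : AnalyticAt ℂ (fun y : ℂ × ℂ => h y.1 y.2) (t, x)) :
    deriv (fun x => deriv (fun t => h t x) t) x = deriv (fun t => deriv (h t) x) t := by
  set Φ := fun y : ℂ × ℂ => h y.1 y.2
  have hx : ∀ᶠ y in 𝓝 x, AnalyticAt ℂ Φ (t, y) :=
    (Continuous.tendsto (by fun_prop : Continuous fun y : ℂ => (t, y)) x).eventually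
      hh.eventually_analyticAt
  have ht : ∀ᶠ s in 𝓝 t, AnalyticAt ℂ Φ (s, x) :=
    (Continuous.tendsto (by fun_prop : Continuous fun s : ℂ => (s, x)) t).eventually
      hh.eventually_analyticAt
  have e1 : (fun x => deriv (fun t => h t x) t) =ᶠ[𝓝 x] fun y => fderiv ℂ Φ (t, y) (1, 0) := by
    filter_upwards [hx] with y hy using deriv_fst_eq hy
  have e2 : (fun t => deriv (h t) x) =ᶠ[𝓝 t] fun s => fderiv ℂ Φ (s, x) (0, 1) := by
    filter_upwards [ht] with y hy using deriv_snd_eq hy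
  rw [e1.deriv_eq, e2.deriv_eq]
  have hd := hh.fderiv
  rw [deriv_snd_eq (h := fun t y => fderiv ℂ Φ (t, y) (1, 0)) (analyticAt_clm_apply hd _),
    deriv_fst_eq (h := fun t y => fderiv ℂ Φ (t, y) (0, 1)) (analyticAt_clm_apply hd _)]
  have hs : IsSymmSndFDerivAt ℂ Φ (t, x) :=
    (hh.contDiffAt (n := ⊤)).isSymmSndFDerivAt (by simp)
  rw [fderiv_clm_apply hd.differentiableAt (differentiableAt_const _),
    fderiv_clm_apply hd.differentiableAt (differentiableAt_const _)]
  simpa using hs (0, 1) (1, 0)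

theorem IsSA.congr {f' fz' : ℂ → evenPart N → Grassmann N} {ft' : evenPart N → Grassmann N}
    (h : IsSA U f fz ft)
    (h1 : ∀ t (z : evenPart N), (t, body (z : Grassmann N)) ∈ U → f' t z = f t z ∧ fz' t z = fz t z)
    (h2 : ∀ z : evenPart N, ((0 : ℂ), body (z : Grassmann N)) ∈ U → ft' z = ft z) :
    IsSA U f' fz' ft' := by
  obtain ⟨F, hF, hf, hft⟩ := h
  exact ⟨F, hF, fun t z hz => ⟨(h1 t z hz).1.trans (hf t z hz).1, (h1 t z hz).2.trans (hf t z hz).2⟩,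
    fun z hz => (h2 z hz).trans (hft z hz)⟩

theorem analytic_coeff {F : Comp N (ℂ → ℂ → ℂ)}
    (hF : ∀ K ∈ F.support, IsLow 2 K ∧ AnalyticOnNhd ℂ (fun x : ℂ × ℂ => F K x.1 x.2) U)
    (K : Finset (Gen N)) : AnalyticOnNhd ℂ (fun x : ℂ × ℂ => F K x.1 x.2) U := by
  by_cases h : K ∈ F.support
  · exact (hF K h).2
  · rw [Finsupp.notMem_support_iff.mp h]
    exact fun x _ => analyticAt_const

theorem IsSA.single {h : ℂ → ℂ → ℂ} (hh : AnalyticOnNhd ℂ (fun x : ℂ × ℂ => h x.1 x.2) U)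
    {K : Finset (Gen N)} (hK : IsLow 2 K) :
    IsSA U (fun t z => ext (h t) z * zeta K) (fun t z => ext (deriv (h t)) z * zeta K)
      (fun z => ext (fun x => deriv (fun t => h t x) 0) z * zeta K) := by
  have h0 : deriv (0 : ℂ → ℂ) = 0 := by funext x; exact deriv_const x 0
  have h1 : (fun x : ℂ => deriv (fun t : ℂ => (0 : ℂ → ℂ → ℂ) t x) 0) = 0 := by
    funext x; exact deriv_const _ 0
  refine ⟨Finsupp.single K h, fun L hL => ?_, fun t z _ => ⟨?_, ?_⟩, fun z _ => ?_⟩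
  · obtain rfl : L = K := by simpa using Finsupp.support_single_subset hL
    exact ⟨hK, by simpa using hh⟩
  · rw [Finsupp.sum_single_index]; rw [Pi.zero_apply, ext_zero, zero_mul]
  · rw [Finsupp.sum_single_index]; rw [Pi.zero_apply, h0, ext_zero, zero_mul]
  · rw [Finsupp.sum_single_index]; rw [h1, ext_zero, zero_mul]

theorem IsSA.zero : IsSA (N := N) U 0 0 0 :=
  ⟨0, by simp, fun t z _ => by simp, fun z _ => by simp⟩

theorem IsSA.add (hf : IsSA U f fz ft) (hg : IsSA U g gz gt) :
    IsSA U (f + g) (fz + gz) (ft + gt) := by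
  classical
  obtain ⟨F, hF, hf, hft⟩ := hf
  obtain ⟨G, hG, hg, hgt⟩ := hg
  have aF := analytic_coeff hF
  have aG := analytic_coeff hG
  -- `P` stands for the three operations in `IsSA`: the value at `t`, the derivative in `z`, and the
  -- derivative in `t` at 0.
  have key : ∀ (P : (ℂ → ℂ → ℂ) → ℂ → ℂ) (z : evenPart N), P 0 = 0 →
      (∀ K, P (F K + G K) =ᶠ[𝓝 (body (z : Grassmann N))] P (F K) + P (G K)) →
      (∀ K, AnalyticAt ℂ (P (F K)) (body (z : Grassmann N))) →
      (∀ K, AnalyticAt ℂ (P (G K)) (body (z : Grassmann N))) →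
      ((F + G).sum fun K g => ext (P g) z * zeta K) = (F.sum fun K g => ext (P g) z * zeta K) +
        G.sum fun K g => ext (P g) z * zeta K := by
    intro P z h0 hP a1 a2
    have hz0 : ∀ K ∈ F.support ∪ G.support, ext (P 0) (z : Grassmann N) * zeta K = 0 :=
      fun K _ => by rw [h0, ext_zero, zero_mul]
    rw [Finsupp.sum_of_support_subset _ Finsupp.support_add _ hz0,
      Finsupp.sum_of_support_subset _ Finset.subset_union_left _ hz0,
      Finsupp.sum_of_support_subset _ Finset.subset_union_right _ hz0, ← Finset.sum_add_distrib]
    refine Finset.sum_congr rfl fun K _ => ?_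
    rw [Finsupp.add_apply, ext_congr (hP K), ext_add z.2 (a1 K) (a2 K), add_mul]
  refine ⟨F + G, fun K hK => ?_, fun t z hz => ⟨?_, ?_⟩, fun z hz => ?_⟩
  · refine ⟨?_, fun x hx => ?_⟩
    · rcases Finset.mem_union.mp (Finsupp.support_add hK) with h | h
      exacts [(hF K h).1, (hG K h).1]
    · exact (aF K x hx).add (aG K x hx)
  · rw [key (fun g => g t) z rfl (fun K => Filter.EventuallyEq.rfl)
      (fun K => analyticAt_snd (aF K _ hz)) (fun K => analyticAt_snd (aG K _ hz)),
      ← (hf t z hz).1, ← (hg t z hz).1]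
    rfl
  · rw [key (fun g => deriv (g t)) z (by funext x; exact deriv_const x 0) (fun K => ?_)
      (fun K => (analyticAt_snd (aF K _ hz)).deriv) (fun K => (analyticAt_snd (aG K _ hz)).deriv),
      ← (hf t z hz).2, ← (hg t z hz).2]
    · rfl
    · filter_upwards [(analyticAt_snd (aF K _ hz)).eventually_analyticAt,
        (analyticAt_snd (aG K _ hz)).eventually_analyticAt] with y h1 h2
      exact deriv_add h1.differentiableAt h2.differentiableAt
  · rw [key (fun g x => deriv (fun t => g t x) 0) z (by funext x; exact deriv_const _ 0)
      (fun K => ?_)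
      (fun K => analyticAt_deriv_fst (aF K _ hz)) (fun K => analyticAt_deriv_fst (aG K _ hz)),
      ← hft z hz, ← hgt z hz]
    · rfl
    · have hc : Filter.Tendsto (fun y : ℂ => ((0 : ℂ), y)) (𝓝 (body (z : Grassmann N)))
          (𝓝 ((0 : ℂ), body (z : Grassmann N))) :=
        Continuous.tendsto (by fun_prop) _
      filter_upwards [hc.eventually (aF K _ hz).eventually_analyticAt,
        hc.eventually (aG K _ hz).eventually_analyticAt] with y h1 h2
      exact deriv_add (analyticAt_fst h1).differentiableAt (analyticAt_fst h2).differentiableAt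

theorem IsSA.sum {ι : Type*} (s : Finset ι) {f fz : ι → ℂ → evenPart N → Grassmann N}
    {ft : ι → evenPart N → Grassmann N} (h : ∀ i ∈ s, IsSA U (f i) (fz i) (ft i)) :
    IsSA U (∑ i ∈ s, f i) (∑ i ∈ s, fz i) (∑ i ∈ s, ft i) := by
  classical
  induction s using Finset.induction_on with
  | empty => exact IsSA.zero
  | insert a s ha ih =>
    rw [Finset.sum_insert ha, Finset.sum_insert ha, Finset.sum_insert ha]
    exact (h a (by simp)).add (ih fun i hi => h i (Finset.mem_insert_of_mem hi))

/-- The product of two monomials is zero or, up to a sign σ, a single monomial; the sign is absorbed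
into the coefficient and the derivatives follow from Leibniz. -/
theorem IsSA.mul_single {h k : ℂ → ℂ → ℂ}
    (hh : AnalyticOnNhd ℂ (fun x : ℂ × ℂ => h x.1 x.2) U)
    (hk : AnalyticOnNhd ℂ (fun x : ℂ × ℂ => k x.1 x.2) U)
    {K L : Finset (Gen N)} (hK : IsLow 2 K) (hL : IsLow 2 L) :
    IsSA U (fun t z => (ext (h t) z * zeta K) * (ext (k t) z * zeta L))
      (fun t z => (ext (deriv (h t)) z * zeta K) * (ext (k t) z * zeta L) +
        (ext (h t) z * zeta K) * (ext (deriv (k t)) z * zeta L))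
      (fun z => (ext (fun x => deriv (fun t => h t x) 0) z * zeta K) * (ext (k 0) z * zeta L) +
        (ext (h 0) z * zeta K) * (ext (fun x => deriv (fun t => k t x) 0) z * zeta L)) := by
  have hcomm : ∀ (a b : ℂ → ℂ) (z : evenPart N), (ext a z * zeta K) * (ext b z * zeta L) =
      ext a (z : Grassmann N) * ext b (z : Grassmann N) * (zeta K * zeta L) := fun a b z => by
    rw [mul_assoc, ← mul_assoc (zeta K), ← (commute_of_even (ext_mem z.2) (zeta K)).eq]
    simp only [mul_assoc]
  simp only [hcomm]
  by_cases hd : Disjoint K L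
  · have main : ∀ σ : ℂ, zeta K * zeta L = σ • zeta (K ∪ L) →
      IsSA (N := N) U (fun t z => ext (h t) z * ext (k t) z * (zeta K * zeta L))
        (fun t z => ext (deriv (h t)) z * ext (k t) z * (zeta K * zeta L) +
          ext (h t) z * ext (deriv (k t)) z * (zeta K * zeta L))
        (fun z => ext (fun x => deriv (fun t => h t x) 0) z * ext (k 0) z * (zeta K * zeta L) +
          ext (h 0) z * ext (fun x => deriv (fun t => k t x) 0) z * (zeta K * zeta L)) := by
      intro σ hσ
      have hsm : ∀ (a : ℂ → ℂ) (z : evenPart N), AnalyticAt ℂ a (body (z : Grassmann N)) →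
          ext (fun x => σ * a x) z = σ • ext a (z : Grassmann N) := fun a z ha => by
        have := ext_mul (g := fun _ => σ) z.2 analyticAt_const ha
        rw [ext_const, ← Algebra.smul_def] at this
        exact this
      have hkh : AnalyticOnNhd ℂ (fun x : ℂ × ℂ => σ * (h x.1 x.2 * k x.1 x.2)) U :=
        analyticOnNhd_const.mul (hh.mul hk)
      refine (IsSA.single (h := fun t x => σ * (h t x * k t x)) hkh (hK.union hL)).congr
        (fun t z hz => ⟨?_, ?_⟩) fun z hz => ?_
      · have a1 := analyticAt_snd (hh _ hz)
        have a2 := analyticAt_snd (hk _ hz)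
        rw [hsm _ _ (a1.fun_mul a2), show (fun x => h t x * k t x) = h t * k t from rfl,
          ext_mul z.2 a1 a2, hσ, mul_smul_comm, smul_mul_assoc]
      · have a1 := analyticAt_snd (hh _ hz)
        have a2 := analyticAt_snd (hk _ hz)
        have e : deriv (fun x => σ * (h t x * k t x)) =ᶠ[𝓝 (body (z : Grassmann N))]
            fun x => σ * (deriv (h t) * k t + h t * deriv (k t)) x := by
          filter_upwards [a1.eventually_analyticAt, a2.eventually_analyticAt] with y h1 h2
          rw [deriv_const_mul_field, deriv_fun_mul h1.differentiableAt h2.differentiableAt]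
          rfl
        rw [ext_congr e, hsm _ _ ((a1.deriv.mul a2).add (a1.mul a2.deriv)),
          ext_add z.2 (a1.deriv.mul a2) (a1.mul a2.deriv), ext_mul z.2 a1.deriv a2,
          ext_mul z.2 a1 a2.deriv, hσ, mul_smul_comm, mul_smul_comm, smul_add, add_mul,
          smul_mul_assoc, smul_mul_assoc]
      · have a1 := analyticAt_snd (hh _ hz)
        have a2 := analyticAt_snd (hk _ hz)
        have b1 := analyticAt_deriv_fst (hh _ hz)
        have b2 := analyticAt_deriv_fst (hk _ hz)
        have hc : Filter.Tendsto (fun y : ℂ => ((0 : ℂ), y)) (𝓝 (body (z : Grassmann N)))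
            (𝓝 ((0 : ℂ), body (z : Grassmann N))) :=
          Continuous.tendsto (by fun_prop) _
        have e : (fun x => deriv (fun t => σ * (h t x * k t x)) 0) =ᶠ[𝓝 (body (z : Grassmann N))]
            fun x => σ * ((fun x => deriv (fun t => h t x) 0) * k 0 +
              h 0 * fun x => deriv (fun t => k t x) 0) x := by
          filter_upwards [hc.eventually (hh _ hz).eventually_analyticAt,
            hc.eventually (hk _ hz).eventually_analyticAt] with y h1 h2
          rw [deriv_const_mul_field, deriv_fun_mul (analyticAt_fst h1).differentiableAt
            (analyticAt_fst h2).differentiableAt]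
          rfl
        rw [ext_congr e, hsm _ _ ((b1.mul a2).add (a1.mul b2)),
          ext_add z.2 (b1.mul a2) (a1.mul b2), ext_mul z.2 b1 a2,
          ext_mul z.2 a1 b2, hσ, mul_smul_comm, mul_smul_comm, smul_add, add_mul,
          smul_mul_assoc, smul_mul_assoc]
    rcases zeta_mul_zeta_of_disjoint hd with h1 | h1
    · exact main 1 (by rw [h1, one_smul])
    · exact main (-1) (by rw [h1, neg_one_smul])
  · rw [zeta_mul_zeta_of_not_disjoint hd]
    simp only [mul_zero, add_zero]
    exact IsSA.zero

theorem IsSA.mul (hf : IsSA U f fz ft) (hg : IsSA U g gz gt) :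
    IsSA U (f * g) (fz * g + f * gz) (ft * g 0 + f 0 * gt) := by
  obtain ⟨F, hF, hf, hft⟩ := hf
  obtain ⟨G, hG, hg, hgt⟩ := hg
  refine (IsSA.sum (F.support ×ˢ G.support) fun i hi => IsSA.mul_single
    (hF i.1 (Finset.mem_product.mp hi).1).2 (hG i.2 (Finset.mem_product.mp hi).2).2
    (hF i.1 (Finset.mem_product.mp hi).1).1 (hG i.2 (Finset.mem_product.mp hi).2).1).congr
    (fun t z hz => ⟨?_, ?_⟩) fun z hz => ?_
  · rw [Pi.mul_apply, Pi.mul_apply, (hf t z hz).1, (hg t z hz).1]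
    simp only [Finsupp.sum, Finset.sum_apply, Finset.sum_mul_sum, Finset.sum_product]
  · simp only [Pi.add_apply, Pi.mul_apply]
    rw [(hf t z hz).1, (hg t z hz).1, (hf t z hz).2, (hg t z hz).2]
    simp only [Finsupp.sum, Finset.sum_apply, Finset.sum_mul_sum, Finset.sum_product,
      Finset.sum_add_distrib]
  · simp only [Pi.add_apply, Pi.mul_apply]
    rw [(hf 0 z hz).1, (hg 0 z hz).1, hft z hz, hgt z hz]
    simp only [Finsupp.sum, Finset.sum_apply, Finset.sum_mul_sum, Finset.sum_product,
      Finset.sum_add_distrib]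

end Families

/-! ### Constants, variables, uniqueness of the derivatives, integer powers and inverses -/

section Families

variable {N : ℕ∞} {U : Set (ℂ × ℂ)} {f fz g gz : ℂ → evenPart N → Grassmann N}
  {ft gt : evenPart N → Grassmann N}

theorem IsSA.scalar {h : ℂ → ℂ → ℂ} (hh : AnalyticOnNhd ℂ (fun x : ℂ × ℂ => h x.1 x.2) U) :
    IsSA (N := N) U (fun t z => ext (h t) z) (fun t z => ext (deriv (h t)) z)
      (fun z => ext (fun x => deriv (fun t => h t x) 0) z) := by
  have := IsSA.single (N := N) hh isLow_empty
  simpa only [zeta_empty, mul_one] using this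

theorem IsSA.const {c : Grassmann N} {j : ZMod 2} (hc : c ∈ grPart N 2 j) :
    IsSA U (fun _ _ => c) 0 0 := by
  have h1 : ∀ a : ℂ, IsSA (N := N) U (fun _ _ => algebraMap ℂ _ a) 0 0 := fun a => by
    refine (IsSA.scalar (h := fun _ _ => a) analyticOnNhd_const).congr (fun t z _ => ⟨?_, ?_⟩)
      fun z _ => ?_
    · exact (ext_const a _).symm
    · simp only [deriv_const']; exact ((ext_const 0 _).trans (map_zero _)).symm
    · simp only [deriv_const]; exact ((ext_const 0 _).trans (map_zero _)).symm
  induction hc using Submodule.span_induction with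
  | mem x hx =>
    obtain ⟨K, hK, -, rfl⟩ := hx
    refine (IsSA.single (h := fun _ _ => 1) analyticOnNhd_const hK).congr (fun t z _ => ⟨?_, ?_⟩)
      fun z _ => ?_
    · rw [ext_const, map_one, one_mul]
    · simp only [deriv_const', Pi.zero_apply]; rw [ext_const, map_zero, zero_mul]
    · simp only [deriv_const, Pi.zero_apply]; rw [ext_const, map_zero, zero_mul]
  | zero => exact IsSA.zero
  | add x y _ _ hx hy => exact (hx.add hy).congr (fun _ _ _ => by simp) (fun _ _ => by simp)
  | smul a x _ hx =>
    exact ((h1 a).mul hx).congr (fun _ _ _ => by simp [Algebra.smul_def]) (fun _ _ => by simp)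

theorem IsSA.neg (h : IsSA U f fz ft) : IsSA U (-f) (-fz) (-ft) := by
  have h1 : (-1 : Grassmann N) ∈ grPart N 2 0 := Submodule.neg_mem _ one_mem_grPart
  exact ((IsSA.const h1).mul h).congr (fun _ _ _ => by simp) (fun _ _ => by simp)

theorem IsSA.param : IsSA (N := N) U (fun t _ => algebraMap ℂ _ t) 0 1 := by
  refine (IsSA.scalar (h := fun t _ => t) ?_).congr (fun t z _ => ⟨?_, ?_⟩) fun z _ => ?_
  · exact fun x _ => _root_.analyticAt_fst
  · rw [ext_const]
  · simp only [deriv_const', Pi.zero_apply]; rw [ext_const, map_zero]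
  · simp only [deriv_id'', Pi.one_apply]; rw [ext_const, map_one]

theorem IsSA.var : IsSA (N := N) U (fun _ z => z) 1 0 := by
  refine (IsSA.scalar (h := fun _ x => x) ?_).congr (fun t z _ => ⟨?_, ?_⟩) fun z _ => ?_
  · exact fun x _ => _root_.analyticAt_snd
  · rw [ext_id z.2]
  · simp only [deriv_id'', Pi.one_apply]; rw [ext_const, map_one]
  · simp only [deriv_const, Pi.zero_apply]; rw [ext_const, map_zero]

theorem coord_sum (F : Comp N (ℂ → ℂ → ℂ)) (P : (ℂ → ℂ → ℂ) → ℂ → ℂ) (hP : P 0 = 0) (x : ℂ)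
    (K : Finset (Gen N)) :
    coord K (F.sum fun K g => ext (P g) (algebraMap ℂ (Grassmann N) x) * zeta K) = P (F K) x := by
  classical
  simp only [ext_algebraMap, ← Algebra.smul_def]
  rw [Finsupp.sum, map_sum]
  simp only [map_smul, coord_zeta, smul_eq_mul, mul_ite, mul_one, mul_zero]
  rw [Finset.sum_ite_eq']
  split_ifs with h
  · rfl
  · rw [Finsupp.notMem_support_iff.mp h, hP, Pi.zero_apply]

/-- At complex values of z the coordinates of the value are the coefficients themselves, so values
determine coefficients on `U`, and therefore their derivatives. Openness of `U` is needed to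
differentiate the equality. -/
theorem IsSA.unique (hU : IsOpen U) (hf : IsSA U f fz ft) (hg : IsSA U g gz gt)
    (h : ∀ t (z : evenPart N), (t, body (z : Grassmann N)) ∈ U → f t z = g t z) :
    (∀ t (z : evenPart N), (t, body (z : Grassmann N)) ∈ U → fz t z = gz t z) ∧
    ∀ z : evenPart N, ((0 : ℂ), body (z : Grassmann N)) ∈ U → ft z = gt z := by
  classical
  obtain ⟨F, hF, hf, hft⟩ := hf
  obtain ⟨G, hG, hg, hgt⟩ := hg
  have key : ∀ K t x, (t, x) ∈ U → F K t x = G K t x := by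
    intro K t x hx
    have hb : body ((algebraMap ℂ (evenPart N) x : evenPart N) : Grassmann N) = x :=
      body_algebraMap x
    have e := h t (algebraMap ℂ (evenPart N) x) (by rwa [hb])
    rw [(hf t _ (by rwa [hb])).1, (hg t _ (by rwa [hb])).1] at e
    have e2 := congrArg (coord K) e
    have hz : ((algebraMap ℂ (evenPart N) x : evenPart N) : Grassmann N) = algebraMap ℂ _ x := rfl
    rw [hz] at e2
    rwa [coord_sum F (fun g => g t) rfl x K, coord_sum G (fun g => g t) rfl x K] at e2
  have sums : ∀ (P : (ℂ → ℂ → ℂ) → ℂ → ℂ) (z : evenPart N), P 0 = 0 →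
      (∀ K, P (F K) =ᶠ[𝓝 (body (z : Grassmann N))] P (G K)) →
      (F.sum fun K g => ext (P g) (z : Grassmann N) * zeta K) =
        G.sum fun K g => ext (P g) z * zeta K := by
    intro P z h0 hP
    have hz0 : ∀ K ∈ F.support ∪ G.support, ext (P 0) (z : Grassmann N) * zeta K = 0 :=
      fun K _ => by rw [h0, ext_zero, zero_mul]
    rw [Finsupp.sum_of_support_subset _ Finset.subset_union_left _ hz0,
      Finsupp.sum_of_support_subset _ Finset.subset_union_right _ hz0]
    exact Finset.sum_congr rfl fun K _ => by rw [ext_congr (hP K)]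
  refine ⟨fun t z hz => ?_, fun z hz => ?_⟩
  · rw [(hf t z hz).2, (hg t z hz).2]
    refine sums (fun g => deriv (g t)) z (by funext x; exact deriv_const x 0) fun K => ?_
    have : F K t =ᶠ[𝓝 (body (z : Grassmann N))] G K t := by
      filter_upwards [(hU.preimage (by fun_prop : Continuous fun y : ℂ => (t, y))).mem_nhds hz]
        with y hy using key K t y hy
    exact this.deriv
  · rw [hft z hz, hgt z hz]
    refine sums (fun g x => deriv (fun t => g t x) 0) z (by funext x; exact deriv_const _ 0)
      fun K => ?_
    filter_upwards [(hU.preimage (by fun_prop : Continuous fun y : ℂ => ((0 : ℂ), y))).mem_nhds hz]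
      with y hy
    refine Filter.EventuallyEq.deriv_eq ?_
    filter_upwards [(hU.preimage (by fun_prop : Continuous fun t : ℂ => (t, y))).mem_nhds hy]
      with t ht using key K t y ht

/-- If `f` differs from an invertible `b` by a multiple of a nilpotent, then `1 - f * B` is
nilpotent and the Neumann series is finite. -/
theorem mul_geom_sum_eq_one {R : Type*} [CommRing R] {f b B s : R} {M : ℕ} (hs : s ^ M = 0)
    (hb : b * B = 1) (h : s ∣ f - b) :
    f * (B * ∑ k ∈ Finset.range M, (1 - f * B) ^ k) = 1 := by
  have h0 : (1 - f * B) ^ M = 0 := by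
    obtain ⟨y, hy⟩ := h
    have : 1 - f * B = s * (-(y * B)) := by
      linear_combination (-B) * hy - hb
    rw [this, mul_pow, hs, zero_mul]
  have := mul_neg_geom_sum (1 - f * B) M
  rwa [h0, sub_zero, sub_sub_cancel, mul_assoc] at this

/-- `IsSA` for even-valued functions. -/
def IsSAE (U : Set (ℂ × ℂ)) (f fz : ℂ → evenPart N → evenPart N)
    (ft : evenPart N → evenPart N) : Prop :=
  IsSA U (fun t z => (f t z : Grassmann N)) (fun t z => (fz t z : Grassmann N))
    (fun z => (ft z : Grassmann N))

/-! ### Even-valued families: powers and inverses -/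

section Even

variable {f fz g gz : ℂ → evenPart N → evenPart N} {ft gt : evenPart N → evenPart N}

theorem IsSAE.add (hf : IsSAE U f fz ft) (hg : IsSAE U g gz gt) :
    IsSAE U (f + g) (fz + gz) (ft + gt) :=
  (IsSA.add hf hg).congr (fun _ _ _ => by simp) (fun _ _ => by simp)

theorem IsSAE.neg (hf : IsSAE U f fz ft) : IsSAE U (-f) (-fz) (-ft) :=
  (IsSA.neg hf).congr (fun _ _ _ => by simp) (fun _ _ => by simp)

theorem IsSAE.mul (hf : IsSAE U f fz ft) (hg : IsSAE U g gz gt) :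
    IsSAE U (f * g) (fz * g + f * gz) (ft * g 0 + f 0 * gt) :=
  (IsSA.mul hf hg).congr (fun _ _ _ => by simp) (fun _ _ => by simp)

theorem IsSAE.const {c : evenPart N} (hc : (c : Grassmann N) ∈ grPart N 2 0) :
    IsSAE U (fun _ _ => c) 0 0 :=
  (IsSA.const hc).congr (fun _ _ _ => by simp) (fun _ _ => by simp)

theorem IsSAE.one : IsSAE (N := N) U 1 0 0 :=
  (IsSAE.const (c := 1) one_mem_grPart).congr (fun _ _ _ => by simp) (fun _ _ => by simp)

theorem IsSAE.constC (a : ℂ) : IsSAE (N := N) U (fun _ _ => algebraMap ℂ _ a) 0 0 :=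
  IsSAE.const (algebraMap_mem_grPart a)

theorem IsSAE.param : IsSAE (N := N) U (fun t _ => algebraMap ℂ _ t) 0 1 :=
  (IsSA.param).congr (fun _ _ _ => by simp) (fun _ _ => by simp)

theorem IsSAE.var : IsSAE (N := N) U (fun _ z => z) 1 0 :=
  (IsSA.var).congr (fun _ _ _ => by simp) (fun _ _ => by simp)

theorem IsSAE.congr {f' fz' : ℂ → evenPart N → evenPart N} {ft' : evenPart N → evenPart N}
    (h : IsSAE U f fz ft)
    (h1 : ∀ t (z : evenPart N), (t, body (z : Grassmann N)) ∈ U → f' t z = f t z ∧ fz' t z = fz t z)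
    (h2 : ∀ z : evenPart N, ((0 : ℂ), body (z : Grassmann N)) ∈ U → ft' z = ft z) :
    IsSAE U f' fz' ft' :=
  IsSA.congr h (fun t z hz => ⟨by rw [(h1 t z hz).1], by rw [(h1 t z hz).2]⟩)
    fun z hz => by rw [h2 z hz]

theorem IsSAE.pow (hf : IsSAE U f fz ft) (k : ℕ) :
    IsSAE U (f ^ k) (k • (f ^ (k - 1) * fz)) (k • (f 0 ^ (k - 1) * ft)) := by
  induction k with
  | zero => simpa using IsSAE.one
  | succ k ih =>
    refine (ih.mul hf).congr (fun t z _ => ⟨by simp [pow_succ], ?_⟩) fun z _ => ?_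
    all_goals
      rcases k with _ | k
      · simp
      · simp [pow_succ]; ring

/-- Integer powers, with the convention `0⁻¹ = 0` for non-units. -/
def zp (x : evenPart N) : ℤ → evenPart N
  | .ofNat k => x ^ k
  | .negSucc k => Ring.inverse x ^ (k + 1)

theorem zp_unit (u : (evenPart N)ˣ) (k : ℤ) : zp (u : evenPart N) k = ((u ^ k : (evenPart N)ˣ) :
    evenPart N) := by
  cases k with
  | ofNat k => simp [zp]
  | negSucc k => simp [zp]

theorem IsSAE.zp_of_inverse (hf : IsSAE U f fz ft)
    (hu : ∀ t (z : evenPart N), (t, body (z : Grassmann N)) ∈ U → IsUnit (f t z))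
    (hi : IsSAE U (fun t z => Ring.inverse (f t z)) (fun t z => -(Ring.inverse (f t z) ^ 2 * fz t z))
      (fun z => -(Ring.inverse (f 0 z) ^ 2 * ft z))) (k : ℤ) :
    IsSAE U (fun t z => zp (f t z) k) (fun t z => (k : evenPart N) * zp (f t z) (k - 1) * fz t z)
      (fun z => (k : evenPart N) * zp (f 0 z) (k - 1) * ft z) := by
  cases k with
  | ofNat k =>
    have key : ∀ x : evenPart N, IsUnit x → ∀ y, ((Int.ofNat k : ℤ) : evenPart N) *
        zp x (Int.ofNat k - 1) * y = k • (x ^ (k - 1) * y) := by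
      rintro _ ⟨u, rfl⟩ y
      rw [zp_unit]
      rcases k with _ | k
      · simp
      · simp [mul_assoc]
    exact (hf.pow k).congr (fun t z hz => ⟨rfl, key _ (hu t z hz) _⟩) fun z hz => key _ (hu 0 z hz) _
  | negSucc k =>
    have key : ∀ x : evenPart N, IsUnit x → ∀ y, ((Int.negSucc k : ℤ) : evenPart N) *
        zp x (Int.negSucc k - 1) * y =
        (k + 1) • (Ring.inverse x ^ (k + 1 - 1) * -(Ring.inverse x ^ 2 * y)) := by
      rintro _ ⟨u, rfl⟩ y
      rw [zp_unit, Ring.inverse_unit, show Int.negSucc k - 1 = -((k + 2 : ℕ) : ℤ) by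
        rw [Int.negSucc_eq]; push_cast; ring, zpow_neg, zpow_natCast, ← inv_pow, Int.cast_negSucc]
      simp [nsmul_eq_mul]
      ring
    exact (hi.pow (k + 1)).congr (fun t z hz => ⟨rfl, key _ (hu t z hz) _⟩)
      fun z hz => key _ (hu 0 z hz) _

/-- The value of an analytic function as an element of the even part. -/
def extE (g : ℂ → ℂ) (z : evenPart N) : evenPart N := ⟨ext g z, ext_mem z.2⟩

theorem extE_mul {g h : ℂ → ℂ} {z : evenPart N} (hg : AnalyticAt ℂ g (body (z : Grassmann N)))
    (hh : AnalyticAt ℂ h (body (z : Grassmann N))) : extE (g * h) z = extE g z * extE h z :=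
  Subtype.ext (ext_mul z.2 hg hh)

theorem extE_congr {g h : ℂ → ℂ} {z : evenPart N} (hgh : g =ᶠ[𝓝 (body (z : Grassmann N))] h) :
    extE g z = extE h z :=
  Subtype.ext (ext_congr hgh)

theorem extE_const (a : ℂ) (z : evenPart N) : extE (fun _ => a) z = algebraMap ℂ _ a :=
  Subtype.ext (ext_const a _)

theorem extE_one (z : evenPart N) : extE (fun _ => 1) z = 1 := by
  rw [extE_const, map_one]

theorem IsSAE.scalar {h : ℂ → ℂ → ℂ} (hh : AnalyticOnNhd ℂ (fun x : ℂ × ℂ => h x.1 x.2) U) :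
    IsSAE (N := N) U (fun t z => extE (h t) z) (fun t z => extE (deriv (h t)) z)
      (fun z => extE (fun x => deriv (fun t => h t x) 0) z) :=
  IsSA.scalar hh

/-- The function `f` is compared with an ordinary analytic function `b` without zeros, from which it
differs by a multiple of one fixed nilpotent `s`. One exponent `M` thus works at all points, and the
inverse is a fixed polynomial expression in `f` and 1/b. -/
theorem IsSAE.inverse (hU : IsOpen U) (hf : IsSAE U f fz ft) {b : ℂ → ℂ → ℂ}
    (hb : AnalyticOnNhd ℂ (fun x : ℂ × ℂ => b x.1 x.2) U)
    (hb0 : ∀ x ∈ U, b x.1 x.2 ≠ 0) {s : evenPart N} (hs : IsNilpotent s)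
    (hdvd : ∀ t (z : evenPart N), (t, body (z : Grassmann N)) ∈ U → s ∣ f t z - extE (b t) z) :
    (∀ t (z : evenPart N), (t, body (z : Grassmann N)) ∈ U → IsUnit (f t z)) ∧
    IsSAE U (fun t z => Ring.inverse (f t z)) (fun t z => -(Ring.inverse (f t z) ^ 2 * fz t z))
      (fun z => -(Ring.inverse (f 0 z) ^ 2 * ft z)) := by
  obtain ⟨M, hM⟩ := hs
  have hB := IsSAE.scalar (N := N) (h := fun t x => (b t x)⁻¹) (hb.inv hb0)
  set B : ℂ → evenPart N → evenPart N := fun t z => extE (fun x => (b t x)⁻¹) z with hBd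
  have hBb : ∀ t (z : evenPart N), (t, body (z : Grassmann N)) ∈ U → extE (b t) z * B t z = 1 := by
    intro t z hz
    have a1 := analyticAt_snd (hb _ hz)
    have a2 : AnalyticAt ℂ (fun x => (b t x)⁻¹) (body (z : Grassmann N)) := a1.inv (hb0 _ hz)
    rw [hBd, ← extE_mul a1 a2]
    have e : b t * (fun x => (b t x)⁻¹) =ᶠ[𝓝 (body (z : Grassmann N))] fun _ => 1 := by
      filter_upwards [a1.continuousAt.eventually_ne (hb0 _ hz)] with x hx
      exact mul_inv_cancel₀ hx
    rw [extE_congr e, extE_one]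
  have hmul : ∀ t (z : evenPart N), (t, body (z : Grassmann N)) ∈ U →
      f t z * (B t z * ∑ k ∈ Finset.range M, (1 - f t z * B t z) ^ k) = 1 := by
    exact fun t z hz => mul_geom_sum_eq_one hM (hBb t z hz) (hdvd t z hz)
  have hunit : ∀ t (z : evenPart N), (t, body (z : Grassmann N)) ∈ U → IsUnit (f t z) :=
    fun t z hz => IsUnit.of_mul_eq_one _ (hmul t z hz)
  have hinv : ∀ t (z : evenPart N), (t, body (z : Grassmann N)) ∈ U → Ring.inverse (f t z) =
      B t z * ∑ k ∈ Finset.range M, (1 - f t z * B t z) ^ k := by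
    intro t z hz
    obtain ⟨u, hu⟩ := hunit t z hz
    have h1 := hmul t z hz
    rw [← hu] at h1 ⊢
    rw [Ring.inverse_unit]
    calc ((u⁻¹ : (evenPart N)ˣ) : evenPart N) = ↑u⁻¹ * (↑u * (B t z *
          ∑ k ∈ Finset.range M, (1 - ↑u * B t z) ^ k)) := by rw [h1, mul_one]
      _ = _ := by rw [← mul_assoc, Units.inv_mul, one_mul]
  refine ⟨hunit, ?_⟩
  have hE : ∃ gz gt, IsSA U (fun t z => ((Ring.inverse (f t z) : evenPart N) : Grassmann N))
      gz gt := by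
    have h1 : IsSAE U (1 + -(f * B)) _ _ := IsSAE.one.add (hf.mul hB).neg
    have h2 := IsSA.sum (Finset.range M) fun k _ => h1.pow k
    refine ⟨_, _, (IsSA.mul hB h2).congr (fun t z hz => ⟨?_, rfl⟩) fun z hz => rfl⟩
    rw [hinv t z hz]
    simp [Finset.sum_apply, sub_eq_add_neg]
  obtain ⟨gz, gt, hg⟩ := hE
  -- The derivatives of the Neumann sum need not be computed: by uniqueness the product rule for f ·
  -- f⁻¹ must give the derivatives of the constant 1.
  have huniq := (IsSA.mul hf hg).unique hU (IsSAE.one (N := N)) fun t z hz => by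
    change ((f t z : evenPart N) : Grassmann N) * (Ring.inverse (f t z) : evenPart N) = 1
    have := Ring.mul_inverse_cancel _ (hunit t z hz)
    exact congrArg Subtype.val this
  have solve : ∀ (x : evenPart N) (y w : Grassmann N), IsUnit x →
      y * (Ring.inverse x : evenPart N) + x * w = 0 →
      -(((Ring.inverse x : evenPart N) : Grassmann N) ^ 2 * y) = w := by
    intro x y w hx h
    have h1 : ((Ring.inverse x : evenPart N) : Grassmann N) * x = 1 :=
      congrArg Subtype.val (Ring.inverse_mul_cancel _ hx)
    have h2 : y * (Ring.inverse x : evenPart N) = (Ring.inverse x : evenPart N) * y :=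
      ((commute_of_even (Ring.inverse x).2 y).eq).symm
    rw [h2] at h
    have h3 := congrArg (((Ring.inverse x : evenPart N) : Grassmann N) * ·) h
    simp only [mul_add, mul_zero, ← mul_assoc, h1, one_mul] at h3
    rw [sq]
    exact (eq_neg_of_add_eq_zero_right h3).symm
  refine IsSA.congr hg (fun t z hz => ⟨rfl, ?_⟩) fun z hz => ?_
  · simpa using solve (f t z) _ _ (hunit t z hz) (huniq.1 t z hz)
  · simpa using solve (f 0 z) _ _ (hunit 0 z hz) (huniq.2 z hz)

end Even

end Families

/-! ### Superfunctions at points -/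

section Superfunctions

variable {N : ℕ∞}

/-- The even coordinate of a point. -/
def Point.z (p : Point N) : evenPart N := ⟨p.1 0, p.2.1⟩

theorem Point.coe_z (p : Point N) : (p.z : Grassmann N) = p.1 0 := rfl

theorem Point.body_z (p : Point N) : N2Sphere.body (p.z : Grassmann N) = p.body := rfl

/-- The combination `a₀ + θ⁺ a₁ + θ⁻ a₂ + θ⁺ θ⁻ a₃`. -/
def ev4 (a : Fin 4 → Grassmann N) (p : Point N) : Grassmann N :=
  a 0 + p.1 1 * a 1 + p.1 2 * a 2 + p.1 1 * p.1 2 * a 3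

/-- The components of `D⁺ F` in terms of those of `F` and of `∂F/∂z`. -/
def compDplus (a a' : Fin 4 → Grassmann N) : Fin 4 → Grassmann N := ![a 1, 0, a 3 + a' 0, -a' 1]

/-- The components of `D⁻ F` in terms of those of `F` and of `∂F/∂z`. -/
def compDminus (a a' : Fin 4 → Grassmann N) : Fin 4 → Grassmann N := ![a 2, a' 0 - a 3, 0, a' 2]

theorem Comp.eval_zero (z : Grassmann N) : Comp.eval (0 : Comp N (ℂ → ℂ)) z = 0 := by
  simp [Comp.eval]

theorem Comp.eval_neg (F : Comp N (ℂ → ℂ)) (z : Grassmann N) :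
    Comp.eval (-F) z = -Comp.eval F z := by
  rw [Comp.eval, Comp.eval, Finsupp.sum_neg_index (fun K => by rw [ext_zero, zero_mul]),
    Finsupp.sum, Finsupp.sum, ← Finset.sum_neg_distrib]
  exact Finset.sum_congr rfl fun K _ => by rw [ext_neg, neg_mul]

theorem Comp.eval_add {F G : Comp N (ℂ → ℂ)} {z : Grassmann N} (hz : z ∈ grPart N 0 0)
    (hF : ∀ K, AnalyticAt ℂ (F K) (body z)) (hG : ∀ K, AnalyticAt ℂ (G K) (body z)) :
    Comp.eval (F + G) z = Comp.eval F z + Comp.eval G z := by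
  classical
  have hz0 : ∀ K ∈ F.support ∪ G.support, ext 0 z * zeta K = 0 :=
    fun K _ => by rw [ext_zero, zero_mul]
  rw [Comp.eval, Comp.eval, Comp.eval, Finsupp.sum_of_support_subset _ Finsupp.support_add _ hz0,
    Finsupp.sum_of_support_subset _ Finset.subset_union_left _ hz0,
    Finsupp.sum_of_support_subset _ Finset.subset_union_right _ hz0, ← Finset.sum_add_distrib]
  refine Finset.sum_congr rfl fun K _ => ?_
  rw [Finsupp.add_apply, ext_add hz (hF K) (hG K), add_mul]

theorem Comp.eval_mapRange {E : Type} [Zero E] (F : Comp N E) (P : E → ℂ → ℂ) (hP : P 0 = 0)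
    (z : Grassmann N) :
    Comp.eval (F.mapRange P hP) z = F.sum fun K g => ext (P g) z * zeta K := by
  rw [Comp.eval, Finsupp.sum_mapRange_index]
  intro K
  rw [ext_zero, zero_mul]

variable {F : SuperFn N (ℂ → ℂ)} {p : Point N}

theorem SuperFn.eval_eq_ev4 (F : SuperFn N (ℂ → ℂ)) (p : Point N) :
    F.eval p = ev4 (fun k => Comp.eval (F k) (p.1 0)) p := rfl

theorem analyticAt_dz {x : ℂ} (hF : ∀ k K, AnalyticAt ℂ (F k K) x) (k : Fin 4)
    (K : Finset (Gen N)) : AnalyticAt ℂ (F.dz k K) x := by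
  rw [SuperFn.dz, Finsupp.mapRange_apply]
  exact (hF k K).deriv

theorem SuperFn.eval_Dplus (hF : ∀ k K, AnalyticAt ℂ (F k K) p.body) :
    F.Dplus.eval p = ev4 (compDplus (fun k => Comp.eval (F k) (p.1 0))
      fun k => Comp.eval (F.dz k) (p.1 0)) p := by
  rw [SuperFn.eval_eq_ev4]
  congr 1
  funext k
  fin_cases k
  · simp [SuperFn.Dplus, dThetaP, mulThetaM, compDplus]
  · simp [SuperFn.Dplus, dThetaP, mulThetaM, compDplus, Comp.eval_zero]
  · simpa [SuperFn.Dplus, dThetaP, mulThetaM, compDplus] using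
      Comp.eval_add p.2.1 (hF 3) (analyticAt_dz hF 0)
  · simp [SuperFn.Dplus, dThetaP, mulThetaM, compDplus, Comp.eval_neg]

theorem SuperFn.eval_Dminus (hF : ∀ k K, AnalyticAt ℂ (F k K) p.body) :
    F.Dminus.eval p = ev4 (compDminus (fun k => Comp.eval (F k) (p.1 0))
      fun k => Comp.eval (F.dz k) (p.1 0)) p := by
  rw [SuperFn.eval_eq_ev4]
  congr 1
  funext k
  fin_cases k
  · simp [SuperFn.Dminus, dThetaM, mulThetaP, compDminus]
  · have := Comp.eval_add (F := -F 3) (G := F.dz 0) p.2.1 (fun K => (hF 3 K).neg)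
      (analyticAt_dz hF 0)
    simpa [SuperFn.Dminus, dThetaM, mulThetaP, compDminus, Comp.eval_neg, sub_eq_neg_add] using this
  · simp [SuperFn.Dminus, dThetaM, mulThetaP, compDminus, Comp.eval_zero]
  · simp [SuperFn.Dminus, dThetaM, mulThetaP, compDminus]

/-- Passage from the calculus of `IsSA`, which works with values, to stored coefficients, including
the values of D⁺, D⁻ and of the velocity. -/
theorem exists_superFn {U : Set (ℂ × ℂ)} {f fz : Fin 4 → ℂ → evenPart N → Grassmann N}
    {ft : Fin 4 → evenPart N → Grassmann N} (h : ∀ k, IsSA U (f k) (fz k) (ft k)) :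
    ∃ F : SuperFn N (ℂ → ℂ → ℂ),
      (∀ k, ∀ K ∈ (F k).support, IsLow 2 K ∧
        AnalyticOnNhd ℂ (fun x : ℂ × ℂ => F k K x.1 x.2) U) ∧
      (∀ t (p : Point N), (t, p.body) ∈ U →
        (F.at t).eval p = ev4 (fun k => f k t p.z) p ∧
        (F.at t).Dplus.eval p = ev4 (compDplus (fun k => f k t p.z) fun k => fz k t p.z) p ∧
        (F.at t).Dminus.eval p = ev4 (compDminus (fun k => f k t p.z) fun k => fz k t p.z) p) ∧
      ∀ p : Point N, ((0 : ℂ), p.body) ∈ U → F.dt.eval p = ev4 (fun k => ft k p.z) p := by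
  choose F hF hf hft using h
  have d0 : deriv (0 : ℂ → ℂ) = 0 := by funext x; exact deriv_const x 0
  refine ⟨F, hF, fun t p hp => ?_, fun p hp => ?_⟩
  · have e1 : (fun k => Comp.eval (SuperFn.at F t k) (p.1 0)) = fun k => f k t p.z := by
      funext k
      exact (Comp.eval_mapRange (F k) (fun g => g t) rfl (p.1 0)).trans (hf k t p.z hp).1.symm
    have e2 : (fun k => Comp.eval (SuperFn.dz (SuperFn.at F t) k) (p.1 0)) =
        fun k => fz k t p.z := by
      funext k
      rw [(hf k t p.z hp).2]
      rw [SuperFn.dz, Comp.eval_mapRange, SuperFn.at, Finsupp.sum_mapRange_index]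
      · rfl
      · intro K
        rw [d0, ext_zero, zero_mul]
    have ha : ∀ k K, AnalyticAt ℂ (SuperFn.at F t k K) p.body := fun k K => by
      have := analyticAt_snd (analytic_coeff (hF k) K (t, p.body) hp)
      simpa [SuperFn.at] using this
    exact ⟨by rw [SuperFn.eval_eq_ev4, e1], by rw [SuperFn.eval_Dplus ha, e1, e2],
      by rw [SuperFn.eval_Dminus ha, e1, e2]⟩
  · rw [SuperFn.eval_eq_ev4]
    congr 1
    funext k
    rw [hft k p.z hp]
    exact Comp.eval_mapRange (F k) (fun g z => deriv (fun t => g t z) 0) _ (p.1 0)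

/-- The superconformal equations for the components of three superfunctions and of their derivatives
with respect to `z`. -/
def ScEqs (f f' : Fin 3 → Fin 4 → Grassmann N) (p : Point N) : Prop :=
  ev4 (compDplus (f 2) (f' 2)) p = 0 ∧ ev4 (compDminus (f 1) (f' 1)) p = 0 ∧
  ev4 (compDplus (f 0) (f' 0)) p - ev4 (f 2) p * ev4 (compDplus (f 1) (f' 1)) p = 0 ∧
  ev4 (compDminus (f 0) (f' 0)) p - ev4 (f 1) p * ev4 (compDminus (f 2) (f' 2)) p = 0

/-- The point with the same even coordinate and vanishing odd coordinates. -/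
def Point.base (p : Point N) : Point N :=
  ⟨![p.1 0, 0, 0], p.2.1, Submodule.zero_mem _, Submodule.zero_mem _⟩

/-- Criterion used for both parities: it suffices to describe the family in each pair of charts by
components with known `z`- and `t`-derivatives, and to check the equations on values. All domains
are allowed to move with `t`, hence the sets `U α β` of pairs. -/
theorem isTangent_of_family {n : ℤ} {R : ℝ} (hR : 0 < R) (T : ℂ → Equiv.Perm (Sphere N n))
    (hT : T 0 = 1) (W : Fin 3 → Point N → Grassmann N)
    (U : Chart → Chart → Set (ℂ × ℂ)) (hU : ∀ α β, IsOpen (U α β))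
    (f fz : Chart → Chart → Fin 3 → Fin 4 → ℂ → evenPart N → Grassmann N)
    (ft : Chart → Chart → Fin 3 → Fin 4 → evenPart N → Grassmann N)
    (hf : ∀ α β i k, IsSA (U α β) (f α β i k) (fz α β i k) (ft α β i k))
    (hdom : ∀ α β t, ‖t‖ < R → ∀ p : Point N,
      (∃ q : Point N, T t (chartInv α p) = chartInv β q) ↔ (t, p.body) ∈ U α β)
    (hval : ∀ α β t, ‖t‖ < R → ∀ p q : Point N, T t (chartInv α p) = chartInv β q →
      ∀ i, q.1 i = ev4 (fun k => f α β i k t p.z) p)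
    (hsc : ∀ α β t, ‖t‖ < R → ∀ p : Point N, (t, p.body) ∈ U α β →
      ScEqs (fun i k => f α β i k t p.z) (fun i k => fz α β i k t p.z) p)
    (hnz : ∀ α β t, ‖t‖ < R → ∀ p : Point N, (t, p.body) ∈ U α β →
      body (f α β 1 1 t p.z) ≠ 0 ∧ body (f α β 2 2 t p.z) ≠ 0)
    (hW : ∀ (p : Point N) i, W i p = ev4 (fun k => ft .south .south i k p.z) p) :
    IsTangent N n W := by
  choose F hFan hFev hFdt using fun α β i => exists_superFn (hf α β i)
  have hloc : ∀ α z₀, ∃ r, 0 < r ∧ r ≤ R ∧ Metric.ball ((0 : ℂ), z₀) r ⊆ U α α := by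
    intro α z₀
    -- At `t = 0` the family is the identity, so every body point of a chart is in the domain for
    -- the pair of that chart with itself.
    have hmem : ((0 : ℂ), z₀) ∈ U α α := by
      let p : Point N := ⟨![algebraMap ℂ _ z₀, 0, 0], algebraMap_mem_grPart _,
        Submodule.zero_mem _, Submodule.zero_mem _⟩
      have hb : p.body = z₀ := body_algebraMap z₀
      rw [← hb, ← hdom α α 0 (by simpa using hR) p]
      exact ⟨p, by rw [hT]; rfl⟩
    obtain ⟨r, hr, hrU⟩ := Metric.isOpen_iff.mp (hU α α) _ hmem
    exact ⟨min r R, lt_min hr hR, min_le_right _ _,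
      (Metric.ball_subset_ball (min_le_left _ _)).trans hrU⟩
  have hfam : ∀ α z₀ r, 0 < r → r ≤ R → Metric.ball ((0 : ℂ), z₀) r ⊆ U α α →
      IsLocalFamily T α z₀ r (F α α) := by
    intro α z₀ r hr hrR hrU
    refine ⟨hr, fun i k K hK => ⟨(hFan α α i k K hK).1, (hFan α α i k K hK).2.mono hrU⟩, ?_⟩
    intro t ht p hp
    have hm : (t, p.body) ∈ U α α := hrU (by
      rw [Metric.mem_ball, Prod.dist_eq, max_lt_iff, dist_zero_right, dist_eq_norm]
      exact ⟨ht, hp⟩)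
    have htR := ht.trans_le hrR
    obtain ⟨q, hq⟩ := (hdom α α t htR p).mpr hm
    exact ⟨q, hq, fun i => by rw [hval α α t htR p q hq i, (hFev α α i t p hm).1]⟩
  refine ⟨T, hT, ?_, fun z₀ => ?_, fun z₀ => ?_⟩
  · filter_upwards [Metric.ball_mem_nhds (0 : ℂ) hR] with t ht α β hne
    rw [mem_ball_zero_iff] at ht
    refine ⟨{x | (t, x) ∈ U α β}, (hU α β).preimage (by fun_prop), fun p => hdom α β t ht p,
      fun i => (F α β i).at t, ⟨fun i k K hK => ?_, fun p hp => ?_, ?_, ?_⟩, fun p q hpq i => ?_⟩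
    · have hK' : K ∈ (F α β i k).support := Finsupp.support_mapRange hK
      refine ⟨(hFan α β i k K hK').1, fun x hx => ?_⟩
      simpa [SuperFn.at] using analyticAt_snd ((hFan α β i k K hK').2 _ hx)
    · have := hsc α β t ht p hp
      have hp : (t, p.body) ∈ U α β := hp
      rw [(hFev α β 0 t p hp).2.1, (hFev α β 0 t p hp).2.2, (hFev α β 1 t p hp).2.1,
        (hFev α β 1 t p hp).2.2, (hFev α β 2 t p hp).2.1, (hFev α β 2 t p hp).2.2,
        (hFev α β 1 t p hp).1, (hFev α β 2 t p hp).1]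
      exact this
    · obtain ⟨p, q, hpq⟩ := hne
      -- At vanishing odd coordinates the value of D⁺θ̃⁺ is its leading component, whose body is
      -- nonzero by `hnz`.
      have hp : (t, p.base.body) ∈ U α β := (hdom α β t ht p).mp ⟨q, hpq⟩
      refine ⟨p.base, hp, fun h0 => (hnz α β t ht p.base hp).1 ?_⟩
      rw [(hFev α β 1 t p.base hp).2.1] at h0
      have := congrArg body h0
      simpa [ev4, compDplus, Point.base] using this
    · obtain ⟨p, q, hpq⟩ := hne
      have hp : (t, p.base.body) ∈ U α β := (hdom α β t ht p).mp ⟨q, hpq⟩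
      refine ⟨p.base, hp, fun h0 => (hnz α β t ht p.base hp).2 ?_⟩
      rw [(hFev α β 2 t p.base hp).2.2] at h0
      have := congrArg body h0
      simpa [ev4, compDminus, Point.base] using this
    · have hp : (t, p.body) ∈ U α β := (hdom α β t ht p).mp ⟨q, hpq⟩
      rw [hval α β t ht p q hpq i, (hFev α β i t p hp).1]
  · obtain ⟨r, hr, hrR, hrU⟩ := hloc .north z₀
    exact ⟨r, _, hfam .north z₀ r hr hrR hrU⟩
  · obtain ⟨r, hr, hrR, hrU⟩ := hloc .south z₀
    refine ⟨r, _, hfam .south z₀ r hr hrR hrU, fun p hp i => ?_⟩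
    have hm : ((0 : ℂ), p.body) ∈ U .south .south := hrU (by
      rw [Metric.mem_ball, Prod.dist_eq, max_lt_iff, dist_zero_right, dist_eq_norm]
      exact ⟨by simpa using hr, hp⟩)
    rw [hW p i, hFdt .south .south i p hm]

end Superfunctions

/-! ### Coordinates on the sphere -/

section Coordinates

variable {N : ℕ∞}

/-- The odd part of the Grassmann algebra, as a module over the even part. -/
def oddPart (N : ℕ∞) : Submodule (evenPart N) (Grassmann N) where
  carrier := grPart N 0 1
  add_mem' := fun hx hy => Submodule.add_mem _ hx hy
  zero_mem' := Submodule.zero_mem _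
  smul_mem' := fun x _ hy => even_smul_odd x hy

instance : Module (evenPart N) (oddPart N) := Submodule.module _

instance : MulAction (evenPart N) (oddPart N) :=
  (inferInstance : Module (evenPart N) (oddPart N)).toMulAction

instance : SMul (evenPart N) (oddPart N) :=
  (inferInstance : MulAction (evenPart N) (oddPart N)).toSMul

/-- The coordinate `θ⁺` of a point. -/
def Point.thP (p : Point N) : oddPart N := ⟨p.1 1, p.2.2.1⟩

/-- The coordinate `θ⁻` of a point. -/
def Point.thM (p : Point N) : oddPart N := ⟨p.1 2, p.2.2.2⟩

/-- The point with given coordinates. -/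
def mkPt (z : evenPart N) (a b : oddPart N) : Point N := ⟨![z, a, b], z.2, a.2, b.2⟩

@[simp] theorem mkPt_z (z : evenPart N) (a b : oddPart N) : (mkPt z a b).z = z := rfl
@[simp] theorem mkPt_thP (z : evenPart N) (a b : oddPart N) : (mkPt z a b).thP = a := rfl
@[simp] theorem mkPt_thM (z : evenPart N) (a b : oddPart N) : (mkPt z a b).thM = b := rfl

theorem mkPt_eta (p : Point N) : mkPt p.z p.thP p.thM = p := by
  refine Subtype.ext ?_
  funext i
  fin_cases i <;> rfl

theorem Point.ext {p q : Point N} (h0 : p.z = q.z) (h1 : p.thP = q.thP) (h2 : p.thM = q.thM) :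
    p = q := by
  rw [← mkPt_eta p, ← mkPt_eta q, h0, h1, h2]

theorem isUnit_z_iff {p : Point N} : IsUnit p.z ↔ p.body ≠ 0 := isUnit_even_iff

/-- The coordinate change `(z, θ⁺, θ⁻) ↦ (1 / z, κ θ⁺ z ^ (n - 1), κ θ⁻ z ^ (- n - 1))`. -/
def flip (n : ℤ) (κ : ℂ) (p : Point N) : Point N :=
  mkPt (Ring.inverse p.z) ((algebraMap ℂ (evenPart N) κ * zp p.z (n - 1)) • p.thP)
    ((algebraMap ℂ (evenPart N) κ * zp p.z (-n - 1)) • p.thM)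

theorem flip_flip {n : ℤ} {κ μ : ℂ} (h : κ * μ = 1) {p : Point N} (hp : IsUnit p.z) :
    flip n κ (flip n μ p) = p := by
  obtain ⟨u, hu⟩ := hp
  have hk : algebraMap ℂ (evenPart N) κ * algebraMap ℂ (evenPart N) μ = 1 := by
    rw [← map_mul, h, map_one]
  have key : ∀ k : ℤ, (algebraMap ℂ (evenPart N) κ * zp (Ring.inverse p.z) k) *
      (algebraMap ℂ (evenPart N) μ * zp p.z k) = 1 := fun k => by
    rw [← hu, Ring.inverse_unit, zp_unit, zp_unit, mul_mul_mul_comm, hk, one_mul, ← Units.val_mul,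
      inv_zpow, inv_mul_cancel, Units.val_one]
  apply Point.ext
  · simp [flip, ← hu]
  · simp only [flip, mkPt_z, mkPt_thP]
    rw [smul_smul, key, one_smul]
  · simp only [flip, mkPt_z, mkPt_thM]
    rw [smul_smul, key, one_smul]

theorem isUnit_flip_z {n : ℤ} {κ : ℂ} {p : Point N} (hp : IsUnit p.z) : IsUnit (flip n κ p).z := by
  obtain ⟨u, hu⟩ := hp
  simp [flip, ← hu]

theorem coe_zpow_unit (u : (evenPart N)ˣ) (k : ℤ) :
    (((Units.map (evenPart N).val.toMonoidHom u) ^ k : (Grassmann N)ˣ) : Grassmann N) =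
      ((u ^ k : (evenPart N)ˣ) : evenPart N) := by
  rw [← map_zpow]
  rfl

/-- The gluing uses units of the whole Grassmann algebra. A unit with even value is already a unit
of the even part, by the criterion on bodies, so the relation is the graph of `flip`. -/
theorem glue_iff {n : ℤ} {p q : Point N} :
    Glue N n (.inr p) (.inl q) ↔ IsUnit p.z ∧ q = flip n Complex.I p := by
  have main : ∀ u : (evenPart N)ˣ, (u : evenPart N) = p.z →
      ((q.1 0 = (((Units.map (evenPart N).val.toMonoidHom u)⁻¹ : (Grassmann N)ˣ) : Grassmann N) ∧
      q.1 1 = Complex.I • (p.1 1 * (((Units.map (evenPart N).val.toMonoidHom u) ^ (n - 1) :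
        (Grassmann N)ˣ) : Grassmann N)) ∧
      q.1 2 = Complex.I • (p.1 2 * (((Units.map (evenPart N).val.toMonoidHom u) ^ (-n - 1) :
        (Grassmann N)ˣ) : Grassmann N))) ↔ q = flip n Complex.I p) := by
    intro u hu
    have h0 : (((Units.map (evenPart N).val.toMonoidHom u)⁻¹ : (Grassmann N)ˣ) : Grassmann N) =
        (flip n Complex.I p).1 0 := by
      have := coe_zpow_unit u (-1)
      rw [zpow_neg_one, zpow_neg_one] at this
      rw [this, ← Point.coe_z, flip, mkPt_z, ← hu, Ring.inverse_unit]
    have hk : ∀ (k : ℤ) (y : Grassmann N), Complex.I • (y *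
        (((Units.map (evenPart N).val.toMonoidHom u) ^ k : (Grassmann N)ˣ) : Grassmann N)) =
        ((algebraMap ℂ (evenPart N) Complex.I * zp p.z k : evenPart N) : Grassmann N) * y := by
      intro k y
      rw [coe_zpow_unit, ← hu, zp_unit, ← (commute_of_even ((u ^ k : (evenPart N)ˣ) : evenPart N).2 y).eq, Algebra.smul_def,
        ← mul_assoc]
      rfl
    rw [h0, hk, hk]
    constructor
    · rintro ⟨a, b, c⟩
      exact Point.ext (Subtype.ext a) (Subtype.ext b) (Subtype.ext c)
    · rintro rfl
      exact ⟨rfl, rfl, rfl⟩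
  constructor
  · rintro ⟨v, hv, h⟩
    have hb : body (p.1 0) ≠ 0 := by
      rw [← hv]
      exact ((v.isUnit).map body).ne_zero
    obtain ⟨u, hu⟩ := isUnit_even_iff.mpr (show body (p.z : Grassmann N) ≠ 0 from hb)
    have hvu : v = Units.map (evenPart N).val.toMonoidHom u := by
      ext
      rw [hv]
      exact (congrArg Subtype.val hu).symm
    rw [hvu] at h
    exact ⟨⟨u, hu⟩, (main u hu).mp h⟩
  · rintro ⟨⟨u, hu⟩, h⟩
    exact ⟨Units.map (evenPart N).val.toMonoidHom u, congrArg Subtype.val hu, (main u hu).mpr h⟩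

theorem glue_cases {n : ℤ} {a b : Point N ⊕ Point N} (h : Glue N n a b) :
    ∃ p, IsUnit p.z ∧ a = .inr p ∧ b = .inl (flip n Complex.I p) := by
  rcases a with a | p
  · exact absurd h (by simp [Glue])
  rcases b with q | q
  · obtain ⟨h1, rfl⟩ := glue_iff.mp h
    exact ⟨p, h1, rfl, rfl⟩
  · exact absurd h (by simp [Glue])

theorem north_eq_south {n : ℤ} {p : Point N} (hp : IsUnit p.z) :
    (chartInv .north p : Sphere N n) = chartInv .south (flip n Complex.I p) :=
  Quot.sound (glue_iff.mpr ⟨hp, rfl⟩)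

theorem south_eq_north {n : ℤ} {p : Point N} (hp : IsUnit p.z) :
    (chartInv .south p : Sphere N n) = chartInv .north (flip n (-Complex.I) p) := by
  rw [north_eq_south (isUnit_flip_z hp), flip_flip (by simp) hp]

open Classical in
/-- The coordinates of a point of the sphere in a chart, where they are defined. -/
def coords {n : ℤ} (α : Chart) : Sphere N n → Option (Point N) :=
  Quot.lift (fun a => match α, a with
    | .south, .inl p => some p
    | .south, .inr p => if IsUnit p.z then some (flip n Complex.I p) else none
    | .north, .inr p => some p
    | .north, .inl p => if IsUnit p.z then some (flip n (-Complex.I) p) else none) (by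
    intro a b h
    obtain ⟨p, hp, rfl, rfl⟩ := glue_cases h
    cases α
    · simp [hp]
    · simp [isUnit_flip_z hp, flip_flip (show -Complex.I * Complex.I = 1 by simp) hp])

theorem coords_chartInv {n : ℤ} (α : Chart) (p : Point N) :
    coords α (chartInv α p : Sphere N n) = some p := by
  cases α <;> rfl

/-- `coords` is well defined on the quotient and inverts the chart; thus the quotient makes no
identifications inside a chart. -/
theorem chartInv_injective {n : ℤ} (α : Chart) :
    Function.Injective (chartInv α : Point N → Sphere N n) := fun p q h => by
  have := congrArg (coords α) h
  rwa [coords_chartInv, coords_chartInv, Option.some_inj] at this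

open Classical in
theorem south_eq_north_iff {n : ℤ} {p q : Point N} :
    (chartInv .south p : Sphere N n) = chartInv .north q ↔
      IsUnit p.z ∧ q = flip n (-Complex.I) p := by
  constructor
  · intro h
    have h1 : coords .north (chartInv .south p : Sphere N n) = some q := by
      rw [h, coords_chartInv]
    have h2 : coords .north (chartInv .south p : Sphere N n) =
        if IsUnit p.z then some (flip n (-Complex.I) p) else none := rfl
    rw [h2] at h1
    split_ifs at h1 with hp
    exact ⟨hp, (Option.some_inj.mp h1).symm⟩
  · rintro ⟨hp, rfl⟩
    exact south_eq_north hp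

open Classical in
theorem north_eq_south_iff {n : ℤ} {p q : Point N} :
    (chartInv .north p : Sphere N n) = chartInv .south q ↔
      IsUnit p.z ∧ q = flip n Complex.I p := by
  constructor
  · intro h
    have h1 : coords .south (chartInv .north p : Sphere N n) = some q := by
      rw [h, coords_chartInv]
    have h2 : coords .south (chartInv .north p : Sphere N n) =
        if IsUnit p.z then some (flip n Complex.I p) else none := rfl
    rw [h2] at h1
    split_ifs at h1 with hp
    exact ⟨hp, (Option.some_inj.mp h1).symm⟩
  · rintro ⟨hp, rfl⟩
    exact north_eq_south hp

theorem exists_chart {n : ℤ} (x : Sphere N n) : ∃ α p, x = chartInv α p := by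
  induction x using Quot.ind with
  | mk a =>
    rcases a with p | p
    · exact ⟨.south, p, rfl⟩
    · exact ⟨.north, p, rfl⟩

/-- A self-map of the sphere, from its restrictions to the charts. -/
def sphereMap {n : ℤ} (S : Chart → Point N → Sphere N n)
    (hS : ∀ p : Point N, IsUnit p.z → S .north p = S .south (flip n Complex.I p)) :
    Sphere N n → Sphere N n :=
  Quot.lift (Sum.elim (S .south) (S .north)) (by
    intro a b h
    obtain ⟨p, hp, rfl, rfl⟩ := glue_cases h
    exact hS p hp)

theorem sphereMap_chartInv {n : ℤ} (S : Chart → Point N → Sphere N n)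
    (hS : ∀ p : Point N, IsUnit p.z → S .north p = S .south (flip n Complex.I p))
    (α : Chart) (p : Point N) : sphereMap S hS (chartInv α p) = S α p := by
  cases α <;> rfl

end Coordinates

/-! ### Superconformal equations -/

section Equations

variable {N : ℕ∞}

instance : Algebra (evenPart N) (Grassmann N) where
  algebraMap := (evenPart N).val.toRingHom
  commutes' := fun x y => commute_of_even x.2 y
  smul_def' := fun _ _ => rfl

theorem algebraMap_even (x : evenPart N) : algebraMap (evenPart N) (Grassmann N) x = x := rfl

theorem mul_coe_even (x : evenPart N) (y : Grassmann N) : y * (x : Grassmann N) = x • y := by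
  rw [← algebraMap_even, ← Algebra.commutes, ← Algebra.smul_def]

/-- The components of a superconformal map `z̃ = w + c (- θ⁺ a h - θ⁻ b g)`,
`θ̃⁺ = θ⁺ a + c (g + θ⁺ θ⁻ g')`, `θ̃⁻ = θ⁻ b + c (h - θ⁺ θ⁻ h')`. -/
def scMap (c : Grassmann N) (w a b g g' h h' : evenPart N) : Fin 3 → Fin 4 → Grassmann N :=
  ![![w, (a * h) • c, (b * g) • c, 0], ![g • c, a, 0, g' • c], ![h • c, 0, b, (-h') • c]]

set_option linter.unusedSimpArgs false in
-- For this shape D⁺θ̃⁻ = 0 and D⁻θ̃⁺ = 0 hold identically. In the other two equations all terms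
-- with two factors c vanish, those with one factor cancel, and what remains is w' = ab.
theorem scEqs_scMap {c : Grassmann N} (hc : c ∈ grPart N 0 1)
    {w w' a a' b b' g g' g'' h h' h'' : evenPart N} (hw : w' = a * b) (p : Point N) :
    ScEqs (scMap c w a b g g' h h')
      (![![w', (a' * h + a * h') • c, (b' * g + b * g') • c, 0], ![g' • c, a', 0, g'' • c],
        ![h' • c, 0, b', (-h'') • c]]) p := by
  set x := p.1 1
  set y := p.1 2
  have hx : x ∈ grPart N 0 1 := p.2.2.1
  have hy : y ∈ grPart N 0 1 := p.2.2.2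
  have xx : ∀ r, x * (x * r) = 0 := fun r => by rw [← mul_assoc, odd_mul_self hx, zero_mul]
  have yy : ∀ r, y * (y * r) = 0 := fun r => by rw [← mul_assoc, odd_mul_self hy, zero_mul]
  have cc : ∀ r, c * (c * r) = 0 := fun r => by rw [← mul_assoc, odd_mul_self hc, zero_mul]
  have xx0 := odd_mul_self hx
  have yy0 := odd_mul_self hy
  have cc0 := odd_mul_self hc
  have yx0 := odd_mul_odd hy hx
  have cx0 := odd_mul_odd hc hx
  have cy0 := odd_mul_odd hc hy
  have yx : ∀ r, y * (x * r) = -(x * (y * r)) := fun r => by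
    rw [← mul_assoc, yx0, neg_mul, mul_assoc]
  have cx : ∀ r, c * (x * r) = -(x * (c * r)) := fun r => by
    rw [← mul_assoc, cx0, neg_mul, mul_assoc]
  have cy : ∀ r, c * (y * r) = -(y * (c * r)) := fun r => by
    rw [← mul_assoc, cy0, neg_mul, mul_assoc]
  have one : ∀ r : evenPart N, (r : Grassmann N) = r • (1 : Grassmann N) := fun r => by
    rw [← mul_coe_even, one_mul]
  subst hw
  refine ⟨?_, ?_, ?_, ?_⟩
  · simp only [ev4, compDplus, scMap, Matrix.cons_val]
    simp
  · simp only [ev4, compDminus, scMap, Matrix.cons_val]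
    simp
  · simp only [ev4, compDplus, scMap, Matrix.cons_val]
    rw [show p.1 1 = x from rfl, show p.1 2 = y from rfl]
    simp only [one, mul_zero, add_zero, mul_add, add_mul, mul_neg, neg_mul, mul_smul_comm,
      smul_mul_assoc, smul_neg, mul_one, one_mul, smul_add, mul_assoc, xx, yy, cc, xx0, yy0, cc0,
      yx0, cx0, cy0, yx, cx, cy, smul_zero, neg_zero, neg_neg, smul_smul]
    module
  · simp only [ev4, compDminus, scMap, Matrix.cons_val]
    rw [show p.1 1 = x from rfl, show p.1 2 = y from rfl]
    simp only [one, mul_zero, add_zero, mul_add, add_mul, mul_neg, neg_mul, mul_smul_comm,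
      smul_mul_assoc, smul_neg, mul_one, one_mul, smul_add, mul_assoc, xx, yy, cc, xx0, yy0, cc0,
      yx0, cx0, cy0, yx, cx, cy, smul_zero, neg_zero, neg_neg, smul_smul, mul_sub, sub_mul]
    module

end Equations

/-! ### Homogeneous coordinates -/

section Homogeneous

variable {N : ℕ∞} {n : ℤ}

theorem zp_mul {x y : evenPart N} (hx : IsUnit x) (hy : IsUnit y) (k : ℤ) :
    zp (x * y) k = zp x k * zp y k := by
  obtain ⟨u, rfl⟩ := hx
  obtain ⟨v, rfl⟩ := hy
  rw [← Units.val_mul, zp_unit, zp_unit, zp_unit, mul_zpow, Units.val_mul]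

theorem zp_add {x : evenPart N} (hx : IsUnit x) (k l : ℤ) : zp x (k + l) = zp x k * zp x l := by
  obtain ⟨u, rfl⟩ := hx
  rw [zp_unit, zp_unit, zp_unit, zpow_add, Units.val_mul]

theorem zp_zero (x : evenPart N) : zp x 0 = 1 := pow_zero x

theorem zp_inverse {x : evenPart N} (hx : IsUnit x) (k : ℤ) : zp (Ring.inverse x) k = zp x (-k) := by
  obtain ⟨u, rfl⟩ := hx
  rw [Ring.inverse_unit, zp_unit, zp_unit, inv_zpow, zpow_neg]

theorem isUnit_inverse {x : evenPart N} (hx : IsUnit x) : IsUnit (Ring.inverse x) := by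
  obtain ⟨u, rfl⟩ := hx
  rw [Ring.inverse_unit]
  exact u⁻¹.isUnit

theorem isUnit_zp {x : evenPart N} (hx : IsUnit x) (k : ℤ) : IsUnit (zp x k) := by
  obtain ⟨u, rfl⟩ := hx
  rw [zp_unit]
  exact (u ^ k).isUnit

/-- Complex numbers as even supernumbers. -/
abbrev cst (a : ℂ) : evenPart N := algebraMap ℂ (evenPart N) a

/-- The factor by which the homogeneous odd coordinates differ from those of the chart. -/
def kin : Chart → ℂ
  | .south => 1
  | .north => Complex.I

/-- The inverse of the factor `kin`. -/
def kout : Chart → ℂ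
  | .south => 1
  | .north => -Complex.I

theorem kout_mul_kin (α : Chart) : kout α * kin α = 1 := by cases α <;> simp [kin, kout]

/-- The homogeneous coordinate that is inverted in a chart. -/
def den (α : Chart) (u v : evenPart N) : evenPart N :=
  match α with
  | .south => v
  | .north => u

/-- The other homogeneous coordinate. -/
def num (α : Chart) (u v : evenPart N) : evenPart N :=
  match α with
  | .south => u
  | .north => v

/-- The coordinates in the chart `α` of the point with homogeneous coordinates `(u, v, η₁, η₂)`. -/
def projPt (n : ℤ) (α : Chart) (u v : evenPart N) (η₁ η₂ : oddPart N) : Point N :=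
  mkPt (num α u v * Ring.inverse (den α u v)) ((cst (kout α) * zp (den α u v) (n - 1)) • η₁)
    ((cst (kout α) * zp (den α u v) (-n - 1)) • η₂)

open Classical in
/-- The point of the sphere with homogeneous coordinates `(u, v, η₁, η₂)`. -/
def proj (n : ℤ) (u v : evenPart N) (η₁ η₂ : oddPart N) : Sphere N n :=
  if IsUnit v then chartInv .south (projPt n .south u v η₁ η₂)
  else chartInv .north (projPt n .north u v η₁ η₂)

theorem flip_projPt {u v : evenPart N} (hu : IsUnit u) (hv : IsUnit v) (η₁ η₂ : oddPart N) :
    flip n (-Complex.I) (projPt n .south u v η₁ η₂) = projPt n .north u v η₁ η₂ := by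
  have key : ∀ k : ℤ, (algebraMap ℂ (evenPart N) (-Complex.I) * zp (u * Ring.inverse v) k) *
      (cst 1 * zp v k) = cst (-Complex.I) * zp u k := fun k => by
    rw [zp_mul hu (isUnit_inverse hv), zp_inverse hv, cst, map_one]
    have : zp v (-k) * zp v k = 1 := by rw [← zp_add hv, neg_add_cancel, zp_zero]
    linear_combination (cst (-Complex.I) * zp u k) * this
  apply Point.ext
  · simp only [flip, projPt, mkPt_z, num, den]
    rw [Ring.mul_inverse_rev, Ring.inverse_inverse hv]
  · simp only [flip, projPt, mkPt_z, mkPt_thP, num, den, kout]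
    rw [smul_smul, key]
  · simp only [flip, projPt, mkPt_z, mkPt_thM, num, den, kout]
    rw [smul_smul, key]

theorem proj_eq {u v : evenPart N} (α : Chart) (h : IsUnit (den α u v)) (η₁ η₂ : oddPart N) :
    proj n u v η₁ η₂ = chartInv α (projPt n α u v η₁ η₂) := by
  unfold proj
  cases α
  · have hv : IsUnit v := h
    rw [if_pos hv]
  · have hu : IsUnit u := h
    split_ifs with hv
    · rw [south_eq_north, flip_projPt hu hv]
      exact hu.mul (isUnit_inverse hv)
    · rfl

/-- If the denominator of a chart is not a unit, the other homogeneous coordinate is, and the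
coordinate in the opposite chart is a multiple of the non-unit, so the point is outside the overlap.
-/
theorem proj_eq_chartInv_iff {u v : evenPart N} (h : IsUnit u ∨ IsUnit v) (α : Chart)
    {η₁ η₂ : oddPart N} {q : Point N} : proj n u v η₁ η₂ = chartInv α q ↔
      IsUnit (den α u v) ∧ q = projPt n α u v η₁ η₂ := by
  constructor
  · intro hq
    have hd : IsUnit (den α u v) := by
      by_contra hd
      cases α
      · have hu : IsUnit u := h.resolve_right hd
        rw [proj_eq .north hu, north_eq_south_iff] at hq
        exact hd (isUnit_of_mul_isUnit_left hq.1)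
      · have hv : IsUnit v := h.resolve_left hd
        rw [proj_eq .south hv, south_eq_north_iff] at hq
        exact hd (isUnit_of_mul_isUnit_left hq.1)
    refine ⟨hd, ?_⟩
    rw [proj_eq α hd] at hq
    exact (chartInv_injective α hq).symm
  · rintro ⟨hd, rfl⟩
    exact proj_eq α hd _ _

/-- The weights 1 - n and 1 + n cancel the powers n - 1 and - n - 1 of the denominator in `projPt`.
-/
theorem proj_smul {x u v : evenPart N} (hx : IsUnit x) (h : IsUnit u ∨ IsUnit v)
    (η₁ η₂ : oddPart N) :
    proj n (x * u) (x * v) (zp x (1 - n) • η₁) (zp x (1 + n) • η₂) = proj n u v η₁ η₂ := by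
  have main : ∀ α, IsUnit (den α u v) →
      proj n (x * u) (x * v) (zp x (1 - n) • η₁) (zp x (1 + n) • η₂) = proj n u v η₁ η₂ := by
    intro α hd
    have e1 : den α (x * u) (x * v) = x * den α u v := by cases α <;> rfl
    have e2 : num α (x * u) (x * v) = x * num α u v := by cases α <;> rfl
    have hd' : IsUnit (den α (x * u) (x * v)) := e1 ▸ hx.mul hd
    rw [proj_eq α hd, proj_eq α hd']
    congr 1
    have key : ∀ k l : ℤ, k + l = 0 → (cst (kout α) * zp (x * den α u v) k) * zp x l =
        cst (kout α) * zp (den α u v) k := fun k l hkl => by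
      have h1 : zp x k * zp x l = 1 := by rw [← zp_add hx, hkl, zp_zero]
      rw [zp_mul hx hd]
      linear_combination (cst (kout α) * zp (den α u v) k) * h1
    apply Point.ext
    · simp only [projPt, mkPt_z, e1, e2]
      rw [Ring.mul_inverse_rev]
      linear_combination (num α u v * Ring.inverse (den α u v)) * Ring.mul_inverse_cancel x hx
    · simp only [projPt, mkPt_thP, e1]
      rw [smul_smul, key _ _ (by ring)]
    · simp only [projPt, mkPt_thM, e1]
      rw [smul_smul, key _ _ (by ring)]
  rcases h with h | h
  · exact main .north h
  · exact main .south h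

/-- First homogeneous coordinate of a point of a chart. -/
def homU (α : Chart) (z : evenPart N) : evenPart N :=
  match α with
  | .south => z
  | .north => 1

/-- Second homogeneous coordinate of a point of a chart. -/
def homV (α : Chart) (z : evenPart N) : evenPart N :=
  match α with
  | .south => 1
  | .north => z

theorem isUnit_hom (α : Chart) (z : evenPart N) : IsUnit (homU α z) ∨ IsUnit (homV α z) := by
  cases α
  · exact Or.inr isUnit_one
  · exact Or.inl isUnit_one

theorem zp_one (k : ℤ) : zp (1 : evenPart N) k = 1 := by
  have := zp_unit (1 : (evenPart N)ˣ) k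
  rwa [one_zpow, Units.val_one] at this

theorem projPt_of_den_eq_one {α : Chart} {u v : evenPart N} (h : den α u v = 1)
    (η₁ η₂ : oddPart N) :
    projPt n α u v η₁ η₂ = mkPt (num α u v) (cst (N := N) (kout α) • η₁)
      (cst (N := N) (kout α) • η₂) := by
  unfold projPt
  rw [h, zp_one, zp_one, mul_one, Ring.inverse_one, mul_one]

theorem cst_kout_kin_smul (α : Chart) (η : oddPart N) :
    cst (N := N) (kout α) • cst (N := N) (kin α) • η = η := by
  have hk : cst (N := N) (kout α) * cst (kin α) = 1 := by rw [← map_mul, kout_mul_kin, map_one]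
  rw [smul_smul, hk, one_smul]

theorem proj_hom (α : Chart) (p : Point N) : proj n (homU α p.z) (homV α p.z)
    (cst (N := N) (kin α) • p.thP) (cst (N := N) (kin α) • p.thM) = chartInv α p := by
  have hd : den α (homU α p.z) (homV α p.z) = 1 := by cases α <;> rfl
  have hn : num α (homU α p.z) (homV α p.z) = p.z := by cases α <;> rfl
  rw [proj_eq_chartInv_iff (isUnit_hom α p.z), projPt_of_den_eq_one hd, hn, hd, cst_kout_kin_smul,
    cst_kout_kin_smul, mkPt_eta]
  exact ⟨isUnit_one, rfl⟩

end Homogeneous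

/-! ### Linear maps of the homogeneous coordinates -/

section Linear

variable {N : ℕ∞} {n : ℤ}

/-- The data of the map `(u, v, η₁, η₂) ↦ (a u + b v, c u + d v, r η₁, s η₂)`, and of its inverse. -/
structure EvenMap (N : ℕ∞) where
  /-- The entries of the matrix and the scale factors. -/
  (a b c d r s : evenPart N)
  isUnit_det : IsUnit (a * d - b * c)
  isUnit_r : IsUnit r
  isUnit_s : IsUnit s

namespace EvenMap

/-- First row of the matrix. -/
def row₁ (g : EvenMap N) (u v : evenPart N) : evenPart N := g.a * u + g.b * v

/-- Second row of the matrix. -/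
def row₂ (g : EvenMap N) (u v : evenPart N) : evenPart N := g.c * u + g.d * v

/-- By Cramer's rule, the determinant times `u` or `v` is a combination of the two rows; in a local
ring a combination of non-units is not a unit. -/
theorem isUnit_rows (g : EvenMap N) {u v : evenPart N} (h : IsUnit u ∨ IsUnit v) :
    IsUnit (g.row₁ u v) ∨ IsUnit (g.row₂ u v) := by
  have key : ∀ x y s t : evenPart N, IsUnit (s * x + t * y) → IsUnit x ∨ IsUnit y := by
    intro x y s t hxy
    rw [isUnit_even_iff] at hxy ⊢
    rw [isUnit_even_iff]
    by_contra hne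
    push Not at hne
    refine hxy ?_
    change body ((s : Grassmann N) * (x : Grassmann N) + (t : Grassmann N) * (y : Grassmann N)) = 0
    rw [map_add, map_mul, map_mul, hne.1, hne.2, mul_zero, mul_zero, add_zero]
  rcases h with h | h
  · refine key _ _ g.d (-g.b) ?_
    convert g.isUnit_det.mul h using 1
    simp only [row₁, row₂]
    ring
  · refine key _ _ (-g.c) g.a ?_
    convert g.isUnit_det.mul h using 1
    simp only [row₁, row₂]
    ring

/-- The image of the point with homogeneous coordinates `(u, v, η₁, η₂)`. -/
def act (g : EvenMap N) (n : ℤ) (u v : evenPart N) (η₁ η₂ : oddPart N) : Sphere N n :=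
  proj n (g.row₁ u v) (g.row₂ u v) (g.r • η₁) (g.s • η₂)

theorem act_smul (g : EvenMap N) {x u v : evenPart N} (hx : IsUnit x) (h : IsUnit u ∨ IsUnit v)
    (η₁ η₂ : oddPart N) : g.act n (x * u) (x * v) (zp x (1 - n) • η₁) (zp x (1 + n) • η₂) =
      g.act n u v η₁ η₂ := by
  unfold act
  rw [← proj_smul hx (g.isUnit_rows h), smul_comm g.r, smul_comm g.s]
  congr 1 <;> simp only [row₁, row₂] <;> ring

/-- The restriction of the map to a chart. -/
def onChart (g : EvenMap N) (n : ℤ) (α : Chart) (p : Point N) : Sphere N n :=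
  g.act n (homU α p.z) (homV α p.z) (cst (N := N) (kin α) • p.thP) (cst (N := N) (kin α) • p.thM)

/-- The homogeneous coordinates assigned to two glued points differ by rescaling with z, so the map
descends to the sphere. -/
theorem onChart_glue (g : EvenMap N) (p : Point N) (hp : IsUnit p.z) :
    g.onChart n .north p = g.onChart n .south (flip n Complex.I p) := by
  unfold onChart
  have hs := isUnit_hom (N := N) .south (flip n Complex.I p).z
  rw [← act_smul g hp hs]
  have key : ∀ k l : ℤ, k + l = 0 → zp p.z l * (cst (kin .south) *
      (algebraMap ℂ (evenPart N) Complex.I * zp p.z k)) = cst (kin .north) := fun k l hkl => by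
    have h1 : zp p.z k * zp p.z l = 1 := by rw [← zp_add hp, hkl, zp_zero]
    simp only [kin, cst, map_one]
    linear_combination (algebraMap ℂ (evenPart N) Complex.I) * h1
  congr 1
  · exact (Ring.mul_inverse_cancel _ hp).symm
  · exact (mul_one _).symm
  · simp only [flip, mkPt_thP]
    rw [smul_smul, smul_smul, mul_assoc, key _ _ (by ring)]
  · simp only [flip, mkPt_thM]
    rw [smul_smul, smul_smul, mul_assoc, key _ _ (by ring)]

/-- The induced self-map of the sphere. -/
def toFun (g : EvenMap N) (n : ℤ) : Sphere N n → Sphere N n :=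
  sphereMap (g.onChart n) g.onChart_glue

theorem toFun_chartInv (g : EvenMap N) (α : Chart) (p : Point N) :
    g.toFun n (chartInv α p) = g.onChart n α p := sphereMap_chartInv _ _ α p

/-- With this, composition can be computed on homogeneous coordinates, and bijectivity reduces to
the adjugate matrix. -/
theorem toFun_proj (g : EvenMap N) {u v : evenPart N} (h : IsUnit u ∨ IsUnit v)
    (η₁ η₂ : oddPart N) : g.toFun n (proj n u v η₁ η₂) = g.act n u v η₁ η₂ := by
  have main : ∀ α, IsUnit (den α u v) →
      g.toFun n (proj n u v η₁ η₂) = g.act n u v η₁ η₂ := by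
    intro α hd
    rw [proj_eq α hd, toFun_chartInv, onChart, ← act_smul g hd (isUnit_hom α _)]
    have key : ∀ k l : ℤ, k + l = 0 → zp (den α u v) l * (cst (kin α) *
        (cst (kout α) * zp (den α u v) k)) = 1 := fun k l hkl => by
      have h1 : zp (den α u v) k * zp (den α u v) l = 1 := by rw [← zp_add hd, hkl, zp_zero]
      have h2 : cst (N := N) (kout α) * cst (kin α) = 1 := by
        rw [← map_mul, kout_mul_kin, map_one]
      linear_combination (cst (kout α) * cst (kin α)) * h1 + h2
    have hn : den α u v * (num α u v * Ring.inverse (den α u v)) = num α u v := by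
      linear_combination (num α u v) * Ring.mul_inverse_cancel _ hd
    congr 1
    · cases α
      · exact hn
      · exact mul_one _
    · cases α
      · exact mul_one _
      · exact hn
    · simp only [projPt, mkPt_thP]
      rw [smul_smul, smul_smul, mul_assoc, key _ _ (by ring), one_smul]
    · simp only [projPt, mkPt_thM]
      rw [smul_smul, smul_smul, mul_assoc, key _ _ (by ring), one_smul]
  rcases h with h | h
  · exact main .north h
  · exact main .south h

theorem det_adjugate_smul {R : Type*} [CommRing R] {i a b c d : R} (h : i * (a * d - b * c) = 1) :
    i * d * (i * a) - i * -b * (i * -c) = i := by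
  linear_combination i * h

/-- The inverse matrix and scale factors. -/
def inv (g : EvenMap N) : EvenMap N where
  a := Ring.inverse (g.a * g.d - g.b * g.c) * g.d
  b := Ring.inverse (g.a * g.d - g.b * g.c) * -g.b
  c := Ring.inverse (g.a * g.d - g.b * g.c) * -g.c
  d := Ring.inverse (g.a * g.d - g.b * g.c) * g.a
  r := Ring.inverse g.r
  s := Ring.inverse g.s
  isUnit_det := by
    rw [det_adjugate_smul (Ring.inverse_mul_cancel _ g.isUnit_det)]
    exact isUnit_inverse g.isUnit_det
  isUnit_r := isUnit_inverse g.isUnit_r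
  isUnit_s := isUnit_inverse g.isUnit_s

theorem inv_toFun_toFun (g : EvenMap N) (x : Sphere N n) : g.inv.toFun n (g.toFun n x) = x := by
  obtain ⟨α, p, rfl⟩ := exists_chart x
  rw [toFun_chartInv, onChart, act, toFun_proj _ (g.isUnit_rows (isUnit_hom α _)), act,
    ← proj_hom α p]
  have hd := Ring.inverse_mul_cancel _ g.isUnit_det
  congr 1
  · simp only [row₁, row₂, inv]
    linear_combination (homU α p.z) * hd
  · simp only [row₁, row₂, inv]
    linear_combination (homV α p.z) * hd
  · rw [smul_smul]
    simp only [inv]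
    rw [Ring.inverse_mul_cancel _ g.isUnit_r, one_smul]
  · rw [smul_smul]
    simp only [inv]
    rw [Ring.inverse_mul_cancel _ g.isUnit_s, one_smul]

theorem toFun_inv_toFun (g : EvenMap N) (x : Sphere N n) : g.toFun n (g.inv.toFun n x) = x := by
  obtain ⟨α, p, rfl⟩ := exists_chart x
  rw [toFun_chartInv, onChart, act, toFun_proj _ (g.inv.isUnit_rows (isUnit_hom α _)), act,
    ← proj_hom α p]
  have hd := Ring.inverse_mul_cancel _ g.isUnit_det
  congr 1
  · simp only [row₁, row₂, inv]
    linear_combination (homU α p.z) * hd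
  · simp only [row₁, row₂, inv]
    linear_combination (homV α p.z) * hd
  · rw [smul_smul]
    simp only [inv]
    rw [Ring.mul_inverse_cancel _ g.isUnit_r, one_smul]
  · rw [smul_smul]
    simp only [inv]
    rw [Ring.mul_inverse_cancel _ g.isUnit_s, one_smul]

/-- The induced bijection of the sphere. -/
def toPerm (g : EvenMap N) (n : ℤ) : Equiv.Perm (Sphere N n) :=
  ⟨g.toFun n, g.inv.toFun n, g.inv_toFun_toFun, g.toFun_inv_toFun⟩

theorem toPerm_chartInv_eq_iff (g : EvenMap N) (α β : Chart) (p q : Point N) :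
    g.toPerm n (chartInv α p) = chartInv β q ↔
      IsUnit (den β (g.row₁ (homU α p.z) (homV α p.z)) (g.row₂ (homU α p.z) (homV α p.z))) ∧
      q = projPt n β (g.row₁ (homU α p.z) (homV α p.z)) (g.row₂ (homU α p.z) (homV α p.z))
        (g.r • cst (N := N) (kin α) • p.thP) (g.s • cst (N := N) (kin α) • p.thM) := by
  rw [show g.toPerm n (chartInv α p) = g.onChart n α p from toFun_chartInv g α p, onChart, act,
    proj_eq_chartInv_iff (g.isUnit_rows (isUnit_hom α _))]

theorem toPerm_eq_one {g : EvenMap N} (ha : g.a = 1) (hb : g.b = 0) (hc : g.c = 0) (hd : g.d = 1)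
    (hr : g.r = 1) (hs : g.s = 1) : g.toPerm n = 1 := by
  ext x
  obtain ⟨α, p, rfl⟩ := exists_chart x
  rw [show g.toPerm n (chartInv α p) = g.onChart n α p from toFun_chartInv g α p, onChart, act,
    row₁, row₂, ha, hb, hc, hd, hr, hs, one_smul, one_smul, one_mul, one_mul, zero_mul, zero_mul,
    zero_add, add_zero, proj_hom]
  rfl

end EvenMap

end Linear

/-! ### One-parameter families of linear maps -/

section LinearFamilies

variable {N : ℕ∞}

open Polynomial in
/-- The value of a polynomial at `t c`. -/
def polyAt (c : evenPart N) (q : ℂ[X]) (t : ℂ) : evenPart N := aeval (cst t * c) q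

variable (c : evenPart N)

theorem polyAt_add (p q : Polynomial ℂ) (t : ℂ) : polyAt c (p + q) t = polyAt c p t + polyAt c q t :=
  map_add _ _ _

theorem polyAt_sub (p q : Polynomial ℂ) (t : ℂ) : polyAt c (p - q) t = polyAt c p t - polyAt c q t :=
  map_sub _ _ _

theorem polyAt_mul (p q : Polynomial ℂ) (t : ℂ) : polyAt c (p * q) t = polyAt c p t * polyAt c q t :=
  map_mul _ _ _

theorem polyAt_one (t : ℂ) : polyAt c 1 t = 1 := map_one _

theorem polyAt_zero (q : Polynomial ℂ) : polyAt c q 0 = cst (q.eval 0) := by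
  rw [polyAt, cst, map_zero, zero_mul, Polynomial.aeval_def, Polynomial.eval₂_at_zero,
    Polynomial.coeff_zero_eq_eval_zero]

/-- For `s` the body of `c` this supplies the nilpotent divisor required in `IsSAE.inverse`: the
denominators differ from scalar analytic functions by multiples of the soul of `c`. -/
theorem sub_dvd_polyAt (q : Polynomial ℂ) (t s : ℂ) :
    c - cst s ∣ polyAt c q t - cst (q.eval (t * s)) := by
  have h1 : cst (N := N) t * c - cst (t * s) ∣ polyAt c q t - cst (q.eval (t * s)) := by
    have := Polynomial.sub_dvd_eval_sub (cst (N := N) t * c) (cst (t * s))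
      (q.map (algebraMap ℂ (evenPart N)))
    rwa [Polynomial.eval_map_algebraMap, Polynomial.eval_map_algebraMap,
      Polynomial.aeval_algebraMap_apply_eq_algebraMap_eval] at this
  refine dvd_trans ⟨cst t, ?_⟩ h1
  rw [cst, cst, cst, map_mul]
  ring

theorem body_polyAt (q : Polynomial ℂ) (t : ℂ) :
    body (polyAt c q t : Grassmann N) = q.eval (t * body (c : Grassmann N)) := by
  have h1 : (body.comp (evenPart N).val) (polyAt c q t) =
      Polynomial.aeval ((body.comp (evenPart N).val) (cst t * c)) q :=
    (Polynomial.aeval_algHom_apply _ _ _).symm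
  rw [map_mul, AlgHom.commutes, Polynomial.coe_aeval_eq_eval] at h1
  exact h1

variable {c}

theorem isSAE_polyAt (hc : (c : Grassmann N) ∈ grPart N 2 0) (U : Set (ℂ × ℂ)) (q : Polynomial ℂ) :
    IsSAE U (fun t _ => polyAt c q t) 0 (fun _ => c * cst (q.derivative.eval 0)) := by
  induction q using Polynomial.induction_on with
  | C a =>
    refine (IsSAE.constC a).congr (fun t z _ => ⟨Polynomial.aeval_C _ _, rfl⟩) fun z _ => ?_
    rw [Polynomial.derivative_C, Polynomial.eval_zero, cst, map_zero, mul_zero]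
    rfl
  | add p q hp hq =>
    refine (hp.add hq).congr (fun t z _ => ⟨polyAt_add c p q t, (add_zero _).symm⟩) fun z _ => ?_
    rw [Polynomial.derivative_add, Polynomial.eval_add, cst, map_add, mul_add]
    rfl
  | monomial k a ih =>
    refine (ih.mul (IsSAE.param.mul (IsSAE.const hc))).congr (fun t z _ => ⟨?_, ?_⟩) fun z _ => ?_
    · simp only [Pi.mul_apply, polyAt, pow_succ, map_mul, Polynomial.aeval_X, mul_assoc, cst]
    · simp
    · have h0 : (algebraMap ℂ (evenPart N)) 0 = 0 := map_zero _
      simp only [Pi.mul_apply, Pi.add_apply, Pi.one_apply, Pi.zero_apply, one_mul, mul_zero,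
        add_zero, h0, zero_mul, zero_add, polyAt_zero, pow_succ, ← mul_assoc,
        Polynomial.derivative_mul, Polynomial.eval_add, Polynomial.eval_mul, Polynomial.eval_X,
        Polynomial.derivative_X, Polynomial.eval_one, mul_one]
      exact mul_comm _ _

/-- The affine function `x ↦ P(t c) x + Q(t c)`. -/
def affine (c : evenPart N) (P Q : Polynomial ℂ) (t : ℂ) (x : evenPart N) : evenPart N :=
  polyAt c P t * x + polyAt c Q t

/-- The set of bodies where the affine function is invertible. -/
def affineDomain (c : evenPart N) (P Q : Polynomial ℂ) : Set (ℂ × ℂ) :=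
  {y | P.eval (y.1 * body (c : Grassmann N)) * y.2 + Q.eval (y.1 * body (c : Grassmann N)) ≠ 0}

theorem isOpen_affineDomain (P Q : Polynomial ℂ) : IsOpen (affineDomain c P Q) := by
  refine isOpen_ne.preimage (f := fun y : ℂ × ℂ => P.eval (y.1 * body (c : Grassmann N)) * y.2 +
    Q.eval (y.1 * body (c : Grassmann N))) ?_
  fun_prop

theorem body_affine (P Q : Polynomial ℂ) (t : ℂ) (x : evenPart N) :
    body (affine c P Q t x : Grassmann N) = P.eval (t * body (c : Grassmann N)) * body (x : Grassmann N)
      + Q.eval (t * body (c : Grassmann N)) := by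
  have : (affine c P Q t x : Grassmann N) =
    (polyAt c P t : Grassmann N) * (x : Grassmann N) + (polyAt c Q t : Grassmann N) := rfl
  rw [this, map_add, map_mul, body_polyAt, body_polyAt]

theorem isUnit_affine_iff (P Q : Polynomial ℂ) (t : ℂ) (x : evenPart N) :
    IsUnit (affine c P Q t x) ↔ (t, body (x : Grassmann N)) ∈ affineDomain c P Q := by
  rw [isUnit_even_iff, body_affine]
  rfl

theorem isSAE_affine (hc : (c : Grassmann N) ∈ grPart N 2 0) (U : Set (ℂ × ℂ))
    (P Q : Polynomial ℂ) : IsSAE U (affine c P Q) (fun t _ => polyAt c P t)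
      (fun x => c * (cst (P.derivative.eval 0) * x + cst (Q.derivative.eval 0))) := by
  refine (((isSAE_polyAt hc U P).mul IsSAE.var).add (isSAE_polyAt hc U Q)).congr
    (fun t x _ => ⟨rfl, by simp⟩) fun x _ => ?_
  simp only [Pi.add_apply, Pi.mul_apply, Pi.zero_apply, mul_zero, add_zero]
  ring

theorem isNilpotent_sub_cst (x : evenPart N) : IsNilpotent (x - cst (body (x : Grassmann N))) := by
  obtain ⟨k, hk⟩ := isNilpotent_soul x.2
  exact ⟨k, Subtype.ext hk⟩

theorem extE_id (x : evenPart N) : extE (fun y => y) x = x := Subtype.ext (ext_id x.2)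

theorem extE_add {g h : ℂ → ℂ} {z : evenPart N} (hg : AnalyticAt ℂ g (body (z : Grassmann N)))
    (hh : AnalyticAt ℂ h (body (z : Grassmann N))) : extE (g + h) z = extE g z + extE h z :=
  Subtype.ext (ext_add z.2 hg hh)

theorem extE_affine (a b : ℂ) (x : evenPart N) :
    extE (fun y => a * y + b) x = cst a * x + cst b := by
  have h1 : AnalyticAt ℂ (fun _ : ℂ => a) (body (x : Grassmann N)) := analyticAt_const
  have h2 : AnalyticAt ℂ (fun y : ℂ => y) (body (x : Grassmann N)) := analyticAt_id
  have h3 : AnalyticAt ℂ (fun _ : ℂ => b) (body (x : Grassmann N)) := analyticAt_const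
  rw [show (fun y => a * y + b) = (fun _ => a) * (fun y => y) + fun _ => b from rfl,
    extE_add (h1.mul h2) h3, extE_mul h1 h2, extE_const, extE_const, extE_id]

theorem isSAE_inverse_affine (hc : (c : Grassmann N) ∈ grPart N 2 0) (P Q : Polynomial ℂ) :
    IsSAE (affineDomain c P Q) (fun t x => Ring.inverse (affine c P Q t x))
      (fun t x => -(Ring.inverse (affine c P Q t x) ^ 2 * polyAt c P t))
      (fun x => -(Ring.inverse (affine c P Q 0 x) ^ 2 *
        (c * (cst (P.derivative.eval 0) * x + cst (Q.derivative.eval 0))))) := by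
  refine (IsSAE.inverse (isOpen_affineDomain P Q) (isSAE_affine hc _ P Q)
    (b := fun t y => P.eval (t * body (c : Grassmann N)) * y + Q.eval (t * body (c : Grassmann N)))
    ?_ (fun y hy => hy) (isNilpotent_sub_cst c) fun t x _ => ?_).2
  · intro y _
    have hp : ∀ q : Polynomial ℂ, AnalyticAt ℂ
        (fun y : ℂ × ℂ => q.eval (y.1 * body (c : Grassmann N))) y := fun q =>
      AnalyticAt.aeval_polynomial (_root_.analyticAt_fst.fun_mul analyticAt_const) q
    exact ((hp P).fun_mul _root_.analyticAt_snd).fun_add (hp Q)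
  · rw [extE_affine, affine]
    have h1 := sub_dvd_polyAt c P t (body (c : Grassmann N))
    have h2 := sub_dvd_polyAt c Q t (body (c : Grassmann N))
    have := (h1.mul_right x).add h2
    convert this using 1
    ring

theorem isSAE_zp_affine (hc : (c : Grassmann N) ∈ grPart N 2 0) (P Q : Polynomial ℂ) (k : ℤ) :
    IsSAE (affineDomain c P Q) (fun t x => zp (affine c P Q t x) k)
      (fun t x => (k : evenPart N) * zp (affine c P Q t x) (k - 1) * polyAt c P t)
      (fun x => (k : evenPart N) * zp (affine c P Q 0 x) (k - 1) *
        (c * (cst (P.derivative.eval 0) * x + cst (Q.derivative.eval 0)))) :=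
  (isSAE_affine hc _ P Q).zp_of_inverse (fun t x hx => (isUnit_affine_iff P Q t x).mpr hx)
    (isSAE_inverse_affine hc P Q) k

end LinearFamilies

/-! ### Even infinitesimal automorphisms -/

section EvenTangent

variable {N : ℕ∞}

open Polynomial

/-- The scale factor of the first odd coordinate in the family generated by
`(a + b z + d z²) ∂_z + …`. -/
def scaleP (e : ℂ) : ℂ[X] := 1 + C e * X

/-- The entries `(p, q)` of the row of the matrix of the family which is the denominator in a
chart. -/
def rowD (a b d e : ℂ) : Chart → ℂ[X] × ℂ[X]
  | .south => (-(C d * X), 1)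
  | .north => (scaleP e * scaleP (b - e) - C (a * d) * X ^ 2, C a * X)

/-- The entries of the other row. -/
def rowN (a b d e : ℂ) : Chart → ℂ[X] × ℂ[X]
  | .north => (-(C d * X), 1)
  | .south => (scaleP e * scaleP (b - e) - C (a * d) * X ^ 2, C a * X)

/-- The coefficients of a row, in a chart. -/
def inChart : Chart → ℂ[X] × ℂ[X] → ℂ[X] × ℂ[X]
  | .south, r => r
  | .north, r => (r.2, r.1)

/-- The sign of the determinant in a pair of charts. -/
def detSign (α β : Chart) : ℂ := (kout β * kin α) ^ 2

/-- The summand -ad X² in one entry is there to make the determinant exactly the product of the two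
scale factors. It has order two in `t`, so the velocity does not see it. Exchanging charts permutes
rows or columns, which accounts for the sign. -/
theorem row_det (a b d e : ℂ) (α β : Chart) :
    (inChart α (rowN a b d e β)).1 * (inChart α (rowD a b d e β)).2 -
      (inChart α (rowN a b d e β)).2 * (inChart α (rowD a b d e β)).1 =
      C (detSign α β) * (scaleP e * scaleP (b - e)) := by
  have hI : C Complex.I ^ 2 = (-1 : ℂ[X]) := by rw [← C_pow, Complex.I_sq]; simp
  cases α <;> cases β <;> simp [inChart, rowN, rowD, detSign, kin, kout]
  all_goals ring_nf

variable (a b d e : ℂ) (c : evenPart N)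

/-- The matrix of the family at time `t`. -/
def flowMap (t : ℂ) (h₁ : IsUnit (polyAt c (scaleP e) t)) (h₂ : IsUnit (polyAt c (scaleP (b - e)) t)) :
    EvenMap N where
  a := polyAt c (rowD a b d e .north).1 t
  b := polyAt c (rowD a b d e .north).2 t
  c := polyAt c (rowD a b d e .south).1 t
  d := polyAt c (rowD a b d e .south).2 t
  r := polyAt c (scaleP e) t
  s := polyAt c (scaleP (b - e)) t
  isUnit_det := by
    rw [← polyAt_mul, ← polyAt_mul, ← polyAt_sub]
    have := row_det a b d e .south .south
    simp only [inChart, rowN, rowD, detSign, kin, kout, mul_one, one_pow, map_one, one_mul] at this ⊢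
    rw [this, polyAt_mul]
    exact h₁.mul h₂
  isUnit_r := h₁
  isUnit_s := h₂

open Classical in
/-- The family of bijections of the sphere. -/
def flow (n : ℤ) (t : ℂ) : Equiv.Perm (Sphere N n) :=
  if h : IsUnit (polyAt c (scaleP e) t) ∧ IsUnit (polyAt c (scaleP (b - e)) t) then
    (flowMap a b d e c t h.1 h.2).toPerm n
  else 1

theorem flow_zero (n : ℤ) : flow a b d e c n 0 = 1 := by
  unfold flow
  split_ifs with h
  · apply EvenMap.toPerm_eq_one <;> simp only [flowMap, polyAt_zero] <;> simp [rowD, scaleP, cst]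
  · rfl

theorem flow_chartInv_eq_iff (n : ℤ) {t : ℂ} (h₁ : IsUnit (polyAt c (scaleP e) t))
    (h₂ : IsUnit (polyAt c (scaleP (b - e)) t)) (α β : Chart) (p q : Point N) :
    flow a b d e c n t (chartInv α p) = chartInv β q ↔
      IsUnit (affine c (inChart α (rowD a b d e β)).1 (inChart α (rowD a b d e β)).2 t p.z) ∧
      q = mkPt (affine c (inChart α (rowN a b d e β)).1 (inChart α (rowN a b d e β)).2 t p.z *
          Ring.inverse (affine c (inChart α (rowD a b d e β)).1 (inChart α (rowD a b d e β)).2 t p.z))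
        ((cst (N := N) (kout β * kin α) * polyAt c (scaleP e) t * zp (affine c
          (inChart α (rowD a b d e β)).1 (inChart α (rowD a b d e β)).2 t p.z) (n - 1)) • p.thP)
        ((cst (N := N) (kout β * kin α) * polyAt c (scaleP (b - e)) t * zp (affine c
          (inChart α (rowD a b d e β)).1 (inChart α (rowD a b d e β)).2 t p.z) (-n - 1)) • p.thM) := by
  rw [flow, dif_pos ⟨h₁, h₂⟩, EvenMap.toPerm_chartInv_eq_iff]
  set g := flowMap a b d e c t h₁ h₂
  have hD : den β (g.row₁ (homU α p.z) (homV α p.z)) (g.row₂ (homU α p.z) (homV α p.z)) =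
      affine c (inChart α (rowD a b d e β)).1 (inChart α (rowD a b d e β)).2 t p.z := by
    cases α <;> cases β <;>
      simp only [den, EvenMap.row₁, EvenMap.row₂, homU, homV, inChart, affine, mul_one] <;>
      first | rfl | exact add_comm _ _
  have hN : num β (g.row₁ (homU α p.z) (homV α p.z)) (g.row₂ (homU α p.z) (homV α p.z)) =
      affine c (inChart α (rowN a b d e β)).1 (inChart α (rowN a b d e β)).2 t p.z := by
    cases α <;> cases β <;>
      simp only [num, EvenMap.row₁, EvenMap.row₂, homU, homV, inChart, affine, mul_one] <;>
      first | rfl | exact add_comm _ _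
  rw [projPt, hD, hN, smul_smul, smul_smul, smul_smul, smul_smul]
  have hk : ∀ x y : evenPart N, cst (kout β) * y * x * cst (kin α) =
      cst (kout β * kin α) * x * y := fun x y => by
    rw [cst, cst, cst, map_mul]
    ring
  rw [hk, hk]
  rfl

theorem isSAE_scMap_coeff {U : Set (ℂ × ℂ)} {w wz x xz y yz : ℂ → evenPart N → evenPart N}
    {wt xt yt : evenPart N → evenPart N} (hw : IsSAE U w wz wt) (hx : IsSAE U x xz xt)
    (hy : IsSAE U y yz yt) (i : Fin 3) (k : Fin 4) :
    IsSA U (fun t z => scMap 0 (w t z) (x t z) (y t z) 0 0 0 0 i k)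
      (fun t z => scMap 0 (wz t z) (xz t z) (yz t z) 0 0 0 0 i k)
      (fun z => scMap 0 (wt z) (xt z) (yt z) 0 0 0 0 i k) := by
  have h0 : IsSA (N := N) U (fun _ _ => 0) (fun _ _ => 0) (fun _ => 0) := IsSA.zero
  fin_cases i <;> fin_cases k <;> simp only [scMap, smul_zero, neg_zero]
  · exact hw
  · exact h0
  · exact h0
  · exact h0
  · exact h0
  · exact hx
  · exact h0
  · exact h0
  · exact h0
  · exact h0
  · exact hy
  · exact h0

theorem scEqs_scMap_zero {w w' a a' b b' : evenPart N} (hw : w' = a * b) (p : Point N) :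
    ScEqs (scMap 0 w a b 0 0 0 0) (scMap 0 w' a' b' 0 0 0 0) p := by
  have h := scEqs_scMap (w := w) (a' := a') (b' := b') (g := 0) (g' := 0) (g'' := 0) (h := 0)
    (h' := 0) (h'' := 0) (Submodule.zero_mem (grPart N 0 1)) hw p
  simpa only [scMap, smul_zero, neg_zero] using h

theorem inverse_mul_zp_sub {x : evenPart N} (hx : IsUnit x) (n : ℤ) :
    zp x (n - 1) * zp x (-n - 1) = Ring.inverse x ^ 2 := by
  rw [← zp_add hx, show n - 1 + (-n - 1) = -2 by ring, ← zp_inverse hx]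
  rfl

/-- The derivative of a quotient of affine functions is the determinant divided by the square of the
denominator. As the exponents n - 1 and - n - 1 add up to -2, this is the product of the
coefficients of θ⁺ and θ⁻, the condition w' = ab of `scEqs_scMap`. -/
theorem det_identity {R : Type*} [CommRing R] {x p q p' q' i σ ρ₁ ρ₂ κ z₁ z₂ : R}
    (hi : (p * x + q) * i = 1) (hdet : p' * q - q' * p = σ * (ρ₁ * ρ₂)) (hκ : κ ^ 2 = σ)
    (hz : z₁ * z₂ = i ^ 2) :
    p' * i + (p' * x + q') * -(i ^ 2 * p) = κ * ρ₁ * z₁ * (κ * ρ₂ * z₂) := by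
  subst hκ
  linear_combination (-(p' * i)) * hi + i ^ 2 * hdet - κ ^ 2 * ρ₁ * ρ₂ * hz

/-- The parameter enters through tc only, so the velocity of `flow` at 0 carries the factor c. The
curve is not a one-parameter group; tangency requires only the right first derivative. -/
theorem isTangent_of_even (n : ℤ) {c : Grassmann N} (hc : c ∈ grPart N 2 0) (a b d e : ℂ)
    (W : Fin 3 → Point N → Grassmann N)
    (hW0 : ∀ p : Point N, W 0 p = c * (cst (N := N) a + cst (N := N) b * p.z + cst (N := N) d * p.z ^ 2 : evenPart N))
    (hW1 : ∀ p : Point N, W 1 p = c * ((cst (N := N) e + cst (N := N) ((1 - n) * d) * p.z : evenPart N) • p.1 1))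
    (hW2 : ∀ p : Point N, W 2 p = c * ((cst (N := N) (b - e) + cst (N := N) ((1 + n) * d) * p.z : evenPart N) • p.1 2)) :
    IsTangent N n W := by
  obtain ⟨c, rfl⟩ : ∃ x : evenPart N, (x : Grassmann N) = c := ⟨⟨c, grPart_le_zero 0 hc⟩, rfl⟩
  -- The scale factors are 1 at `t = 0`, so their bodies are nonzero for small `t`; for other `t`
  -- the definition of `flow` returns the identity.
  obtain ⟨R, hR, hRu⟩ : ∃ R > 0, ∀ t : ℂ, ‖t‖ < R →
      IsUnit (polyAt c (scaleP e) t) ∧ IsUnit (polyAt c (scaleP (b - e)) t) := by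
    have h1 : ∀ e : ℂ, ∀ᶠ t in 𝓝 (0 : ℂ), IsUnit (polyAt c (scaleP e) t) := by
      intro e
      simp only [isUnit_even_iff, body_polyAt]
      have hcont : ContinuousAt (fun t => (scaleP e).eval (t * body (c : Grassmann N))) 0 := by
        fun_prop
      exact hcont.eventually_ne (by simp [scaleP])
    obtain ⟨R, hR, h⟩ := Metric.eventually_nhds_iff.mp ((h1 e).and (h1 (b - e)))
    exact ⟨R, hR, fun t ht => h (by simpa using ht)⟩
  set D : Chart → Chart → ℂ → evenPart N → evenPart N := fun α β =>
    affine c (inChart α (rowD a b d e β)).1 (inChart α (rowD a b d e β)).2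
  set M : Chart → Chart → ℂ → evenPart N → evenPart N := fun α β =>
    affine c (inChart α (rowN a b d e β)).1 (inChart α (rowN a b d e β)).2
  set U : Chart → Chart → Set (ℂ × ℂ) := fun α β =>
    affineDomain c (inChart α (rowD a b d e β)).1 (inChart α (rowD a b d e β)).2
  have hw := fun α β => (isSAE_affine hc (U α β) (inChart α (rowN a b d e β)).1
    (inChart α (rowN a b d e β)).2).mul (isSAE_inverse_affine hc (inChart α (rowD a b d e β)).1
    (inChart α (rowD a b d e β)).2)
  have hx := fun α β => ((IsSAE.constC (kout β * kin α)).mul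
    (isSAE_polyAt hc (U α β) (scaleP e))).mul (isSAE_zp_affine hc
    (inChart α (rowD a b d e β)).1 (inChart α (rowD a b d e β)).2 (n - 1))
  have hy := fun α β => ((IsSAE.constC (kout β * kin α)).mul
    (isSAE_polyAt hc (U α β) (scaleP (b - e)))).mul (isSAE_zp_affine hc
    (inChart α (rowD a b d e β)).1 (inChart α (rowD a b d e β)).2 (-n - 1))
  have hz0 : ∀ x : evenPart N, affine c (inChart .south (rowD a b d e .south)).1
      (inChart .south (rowD a b d e .south)).2 0 x = 1 := fun x => by
    simp [affine, polyAt_zero, inChart, rowD, cst]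
  refine isTangent_of_family hR (flow a b d e c n) (flow_zero a b d e c n) W U
    (fun α β => isOpen_affineDomain _ _) _ _ _
    (fun α β => isSAE_scMap_coeff (hw α β) (hx α β) (hy α β)) ?_ ?_ ?_ ?_ ?_
  · intro α β t ht p
    constructor
    · rintro ⟨q, hq⟩
      exact (isUnit_affine_iff _ _ t p.z).mp
        ((flow_chartInv_eq_iff a b d e c n (hRu t ht).1 (hRu t ht).2 α β p q).mp hq).1
    · intro hp
      exact ⟨_, (flow_chartInv_eq_iff a b d e c n (hRu t ht).1 (hRu t ht).2 α β p _).mpr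
        ⟨(isUnit_affine_iff _ _ t p.z).mpr hp, rfl⟩⟩
  · intro α β t ht p q hq i
    rw [((flow_chartInv_eq_iff a b d e c n (hRu t ht).1 (hRu t ht).2 α β p q).mp hq).2]
    fin_cases i
    · simp [ev4, scMap, mkPt]
    · simp only [ev4, scMap, mkPt, smul_zero, mul_zero, zero_add, add_zero, neg_zero,
        Matrix.cons_val, Fin.mk_one, Fin.isValue]
      rw [mul_coe_even]
      rfl
    · simp only [ev4, scMap, mkPt, smul_zero, mul_zero, zero_add, add_zero, neg_zero,
        Matrix.cons_val, Fin.reduceFinMk, Fin.isValue]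
      rw [mul_coe_even]
      rfl
  · intro α β t ht p hp
    have hu := (isUnit_affine_iff _ _ t p.z).mpr hp
    have hdet := congrArg (fun q => polyAt c q t) (row_det a b d e α β)
    simp only [polyAt_sub, polyAt_mul] at hdet
    have hκ : cst (N := N) (kout β * kin α) ^ 2 = polyAt c (C (detSign α β)) t := by
      rw [polyAt, aeval_C, detSign, cst, ← map_pow]
    refine scEqs_scMap_zero ?_ p
    have key := det_identity (Ring.mul_inverse_cancel _ hu) hdet hκ (inverse_mul_zp_sub hu n)
    simp only [Pi.add_apply, Pi.mul_apply, Pi.zero_apply, zero_mul, mul_zero, zero_add, add_zero]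
    exact key
  · intro α β t ht p hp
    have hu := (isUnit_affine_iff _ _ t p.z).mpr hp
    have hk : IsUnit (cst (N := N) (kout β * kin α)) :=
      (IsUnit.mk0 _ (by cases α <;> cases β <;> simp [kin, kout])).map _
    exact ⟨isUnit_even_iff.mp ((hk.mul (hRu t ht).1).mul (isUnit_zp hu _)),
      isUnit_even_iff.mp ((hk.mul (hRu t ht).2).mul (isUnit_zp hu _))⟩
  · intro p i
    have hm0 : affine c (inChart .south (rowN a b d e .south)).1
        (inChart .south (rowN a b d e .south)).2 0 p.z = p.z := by
      simp [affine, polyAt_zero, inChart, rowN, cst, scaleP]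
    have hN1 : (inChart .south (rowN a b d e .south)).1.derivative.eval 0 = b := by
      simp [inChart, rowN, scaleP]
    have hN2 : (inChart .south (rowN a b d e .south)).2.derivative.eval 0 = a := by
      simp [inChart, rowN]
    have hD1 : (inChart .south (rowD a b d e .south)).1.derivative.eval 0 = -d := by
      simp [inChart, rowD]
    have hD2 : (inChart .south (rowD a b d e .south)).2.derivative.eval 0 = 0 := by
      simp [inChart, rowD]
    have hs : ∀ e : ℂ, (scaleP e).derivative.eval 0 = e := fun e => by simp [scaleP]
    have hs0 : ∀ e : ℂ, polyAt c (scaleP e) 0 = 1 := fun e => by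
      simp [polyAt_zero, scaleP, cst]
    fin_cases i
    · rw [Fin.zero_eta, hW0]
      simp only [ev4, scMap, smul_zero, mul_zero, add_zero, neg_zero, Matrix.cons_val, Pi.add_apply,
        Pi.mul_apply, hz0, hm0, hN1, hN2, hD1, hD2, Ring.inverse_one]
      change ((c * _ : evenPart N) : Grassmann N) = _
      congr 1
      simp only [cst, map_neg, map_zero]
      ring
    · rw [Fin.mk_one, hW1]
      simp only [ev4, scMap, smul_zero, mul_zero, zero_add, add_zero, neg_zero, Matrix.cons_val,
        Pi.add_apply, Pi.mul_apply, hz0, hD1, hD2, hs, hs0, zp_one, kin, kout]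
      rw [mul_coe_even]
      refine (mul_smul c _ (p.1 1)).symm.trans (congrArg (· • p.1 1) ?_)
      simp only [cst, map_neg, map_zero, map_mul, map_sub, map_one, map_intCast, Pi.zero_apply,
        Int.cast_sub, Int.cast_one]
      ring
    · rw [show (⟨2, by norm_num⟩ : Fin 3) = 2 from rfl, hW2]
      simp only [ev4, scMap, smul_zero, mul_zero, zero_add, add_zero, neg_zero, Matrix.cons_val,
        Pi.add_apply, Pi.mul_apply, hz0, hD1, hD2, hs, hs0, zp_one, kin, kout]
      rw [mul_coe_even]
      refine (mul_smul c _ (p.1 2)).symm.trans (congrArg (· • p.1 2) ?_)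
      simp only [cst, map_neg, map_zero, map_mul, map_sub, map_add, map_one, map_intCast,
        Pi.zero_apply, Int.cast_sub, Int.cast_neg, Int.cast_one]
      ring

end EvenTangent

/-! ### Products of odd elements -/

section OddProducts

variable {N : ℕ∞}

/-- The product of two odd elements. -/
def oddMul (x y : oddPart N) : evenPart N :=
  ⟨(x : Grassmann N) * y, by have := mul_mem_grPart x.2 y.2; exact this⟩

theorem coe_oddMul (x y : oddPart N) : (oddMul x y : Grassmann N) = (x : Grassmann N) * y := rfl

theorem coe_smul_odd (a : evenPart N) (x : oddPart N) :
    ((a • x : oddPart N) : Grassmann N) = (a : Grassmann N) * x := rfl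

theorem oddMul_smul_left (x c : oddPart N) : oddMul x c • x = 0 := Subtype.ext (by
  rw [coe_smul_odd, coe_oddMul, mul_assoc, odd_mul_odd c.2 x.2, mul_neg, ← mul_assoc,
    odd_mul_self x.2, zero_mul, neg_zero]; rfl)

theorem oddMul_smul_right (x c : oddPart N) : oddMul x c • c = 0 := Subtype.ext (by
  rw [coe_smul_odd, coe_oddMul, mul_assoc, odd_mul_self c.2, mul_zero]; rfl)

theorem oddMul_smul_swap (x y c : oddPart N) : oddMul x c • y = -(oddMul x y • c) := Subtype.ext (by
  rw [NegMemClass.coe_neg, coe_smul_odd, coe_oddMul, coe_smul_odd, coe_oddMul, mul_assoc,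
    odd_mul_odd c.2 y.2, mul_neg, mul_assoc])

theorem oddMul_comm (x y : oddPart N) : oddMul x y = -oddMul y x := Subtype.ext (by
  rw [NegMemClass.coe_neg, coe_oddMul, coe_oddMul, odd_mul_odd x.2 y.2])

theorem oddMul_self (x : oddPart N) : oddMul x x = 0 := Subtype.ext (odd_mul_self x.2)

theorem oddMul_mul_oddMul (x y c : oddPart N) : oddMul x c * oddMul y c = 0 := Subtype.ext (by
  change (x : Grassmann N) * c * ((y : Grassmann N) * c) = 0
  rw [mul_assoc, odd_mul_odd y.2 c.2, mul_neg, ← mul_assoc (c : Grassmann N), odd_mul_self c.2,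
    zero_mul, neg_zero, mul_zero])

theorem oddMul_add_left (x x' y : oddPart N) : oddMul (x + x') y = oddMul x y + oddMul x' y :=
  Subtype.ext (add_mul _ _ _)

theorem oddMul_add_right (x y y' : oddPart N) : oddMul x (y + y') = oddMul x y + oddMul x y' :=
  Subtype.ext (mul_add _ _ _)

theorem oddMul_smul_left_eq (a : evenPart N) (x y : oddPart N) :
    oddMul (a • x) y = a * oddMul x y :=
  Subtype.ext (mul_assoc _ _ _)

theorem oddMul_smul_right_eq (a : evenPart N) (x y : oddPart N) :
    oddMul x (a • y) = a * oddMul x y := by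
  rw [oddMul_comm, oddMul_smul_left_eq, oddMul_comm x y, mul_neg]

theorem body_oddMul (x y : oddPart N) : body (oddMul x y : Grassmann N) = 0 := by
  rw [coe_oddMul, map_mul, body_odd x.2, zero_mul]

/-- Since ν² = 0, first-order Taylor expansion is exact; the same holds for the integer powers
below. -/
theorem inverse_add_sq_zero {x ν : evenPart N} (hx : IsUnit x) (hν : ν * ν = 0) :
    Ring.inverse (x + ν) = Ring.inverse x - Ring.inverse x ^ 2 * ν := by
  have h1 := Ring.mul_inverse_cancel x hx
  have h2 : (x + ν) * (Ring.inverse x - Ring.inverse x ^ 2 * ν) = 1 := by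
    linear_combination (1 - Ring.inverse x * ν) * h1 - Ring.inverse x ^ 2 * hν
  have h3 : IsUnit (x + ν) := IsUnit.of_mul_eq_one _ h2
  have h4 := Ring.inverse_mul_cancel _ h3
  linear_combination (Ring.inverse x - Ring.inverse x ^ 2 * ν) * h4 - Ring.inverse (x + ν) * h2

theorem pow_add_sq_zero {R : Type*} [CommRing R] {x ν : R} (hν : ν * ν = 0) (k : ℕ) :
    (x + ν) ^ (k + 1) = x ^ (k + 1) + (k + 1) * x ^ k * ν := by
  induction k with
  | zero => simp
  | succ k ih =>
    rw [pow_succ, ih]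
    push_cast
    linear_combination ((k + 1) * x ^ k) * hν

theorem zp_add_sq_zero {x ν : evenPart N} (hx : IsUnit x) (hν : ν * ν = 0) (k : ℤ) :
    zp (x + ν) k = zp x k + k * zp x (k - 1) * ν := by
  have h1 := Ring.mul_inverse_cancel x hx
  rcases k with k | k
  · rcases k with _ | k
    · have h0 : ∀ y : evenPart N, zp y (Int.ofNat 0) = 1 := fun y => pow_zero y
      rw [h0, h0]
      simp
    · have e : Int.ofNat (k + 1) - 1 = Int.ofNat k := by simp
      rw [e]
      have := pow_add_sq_zero (x := x) hν k
      simpa [zp] using this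
  · have hm : (-(Ring.inverse x ^ 2 * ν)) * (-(Ring.inverse x ^ 2 * ν)) = 0 := by
      linear_combination (Ring.inverse x ^ 4) * hν
    have := pow_add_sq_zero (x := Ring.inverse x) hm k
    have e : Int.negSucc k - 1 = Int.negSucc (k + 1) := by
      rw [Int.negSucc_eq, Int.negSucc_eq]; push_cast; ring
    rw [e]
    change Ring.inverse (x + ν) ^ (k + 1) = Ring.inverse x ^ (k + 1) +
      ((Int.negSucc k : ℤ) : evenPart N) * Ring.inverse x ^ (k + 1 + 1) * ν
    rw [inverse_add_sq_zero hx hν, sub_eq_add_neg, this, Int.cast_negSucc]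
    push_cast
    ring

/-- The difference of the values of a polynomial is divisible by ν, which `y` annihilates: after
multiplication by `y`, a shift of the argument by ν is invisible. -/
theorem aeval_add_mul {z ν y : evenPart N} (h : ν * y = 0) (q : Polynomial ℂ) :
    Polynomial.aeval (z + ν) q * y = Polynomial.aeval z q * y := by
  have h1 : z + ν - z ∣ Polynomial.aeval (z + ν) q - Polynomial.aeval z q := by
    have := Polynomial.sub_dvd_eval_sub (z + ν) z (q.map (algebraMap ℂ (evenPart N)))
    rwa [Polynomial.eval_map_algebraMap, Polynomial.eval_map_algebraMap] at this
  obtain ⟨s, hs⟩ := h1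
  linear_combination y * hs + s * h

theorem aeval_add_smul {z ν : evenPart N} {y : oddPart N} (h : ν • y = 0) (q : Polynomial ℂ) :
    Polynomial.aeval (z + ν) q • y = Polynomial.aeval z q • y := by
  have h1 : z + ν - z ∣ Polynomial.aeval (z + ν) q - Polynomial.aeval z q := by
    have := Polynomial.sub_dvd_eval_sub (z + ν) z (q.map (algebraMap ℂ (evenPart N)))
    rwa [Polynomial.eval_map_algebraMap, Polynomial.eval_map_algebraMap] at this
  obtain ⟨s, hs⟩ := h1
  rw [eq_add_of_sub_eq hs, add_smul, add_sub_cancel_left, mul_comm, mul_smul, h, smul_zero, zero_add]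

end OddProducts

/-! ### Maps with an odd parameter -/

section OddMaps

variable {N : ℕ∞}

/-- The image of a point under the superconformal map `scMap c w a b g g' h h'`. -/
def scPt (c : oddPart N) (w a b g g' h h' : evenPart N) (p : Point N) : Point N :=
  mkPt (w + ((a * h) * oddMul p.thP c + (b * g) * oddMul p.thM c))
    (a • p.thP + (g + g' * oddMul p.thP p.thM) • c)
    (b • p.thM + (h - h' * oddMul p.thP p.thM) • c)

theorem scPt_apply (c : oddPart N) (w a b g g' h h' : evenPart N) (p : Point N) (i : Fin 3) :
    (scPt c w a b g g' h h' p).1 i = ev4 (scMap c w a b g g' h h' i) p := by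
  fin_cases i
  · simp only [scPt, mkPt, ev4, scMap, Matrix.cons_val, Fin.zero_eta, mul_zero, add_zero,
      mul_smul_comm]
    change (w : Grassmann N) + (((a * h : evenPart N) : Grassmann N) * (p.1 1 * c) +
      ((b * g : evenPart N) : Grassmann N) * (p.1 2 * c)) = _
    rw [← add_assoc]
    rfl
  · simp only [scPt, mkPt, ev4, scMap, Matrix.cons_val, Fin.mk_one, mul_zero, add_zero,
      mul_smul_comm, mul_coe_even, add_smul, mul_smul]
    change a • p.1 1 + (g • (c : Grassmann N) + g' • (p.1 1 * p.1 2 * c)) = _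
    abel
  · simp only [scPt, mkPt, ev4, scMap, Matrix.cons_val, Fin.reduceFinMk, mul_zero, add_zero,
      mul_smul_comm, mul_coe_even, sub_smul, mul_smul, neg_smul, mul_neg]
    change b • p.1 2 + (h • (c : Grassmann N) - h' • (p.1 1 * p.1 2 * c)) = _
    abel

/-- The map `id + t c X` in a chart, with `X` the odd field given by the polynomials `g`, `h`. -/
def oddShift (c : oddPart N) (g h : Polynomial ℂ) (t : ℂ) (p : Point N) : Point N :=
  scPt c p.z 1 1 (cst t * Polynomial.aeval p.z g) (cst t * Polynomial.aeval p.z g.derivative)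
    (cst t * Polynomial.aeval p.z h) (cst t * Polynomial.aeval p.z h.derivative) p

/-- Products of odd elements have no body, so a map with odd parameter moves bodies by `w` alone. In
particular the domains of the odd families do not depend on `t`. -/
theorem body_scPt (c : oddPart N) (w a b g g' h h' : evenPart N) (p : Point N) :
    (scPt c w a b g g' h h' p).body = body (w : Grassmann N) := by
  change body ((w : Grassmann N) + (((a * h : evenPart N) : Grassmann N) *
    (oddMul p.thP c : Grassmann N) + ((b * g : evenPart N) : Grassmann N) *
    (oddMul p.thM c : Grassmann N))) = _
  rw [map_add, map_add, map_mul, map_mul, body_oddMul, body_oddMul, mul_zero, mul_zero, add_zero,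
    add_zero]

/-- Every correction produced by the first map contains c and every use of it in the second is
multiplied by c again, so c² = 0 makes the parameters add. -/
theorem oddShift_oddShift (c : oddPart N) (g h : Polynomial ℂ) {s t : ℂ} (hst : s + t = 0)
    (p : Point N) : oddShift c g h s (oddShift c g h t p) = p := by
  set x := p.thP
  set y := p.thM
  set z := p.z
  set p₁ := oddShift c g h t p with hp₁
  set G := Polynomial.aeval z g
  set H := Polynomial.aeval z h
  set G' := Polynomial.aeval z g.derivative
  set H' := Polynomial.aeval z h.derivative
  set ν := (1 * (cst t * H)) * oddMul x c + (1 * (cst t * G)) * oddMul y c with hν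
  have hz : p₁.z = z + ν := rfl
  have hx : p₁.thP = (1 : evenPart N) • x + (cst t * G + cst t * G' * oddMul x y) • c := rfl
  have hy : p₁.thM = (1 : evenPart N) • y + (cst t * H - cst t * H' * oddMul x y) • c := rfl
  have hs : cst (N := N) s = -cst t := by
    rw [eq_neg_of_add_eq_zero_left hst, cst, cst, map_neg]
  have hxc : oddMul p₁.thP c = oddMul x c := by
    rw [hx, oddMul_add_left, oddMul_smul_left_eq, oddMul_smul_left_eq, oddMul_self, mul_zero,
      add_zero, one_mul]
  have hyc : oddMul p₁.thM c = oddMul y c := by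
    rw [hy, oddMul_add_left, oddMul_smul_left_eq, oddMul_smul_left_eq, oddMul_self, mul_zero,
      add_zero, one_mul]
  have ν1 : ν * oddMul x c = 0 := by
    linear_combination (1 * (cst t * H)) * oddMul_mul_oddMul x x c +
      (1 * (cst t * G)) * oddMul_mul_oddMul y x c
  have ν2 : ν * oddMul y c = 0 := by
    linear_combination (1 * (cst t * H)) * oddMul_mul_oddMul x y c +
      (1 * (cst t * G)) * oddMul_mul_oddMul y y c
  have ν3 : ν • c = 0 := by
    simp only [hν, add_smul, mul_smul, oddMul_smul_right, smul_zero, add_zero]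
  have hxy : oddMul p₁.thP p₁.thM • c = oddMul x y • c := by
    rw [hx, hy]
    simp only [oddMul_add_left, oddMul_add_right, oddMul_smul_left_eq, oddMul_smul_right_eq,
      oddMul_self, mul_zero, add_zero, one_mul, add_smul, mul_smul, oddMul_smul_right, smul_zero]
    rw [oddMul_comm c y]
    simp only [neg_smul, oddMul_smul_right, smul_zero, neg_zero, add_zero]
  apply Point.ext
  · change p₁.z + ((1 * (cst s * Polynomial.aeval p₁.z h)) * oddMul p₁.thP c +
      (1 * (cst s * Polynomial.aeval p₁.z g)) * oddMul p₁.thM c) = z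
    rw [hxc, hyc, hz, hs]
    linear_combination (-cst (N := N) t) * aeval_add_mul ν1 h - cst (N := N) t * aeval_add_mul ν2 g
  · change (1 : evenPart N) • p₁.thP + (cst s * Polynomial.aeval p₁.z g +
      cst s * Polynomial.aeval p₁.z g.derivative * oddMul p₁.thP p₁.thM) • c = x
    rw [add_smul, mul_smul, mul_smul, mul_smul, hxy, hz, aeval_add_smul ν3, smul_comm _ (oddMul x y),
      aeval_add_smul ν3, hx, hs]
    module
  · change (1 : evenPart N) • p₁.thM + (cst s * Polynomial.aeval p₁.z h -
      cst s * Polynomial.aeval p₁.z h.derivative * oddMul p₁.thP p₁.thM) • c = y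
    rw [sub_smul, mul_smul, mul_smul, mul_smul, hxy, hz, aeval_add_smul ν3, smul_comm _ (oddMul x y),
      aeval_add_smul ν3, hy, hs]
    module

/-- The coordinate change of a map with an odd parameter. -/
theorem flip_scPt {n : ℤ} {κ : ℂ} (hκ : κ ^ 2 = -1) (c : oddPart N) (g g' h h' : evenPart N)
    {p : Point N} (hp : IsUnit p.z) :
    flip n κ (scPt c p.z 1 1 g g' h h' p) = scPt c (Ring.inverse p.z) (cst κ * zp p.z (n - 1))
      (cst κ * zp p.z (-n - 1)) (cst κ * zp p.z (n - 1) * g)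
      (cst κ * (((n - 1 : ℤ) : evenPart N) * zp p.z (n - 1 - 1)) * g + cst κ * zp p.z (n - 1) * g')
      (cst κ * zp p.z (-n - 1) * h)
      (cst κ * (((-n - 1 : ℤ) : evenPart N) * zp p.z (-n - 1 - 1)) * h + cst κ * zp p.z (-n - 1) * h') p := by
  set x := p.thP
  set y := p.thM
  set z := p.z
  set ν := (1 * h) * oddMul x c + (1 * g) * oddMul y c with hν
  have hz : (scPt c z 1 1 g g' h h' p).z = z + ν := rfl
  have hx : (scPt c z 1 1 g g' h h' p).thP = (1 : evenPart N) • x + (g + g' * oddMul x y) • c := rfl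
  have hy : (scPt c z 1 1 g g' h h' p).thM = (1 : evenPart N) • y + (h - h' * oddMul x y) • c := rfl
  -- Each product of two terms of ν contains c twice.
  have hν2 : ν * ν = 0 := by
    linear_combination (h * h) * oddMul_mul_oddMul x x c + (h * g) * oddMul_mul_oddMul x y c +
      (h * g) * oddMul_mul_oddMul y x c + (g * g) * oddMul_mul_oddMul y y c
  -- κ² = -1 matches the derivative -z⁻² of 1/z with the product of the coefficients of θ⁺ and θ⁻.
  have hk : cst (N := N) κ ^ 2 = -1 := by rw [cst, ← map_pow, hκ, map_neg, map_one]
  -- The expansion of the power of z + ν meets the odd coordinates; these relations reduce each such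
  -- term to a multiple of θ⁺θ⁻c or to zero.
  have r1 := oddMul_smul_left x c
  have r2 : oddMul y c • x = oddMul x y • c := by
    rw [oddMul_smul_swap, oddMul_comm y x, neg_smul, neg_neg]
  have r3 := oddMul_smul_right x c
  have r4 := oddMul_smul_right y c
  have r5 := oddMul_smul_left y c
  have r6 := oddMul_smul_swap x y c
  apply Point.ext
  · rw [flip, mkPt_z, hz, inverse_add_sq_zero hp hν2]
    change _ = Ring.inverse z + ((cst κ * zp z (n - 1) * (cst κ * zp z (-n - 1) * h)) * oddMul x c +
      (cst κ * zp z (-n - 1) * (cst κ * zp z (n - 1) * g)) * oddMul y c)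
    have := inverse_mul_zp_sub hp n
    linear_combination (-(Ring.inverse z ^ 2 * ν)) * hk + (-(cst κ ^ 2 * ν)) * this -
      (Ring.inverse z ^ 2 - cst κ ^ 2 * zp z (n - 1) * zp z (-n - 1) +
        cst κ ^ 2 * zp z (n - 1) * zp z (-n - 1) - Ring.inverse z ^ 2) * hν
  · rw [flip, mkPt_thP, hz, hx, zp_add_sq_zero hp hν2]
    change _ = (cst κ * zp z (n - 1)) • x + (cst κ * zp z (n - 1) * g +
      (cst κ * (((n - 1 : ℤ) : evenPart N) * zp z (n - 1 - 1)) * g + cst κ * zp z (n - 1) * g') * oddMul x y) • c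
    generalize ((n - 1 : ℤ) : evenPart N) = m
    set K := cst (N := N) κ * (m * zp z (n - 1 - 1))
    linear_combination (norm := skip) (K * h) • r1 + (K * g) • r2 +
      (K * (g + g' * oddMul x y) * h) • r3 + (K * (g + g' * oddMul x y) * g) • r4
    module
  · rw [flip, mkPt_thM, hz, hy, zp_add_sq_zero hp hν2]
    change _ = (cst κ * zp z (-n - 1)) • y + (cst κ * zp z (-n - 1) * h -
      (cst κ * (((-n - 1 : ℤ) : evenPart N) * zp z (-n - 1 - 1)) * h + cst κ * zp z (-n - 1) * h') * oddMul x y) • c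
    generalize ((-n - 1 : ℤ) : evenPart N) = m
    set K := cst (N := N) κ * (m * zp z (-n - 1 - 1))
    linear_combination (norm := skip) (K * g) • r5 + (K * h) • r6 +
      (K * (h - h' * oddMul x y) * h) • r3 + (K * (h - h' * oddMul x y) * g) • r4
    module

end OddMaps

/-! ### Odd infinitesimal automorphisms -/

section OddTangent

variable {N : ℕ∞}

open Polynomial

variable {U : Set (ℂ × ℂ)}

theorem IsSAE.smul_odd {c : Grassmann N} (hc : c ∈ grPart N 2 1)
    {f fz : ℂ → evenPart N → evenPart N} {ft : evenPart N → evenPart N} (hf : IsSAE U f fz ft) :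
    IsSA U (fun t z => f t z • c) (fun t z => fz t z • c) (fun z => ft z • c) :=
  (IsSA.mul hf (IsSA.const hc)).congr (fun t z _ => ⟨rfl, by simp; rfl⟩) fun z _ => by simp; rfl

theorem IsSAE.aeval (q : ℂ[X]) : IsSAE (N := N) U (fun _ z => aeval z q)
    (fun _ z => Polynomial.aeval z q.derivative) 0 := by
  induction q using Polynomial.induction_on with
  | C a =>
    refine (IsSAE.constC a).congr (fun t z _ => ⟨Polynomial.aeval_C _ _, ?_⟩) fun z _ => rfl
    rw [derivative_C, map_zero]
    rfl
  | add p q hp hq =>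
    refine (hp.add hq).congr (fun t z _ => ⟨map_add _ _ _, ?_⟩) fun z _ => (add_zero _).symm
    rw [derivative_add, map_add]
    rfl
  | monomial k a ih =>
    refine (ih.mul IsSAE.var).congr (fun t z _ => ⟨?_, ?_⟩) fun z _ => ?_
    · simp only [Pi.mul_apply, pow_succ, map_mul, aeval_X, mul_assoc]
    · rw [pow_succ, ← mul_assoc, derivative_mul, derivative_X, mul_one, map_add, map_mul, aeval_X]
      simp
    · simp

/-- The velocity components of a family of maps `scMap`. -/
def scVel (c : Grassmann N) (wt a b at' bt g gt g't h ht h't : evenPart N) :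
    Fin 3 → Fin 4 → Grassmann N :=
  ![![wt, (at' * h + a * ht) • c, (bt * g + b * gt) • c, 0], ![gt • c, at', 0, g't • c],
    ![ht • c, 0, bt, (-h't) • c]]

/-- Families of maps between charts, with coordinate expressions of the form `scMap`. -/
def IsScFamily (Q : ℂ → Point N → Point N → Prop) (V : Fin 3 → Point N → Grassmann N) : Prop :=
  ∃ (U : Set (ℂ × ℂ)) (f fz : Fin 3 → Fin 4 → ℂ → evenPart N → Grassmann N)
    (ft : Fin 3 → Fin 4 → evenPart N → Grassmann N), IsOpen U ∧
    (∀ i k, IsSA U (f i k) (fz i k) (ft i k)) ∧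
    (∀ t (p : Point N), (∃ q, Q t p q) ↔ (t, p.body) ∈ U) ∧
    (∀ t (p q : Point N), Q t p q → ∀ i, q.1 i = ev4 (fun k => f i k t p.z) p) ∧
    (∀ t (p : Point N), (t, p.body) ∈ U →
      ScEqs (fun i k => f i k t p.z) (fun i k => fz i k t p.z) p) ∧
    (∀ t (p : Point N), (t, p.body) ∈ U →
      body (f 1 1 t p.z) ≠ 0 ∧ body (f 2 2 t p.z) ≠ 0) ∧
    ∀ (p : Point N) i, V i p = ev4 (fun k => ft i k p.z) p

theorem isScFamily_of_scPt {c : oddPart N} (hc : (c : Grassmann N) ∈ grPart N 2 1)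
    (hU : IsOpen U)
    {w wz a az b bz g g' g'' h h' h'' : ℂ → evenPart N → evenPart N}
    {wt at' bt gt g't ht h't : evenPart N → evenPart N}
    (hw : IsSAE U w wz wt) (ha : IsSAE U a az at') (hb : IsSAE U b bz bt)
    (hg : IsSAE U g g' gt) (hg' : IsSAE U g' g'' g't) (hh : IsSAE U h h' ht)
    (hh' : IsSAE U h' h'' h't)
    (hab : ∀ t (z : evenPart N), (t, body (z : Grassmann N)) ∈ U →
      wz t z = a t z * b t z ∧ IsUnit (a t z) ∧ IsUnit (b t z))
    {Q : ℂ → Point N → Point N → Prop}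
    (hQ : ∀ t p q, Q t p q ↔ (t, p.body) ∈ U ∧ q = scPt c (w t p.z) (a t p.z) (b t p.z) (g t p.z)
      (g' t p.z) (h t p.z) (h' t p.z) p)
    {V : Fin 3 → Point N → Grassmann N}
    (hV : ∀ p i, V i p = ev4 (scVel c (wt p.z) (a 0 p.z) (b 0 p.z) (at' p.z) (bt p.z) (g 0 p.z)
      (gt p.z) (g't p.z) (h 0 p.z) (ht p.z) (h't p.z) i) p) : IsScFamily Q V := by
  refine ⟨U, fun i k t z => scMap c (w t z) (a t z) (b t z) (g t z) (g' t z) (h t z) (h' t z) i k,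
    fun i k t z => (![![wz t z, (az t z * h t z + a t z * h' t z) • (c : Grassmann N),
        (bz t z * g t z + b t z * g' t z) • (c : Grassmann N), 0],
        ![g' t z • (c : Grassmann N), az t z, 0, g'' t z • (c : Grassmann N)],
        ![h' t z • (c : Grassmann N), 0, bz t z, (-h'' t z) • (c : Grassmann N)]] :
          Fin 3 → Fin 4 → Grassmann N) i k,
    fun i k z => scVel c (wt z) (a 0 z) (b 0 z) (at' z) (bt z) (g 0 z) (gt z) (g't z) (h 0 z) (ht z)
      (h't z) i k, hU, ?_, ?_, ?_, ?_, ?_, fun p i => hV p i⟩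
  · have h0 : IsSA (N := N) U (fun _ _ => 0) (fun _ _ => 0) (fun _ => 0) := IsSA.zero
    intro i k
    fin_cases i <;> fin_cases k
    · exact hw
    · exact (ha.mul hh).smul_odd hc
    · exact (hb.mul hg).smul_odd hc
    · exact h0
    · exact hg.smul_odd hc
    · exact ha
    · exact h0
    · exact hg'.smul_odd hc
    · exact hh.smul_odd hc
    · exact h0
    · exact hb
    · exact hh'.neg.smul_odd hc
  · exact fun t p => ⟨fun ⟨q, hq⟩ => ((hQ t p q).mp hq).1, fun hp => ⟨_, (hQ t p _).mpr ⟨hp, rfl⟩⟩⟩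
  · intro t p q hq i
    rw [((hQ t p q).mp hq).2, scPt_apply]
  · exact fun t p hp => scEqs_scMap c.2 (hab t p.z hp).1 p
  · exact fun t p hp => ⟨isUnit_even_iff.mp (hab t p.z hp).2.1,
      isUnit_even_iff.mp (hab t p.z hp).2.2⟩

/-- The velocity of the maps `oddShift c g h t`. -/
def oddVel (c : Grassmann N) (g h : ℂ[X]) (z : evenPart N) : Fin 3 → Fin 4 → Grassmann N :=
  ![![0, aeval z h • c, aeval z g • c, 0], ![aeval z g • c, 0, 0, aeval z g.derivative • c],
    ![aeval z h • c, 0, 0, (-aeval z h.derivative) • c]]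

theorem IsSAE.param_mul_aeval (q : ℂ[X]) : IsSAE (N := N) U (fun t z => cst t * Polynomial.aeval z q)
    (fun t z => cst t * Polynomial.aeval z q.derivative) (fun z => Polynomial.aeval z q) := by
  refine (IsSAE.param.mul (IsSAE.aeval q)).congr (fun t z _ => ⟨rfl, ?_⟩) fun z _ => ?_
  · simp
  · simp

theorem isScFamily_oddShift {c : oddPart N} (hc : (c : Grassmann N) ∈ grPart N 2 1) (g h : ℂ[X]) :
    IsScFamily (fun t p q => oddShift c g h t p = q)
      (fun i p => ev4 (oddVel (c : Grassmann N) g h p.z i) p) := by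
  refine isScFamily_of_scPt hc isOpen_univ IsSAE.var IsSAE.one IsSAE.one (IsSAE.param_mul_aeval g)
    (IsSAE.param_mul_aeval g.derivative) (IsSAE.param_mul_aeval h)
    (IsSAE.param_mul_aeval h.derivative) (fun t z _ => ⟨(one_mul 1).symm, isUnit_one, isUnit_one⟩)
    (fun t p q => ⟨fun e => ⟨trivial, e.symm⟩, fun e => e.2.symm⟩) fun p i => ?_
  congr 1
  simp only [scVel, oddVel, Pi.zero_apply, Pi.one_apply, zero_mul, one_mul, zero_add]
  rfl

/-- The complement of the zero body. -/
def puncturedDomain : Set (ℂ × ℂ) := {y | y.2 ≠ 0}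

theorem isOpen_puncturedDomain : IsOpen puncturedDomain := isOpen_ne.preimage continuous_snd

theorem affine_zero_one_zero (t : ℂ) (x : evenPart N) : affine 0 1 0 t x = x := by
  simp [affine, polyAt]

theorem affineDomain_zero_one_zero : affineDomain (0 : evenPart N) 1 0 = puncturedDomain := by
  simp [affineDomain, puncturedDomain]

/-- Special case of an affine denominator with parameter 0, coefficient 1 and constant term 0. -/
theorem isSAE_inverse : IsSAE (N := N) puncturedDomain (fun _ z => Ring.inverse z)
    (fun _ z => -(Ring.inverse z ^ 2)) 0 := by
  rw [← affineDomain_zero_one_zero (N := N)]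
  refine (isSAE_inverse_affine (Submodule.zero_mem _) 1 0).congr (fun t z _ => ⟨?_, ?_⟩)
    fun z _ => ?_
  · rw [affine_zero_one_zero]
  · rw [affine_zero_one_zero, polyAt_one, mul_one]
  · simp

theorem isSAE_zp (k : ℤ) : IsSAE (N := N) puncturedDomain (fun _ z => zp z k)
    (fun _ z => (k : evenPart N) * zp z (k - 1)) 0 := by
  rw [← affineDomain_zero_one_zero (N := N)]
  refine (isSAE_zp_affine (Submodule.zero_mem _) 1 0 k).congr (fun t z _ => ⟨?_, ?_⟩) fun z _ => ?_
  · rw [affine_zero_one_zero]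
  · rw [affine_zero_one_zero, polyAt_one, mul_one]
  · simp

theorem isSAE_const_mul_zp (κ : ℂ) (k : ℤ) : IsSAE (N := N) puncturedDomain
    (fun _ z => cst κ * zp z k) (fun _ z => cst κ * ((k : evenPart N) * zp z (k - 1))) 0 :=
  ((IsSAE.constC κ).mul (isSAE_zp k)).congr (fun t z _ => ⟨rfl, by simp⟩) fun z _ => by simp

theorem isSAE_const_mul_zp_mul (κ : ℂ) (k : ℤ) (q : ℂ[X]) : IsSAE (N := N) puncturedDomain
    (fun t z => cst κ * zp z k * (cst t * aeval z q))
    (fun t z => cst κ * ((k : evenPart N) * zp z (k - 1)) * (cst t * aeval z q) +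
      cst κ * zp z k * (cst t * aeval z q.derivative)) (fun z => cst κ * zp z k * aeval z q) :=
  ((isSAE_const_mul_zp κ k).mul (IsSAE.param_mul_aeval q)).congr (fun t z _ => ⟨rfl, rfl⟩)
    fun z _ => by simp

theorem exists_isSAE_deriv (κ : ℂ) (k : ℤ) (q : ℂ[X]) : ∃ fz ft, IsSAE (N := N) puncturedDomain
    (fun t z => cst κ * ((k : evenPart N) * zp z (k - 1)) * (cst t * aeval z q) +
      cst κ * zp z k * (cst t * aeval z q.derivative)) fz ft := by
  refine ⟨_, _, IsSAE.congr (((((IsSAE.constC κ).mul ((IsSAE.const (c := (k : evenPart N)) ?_).mul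
    (isSAE_zp (k - 1)))).mul (IsSAE.param_mul_aeval q))).add (isSAE_const_mul_zp_mul κ k q.derivative))
    (fun t z _ => ⟨rfl, rfl⟩) fun z _ => rfl⟩
  have : (k : evenPart N) = cst (k : ℂ) := by rw [cst, map_intCast]
  rw [this]
  exact algebraMap_mem_grPart _

/-- This serves the mixed pairs of charts. Their velocity plays no role in tangency, so it is left
existential. -/
theorem isScFamily_flip_oddShift {c : oddPart N} (hc : (c : Grassmann N) ∈ grPart N 2 1) (g h : ℂ[X])
    (n : ℤ) {κ : ℂ} (hκ : κ ^ 2 = -1) : ∃ V,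
    IsScFamily (fun t p q => IsUnit (oddShift c g h t p).z ∧ q = flip n κ (oddShift c g h t p)) V := by
  have hk : cst (N := N) κ ^ 2 = -1 := by rw [cst, ← map_pow, hκ, map_neg, map_one]
  have hku : IsUnit (cst (N := N) κ) :=
    (IsUnit.mk0 κ (by rintro rfl; norm_num at hκ)).map (algebraMap ℂ (evenPart N))
  obtain ⟨g'', g't, hg'⟩ := exists_isSAE_deriv (N := N) κ (n - 1) g
  obtain ⟨h'', h't, hh'⟩ := exists_isSAE_deriv (N := N) κ (-n - 1) h
  refine ⟨_, isScFamily_of_scPt hc isOpen_puncturedDomain isSAE_inverse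
    (isSAE_const_mul_zp κ (n - 1)) (isSAE_const_mul_zp κ (-n - 1))
    (isSAE_const_mul_zp_mul κ (n - 1) g) hg' (isSAE_const_mul_zp_mul κ (-n - 1) h) hh'
    (fun t z hz => ?_) (fun t p q => ?_) fun p i => rfl⟩
  · have hz' : IsUnit z := isUnit_even_iff.mpr hz
    refine ⟨?_, hku.mul (isUnit_zp hz' _), hku.mul (isUnit_zp hz' _)⟩
    linear_combination (- (zp z (n - 1) * zp z (-n - 1))) * hk + inverse_mul_zp_sub hz' n
  · have h1 : IsUnit (oddShift c g h t p).z ↔ IsUnit p.z := by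
      rw [isUnit_z_iff, isUnit_z_iff, oddShift, body_scPt, Point.body_z]
    have h2 : (t, p.body) ∈ puncturedDomain ↔ IsUnit p.z := isUnit_z_iff.symm
    rw [h1, h2]
    exact and_congr_right fun hp => by rw [oddShift, flip_scPt hκ c _ _ _ _ hp]

/-- `g̃(z) = z ^ m g(1 / z)`. -/
def IsReflection (N : ℕ∞) (m : ℤ) (g g₁ : ℂ[X]) : Prop :=
  ∀ z : evenPart N, IsUnit z → aeval z g₁ = zp z m * aeval (Ring.inverse z) g ∧
    aeval z g₁.derivative = (m : evenPart N) * zp z (m - 1) * aeval (Ring.inverse z) g -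
      zp z (m - 2) * aeval (Ring.inverse z) g.derivative

theorem zp_natCast (z : evenPart N) (k : ℕ) : zp z (k : ℤ) = z ^ k := rfl

theorem pow_inverse {z : evenPart N} (hz : IsUnit z) (k : ℕ) :
    Ring.inverse z ^ k = zp z (-(k : ℤ)) := by
  rw [← zp_natCast, zp_inverse hz]

theorem IsReflection.monomial (k l : ℕ) (a : ℂ) :
    IsReflection N ((k : ℤ) + l) (monomial k a) (monomial l a) := by
  intro z hz
  refine ⟨?_, ?_⟩
  · rw [aeval_monomial, aeval_monomial, pow_inverse hz, ← zp_natCast z l]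
    have : zp z l = zp z (k + l) * zp z (-k) := by rw [← zp_add hz]; congr 1; ring
    rw [this]
    ring
  · rw [derivative_monomial, derivative_monomial, aeval_monomial, aeval_monomial, aeval_monomial,
      map_mul, map_mul, map_natCast, map_natCast, pow_inverse hz k]
    have h1 : (l : evenPart N) * z ^ (l - 1) = (l : evenPart N) * zp z (l - 1) := by
      rcases l with _ | l
      · simp
      · rw [← zp_natCast]; congr 2; simp
    have h2 : (k : evenPart N) * Ring.inverse z ^ (k - 1) = (k : evenPart N) * zp z (1 - k) := by
      rcases k with _ | k
      · simp
      · rw [pow_inverse hz]; congr 2; simp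
    have h3 : zp z (k + l - 1) * zp z (-k) = zp z (l - 1) := by rw [← zp_add hz]; congr 1; ring
    have h4 : zp z (k + l - 2) * zp z (1 - k) = zp z (l - 1) := by rw [← zp_add hz]; congr 1; ring
    push_cast
    linear_combination algebraMap ℂ (evenPart N) a * h1 +
      zp z (k + l - 2) * algebraMap ℂ (evenPart N) a * h2 -
      ((k : evenPart N) + l) * algebraMap ℂ (evenPart N) a * h3 +
      (k : evenPart N) * algebraMap ℂ (evenPart N) a * h4

/-- The degree bound is exactly what makes z^m g(1/z) a polynomial; it is assembled monomial by
monomial, with k reflected to m - k. -/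
theorem IsReflection.exists {m : ℤ} {g : ℂ[X]} (hg : ∀ k ∈ g.support, (k : ℤ) ≤ m) :
    ∃ g₁, IsReflection N m g g₁ := by
  refine ⟨∑ k ∈ g.support, Polynomial.monomial (m - k).toNat (g.coeff k), fun z hz => ?_⟩
  have h := fun k (hk : k ∈ g.support) => by
    have := IsReflection.monomial (N := N) k (m - k).toNat (g.coeff k) z hz
    rwa [show (k : ℤ) + (m - k).toNat = m by have := hg k hk; omega] at this
  have e : g = ∑ k ∈ g.support, Polynomial.monomial k (g.coeff k) := as_sum_support g
  constructor
  · conv_rhs => rw [e]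
    rw [map_sum, map_sum, Finset.mul_sum]
    exact Finset.sum_congr rfl fun k hk => (h k hk).1
  · conv_rhs => rw [e]
    rw [derivative_sum, derivative_sum, map_sum, map_sum, map_sum, Finset.mul_sum, Finset.mul_sum,
      ← Finset.sum_sub_distrib]
    exact Finset.sum_congr rfl fun k hk => (h k hk).2

/-- The northern potential solves i z^(n-1) g_N(z) = g(1/z), and similarly for h with z^(-n-1). This
explains the factor -i and the reflection degrees 1 - n and n + 1. -/
theorem flip_oddShift {n : ℤ} {g h g₁ h₁ : ℂ[X]} (hg : IsReflection N (1 - n) g g₁)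
    (hh : IsReflection N (n + 1) h h₁) (c : oddPart N) (t : ℂ) {p : Point N} (hp : IsUnit p.z) :
    flip n Complex.I (oddShift c (C (-Complex.I) * g₁) (C (-Complex.I) * h₁) t p) =
      oddShift c g h t (flip n Complex.I p) := by
  obtain ⟨k, hk⟩ : ∃ k, k = algebraMap ℂ (evenPart N) (-Complex.I) := ⟨_, rfl⟩
  obtain ⟨ι, hι⟩ : ∃ ι, ι = algebraMap ℂ (evenPart N) Complex.I := ⟨_, rfl⟩
  have hI : ι * k = 1 := by rw [hk, hι, ← map_mul]; simp
  have hI2 : ι * ι = -1 := by rw [hι, ← map_mul]; simp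
  obtain ⟨hg1, hg2⟩ := hg p.z hp
  obtain ⟨hh1, hh2⟩ := hh p.z hp
  rw [oddShift, flip_scPt Complex.I_sq c _ _ _ _ hp]
  simp only [derivative_C_mul, map_mul, aeval_C]
  rw [hg1, hg2, hh1, hh2, ← hk, cst, ← hι]
  set z := p.z
  set i := Ring.inverse z
  have e1 : zp z (n - 1) * zp z (1 - n) = 1 := by rw [← zp_add hp, ← zp_zero z]; congr 1; ring
  have e2 : zp z (-n - 1) * zp z (n + 1) = 1 := by rw [← zp_add hp, ← zp_zero z]; congr 1; ring
  have e3 : zp z (n - 1 - 1) * zp z (1 - n) = zp z (n - 1) * zp z (1 - n - 1) := by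
    rw [← zp_add hp, ← zp_add hp]; congr 1; ring
  have e4 : zp z (-n - 1 - 1) * zp z (n + 1) = zp z (-n - 1) * zp z (n + 1 - 1) := by
    rw [← zp_add hp, ← zp_add hp]; congr 1; ring
  have e5 : zp z (n - 1) * zp z (1 - n - 2) = zp z (n - 1) * zp z (-n - 1) := by
    congr 2; ring
  have e6 : zp z (-n - 1) * zp z (n + 1 - 2) = zp z (n - 1) * zp z (-n - 1) := by
    rw [mul_comm]; congr 2; ring
  -- The southern shift takes place at rescaled odd coordinates; the scale factors are moved into
  -- the parameters of `scPt`, to match the result of `flip_scPt`.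
  have key : ∀ a b w g g' h h' : evenPart N,
      scPt c w 1 1 g g' h h' (mkPt w (a • p.thP) (b • p.thM)) =
        scPt c w a b g (a * b * g') h (a * b * h') p := by
    intro a b w g g' h h'
    simp only [scPt, mkPt_thP, mkPt_thM, oddMul_smul_left_eq, oddMul_smul_right_eq, one_smul, one_mul]
    congr 1
    · ring
    · congr 3; ring
    · congr 3; ring
  rw [oddShift, flip, ← hι]
  simp only [mkPt_z]
  rw [key]
  have f1 : ι * zp z (n - 1) * (cst t * (k * (zp z (1 - n) * aeval i g))) =
      cst t * aeval i g := by
    linear_combination (cst (N := N) t * aeval i g) * (zp z (n - 1) * zp z (1 - n) * hI + e1)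
  have f2 : ι * zp z (-n - 1) * (cst t * (k * (zp z (n + 1) * aeval i h))) =
      cst t * aeval i h := by
    linear_combination (cst (N := N) t * aeval i h) * (zp z (-n - 1) * zp z (n + 1) * hI + e2)
  rw [f1, f2]
  congr 1
  · push_cast
    linear_combination (cst t * ((n - 1) * zp z (n - 1 - 1) * zp z (1 - n) * aeval i g +
      zp z (n - 1) * ((1 - n) * zp z (1 - n - 1) * aeval i g - zp z (1 - n - 2) *
        aeval i g.derivative))) * hI + cst t * (n - 1) * aeval i g * e3 -
      cst t * aeval i g.derivative * e5 -
      cst t * aeval i g.derivative * zp z (n - 1) * zp z (-n - 1) * hI2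
  · push_cast
    linear_combination (cst t * ((-n - 1) * zp z (-n - 1 - 1) * zp z (n + 1) * aeval i h +
      zp z (-n - 1) * ((n + 1) * zp z (n + 1 - 1) * aeval i h - zp z (n + 1 - 2) *
        aeval i h.derivative))) * hI + cst t * (-n - 1) * aeval i h * e4 -
      cst t * aeval i h.derivative * e6 -
      cst t * aeval i h.derivative * zp z (n - 1) * zp z (-n - 1) * hI2

theorem oddShift_zero (c : oddPart N) (g h : ℂ[X]) (p : Point N) : oddShift c g h 0 p = p := by
  have h0 : cst (N := N) 0 = 0 := map_zero _
  apply Point.ext <;> simp [oddShift, scPt, h0]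

/-- The family is the shift by tc in both charts, with reflected potentials in the north. It
descends to the sphere by `flip_oddShift`, is inverted by the shift with -t, and is defined for all
`t`. -/
theorem isTangent_of_odd (n : ℤ) {c : Grassmann N} (hc : c ∈ grPart N 2 1) {g h : ℂ[X]}
    (hg : ∀ k ∈ g.support, (k : ℤ) ≤ 1 - n) (hh : ∀ k ∈ h.support, (k : ℤ) ≤ n + 1)
    (W : Fin 3 → Point N → Grassmann N) (hW : ∀ i p, W i p = ev4 (oddVel c g h p.z i) p) :
    IsTangent N n W := by
  obtain ⟨c, rfl⟩ : ∃ x : oddPart N, (x : Grassmann N) = c := ⟨⟨c, grPart_le_zero 1 hc⟩, rfl⟩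
  obtain ⟨g₁, hg₁⟩ := IsReflection.exists (N := N) hg
  obtain ⟨h₁, hh₁⟩ := IsReflection.exists (N := N) hh
  let G : Chart → ℂ[X] := fun α => match α with
    | .south => g
    | .north => C (-Complex.I) * g₁
  let H : Chart → ℂ[X] := fun α => match α with
    | .south => h
    | .north => C (-Complex.I) * h₁
  let S : ℂ → Chart → Point N → Sphere N n := fun t α p =>
    chartInv α (oddShift c (G α) (H α) t p)
  have hunit : ∀ t α (p : Point N), IsUnit (oddShift c (G α) (H α) t p).z ↔ IsUnit p.z := by
    intro t α p
    rw [isUnit_z_iff, isUnit_z_iff, oddShift, body_scPt, Point.body_z]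
  have hS : ∀ t (p : Point N), IsUnit p.z → S t .north p = S t .south (flip n Complex.I p) := by
    intro t p hp
    change chartInv .north _ = chartInv .south _
    rw [north_eq_south ((hunit t .north p).mpr hp), flip_oddShift hg₁ hh₁ c t hp]
  have hinv : ∀ s t, s + t = 0 → ∀ x, sphereMap (S s) (hS s) (sphereMap (S t) (hS t) x) = x := by
    intro s t hst x
    obtain ⟨α, p, rfl⟩ := exists_chart x
    rw [sphereMap_chartInv]
    change sphereMap (S s) (hS s) (chartInv α _) = _
    rw [sphereMap_chartInv]
    change chartInv α _ = _
    rw [oddShift_oddShift c _ _ hst]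
  let T : ℂ → Equiv.Perm (Sphere N n) := fun t =>
    ⟨sphereMap (S t) (hS t), sphereMap (S (-t)) (hS (-t)), hinv (-t) t (by ring),
      hinv t (-t) (by ring)⟩
  have hT : ∀ t α p, T t (chartInv α p) = chartInv α (oddShift c (G α) (H α) t p) :=
    fun t α p => sphereMap_chartInv (S t) (hS t) α p
  have fam : ∀ α β, ∃ V, IsScFamily (fun t p q => T t (chartInv α p) = chartInv β q) V ∧
      (α = .south → β = .south → V = W) := by
    have same : ∀ α, IsScFamily (fun t p q => T t (chartInv α p) = chartInv α q)
        (fun i p => ev4 (oddVel (c : Grassmann N) (G α) (H α) p.z i) p) := fun α => by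
      simpa only [hT, (chartInv_injective α).eq_iff] using isScFamily_oddShift hc (G α) (H α)
    intro α β
    cases α <;> cases β
    · exact ⟨_, same .south, fun _ _ => by funext i p; rw [hW]⟩
    · obtain ⟨V, hV⟩ := isScFamily_flip_oddShift hc (G .south) (H .south) n
        (κ := -Complex.I) (by simp)
      exact ⟨V, by simpa only [hT, south_eq_north_iff] using hV, fun _ h => by simp at h⟩
    · obtain ⟨V, hV⟩ := isScFamily_flip_oddShift hc (G .north) (H .north) n
        (κ := Complex.I) (by simp)
      exact ⟨V, by simpa only [hT, north_eq_south_iff] using hV, fun h => by simp at h⟩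
    · exact ⟨_, same .north, fun h => by simp at h⟩
  choose V hV hVW using fam
  choose U f fz ft hU hSA hdom hval hsc hnz hvel using hV
  refine isTangent_of_family one_pos T ?_ W U hU f fz ft hSA (fun α β t _ p => hdom α β t p)
    (fun α β t _ p q h i => hval α β t p q h i) (fun α β t _ p h => hsc α β t p h)
    (fun α β t _ p h => hnz α β t p h) fun p i => ?_
  · ext x
    obtain ⟨α, p, rfl⟩ := exists_chart x
    rw [hT, oddShift_zero]
    rfl
  · rw [← hVW .south .south rfl rfl]
    exact hvel .south .south p i

end OddTangent

/-! ### Coefficients of superfunctions -/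

section Coefficients

variable {N : ℕ∞}

theorem induction_zeta {P : Grassmann N → Prop} (hz : ∀ K, P (zeta K)) (h0 : P 0)
    (ha : ∀ x y, P x → P y → P (x + y)) (hs : ∀ (a : ℂ) x, P x → P (a • x)) (x : Grassmann N) :
    P x := by
  have hx : x ∈ Submodule.span ℂ (Set.range (zeta : Finset (Gen N) → Grassmann N)) := by
    rw [span_zeta]; trivial
  induction hx using Submodule.span_induction with
  | mem x hx => obtain ⟨K, rfl⟩ := hx; exact hz K
  | zero => exact h0
  | add x y _ _ h1 h2 => exact ha x y h1 h2
  | smul a x _ h => exact hs a x h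

theorem coord_empty (x : Grassmann N) : coord ∅ x = body x := by
  induction x using induction_zeta with
  | hz K =>
    rw [coord_zeta]
    split_ifs with h
    · rw [h, zeta_empty, map_one]
    · rw [body_zeta (Finset.nonempty_iff_ne_empty.mpr h)]
  | h0 => simp
  | ha x y h1 h2 => rw [map_add, map_add, h1, h2]
  | hs a x h => rw [map_smul, map_smul, h]

/-- A monomial of degree one arises only from degree one times degree zero, so this coordinate is a
derivation over the body. -/
theorem coord_singleton_mul (b : Gen N) (x y : Grassmann N) :
    coord {b} (x * y) = coord {b} x * body y + body x * coord {b} y := by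
  have h0 : (∅ : Finset (Gen N)) ≠ {b} := (Finset.singleton_ne_empty b).symm
  induction x using induction_zeta with
  | hz K =>
    induction y using induction_zeta with
    | hz L =>
      rcases K.eq_empty_or_nonempty with rfl | hK
      · rw [zeta_empty, one_mul, map_one (body (N := N)), one_mul, ← zeta_empty, coord_zeta {b} ∅, if_neg h0,
          zero_mul, zero_add]
      rcases L.eq_empty_or_nonempty with rfl | hL
      · rw [zeta_empty, mul_one, map_one (body (N := N)), mul_one, ← zeta_empty, coord_zeta ({b}) ∅, if_neg h0,
          mul_zero, add_zero]
      rw [body_zeta hK, body_zeta hL, mul_zero, zero_mul, add_zero]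
      by_cases h : Disjoint K L
      · have hne : K ∪ L ≠ {b} := by
          intro e
          have := Finset.card_union_of_disjoint h
          rw [e, Finset.card_singleton] at this
          have := hK.card_pos
          have := hL.card_pos
          omega
        rcases zeta_mul_zeta_of_disjoint h with e | e
        · rw [e, coord_zeta, if_neg hne]
        · rw [e, map_neg, coord_zeta, if_neg hne, neg_zero]
      · rw [zeta_mul_zeta_of_not_disjoint h, map_zero]
    | h0 => simp
    | ha x y h1 h2 => rw [mul_add, map_add, h1, h2, map_add, map_add]; ring
    | hs a x h => rw [mul_smul_comm, map_smul, h, map_smul, map_smul]; simp only [smul_eq_mul]; ring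
  | h0 => simp
  | ha x y h1 h2 => rw [add_mul, map_add, h1, h2, map_add, map_add]; ring
  | hs a x h => rw [smul_mul_assoc, map_smul, h, map_smul, map_smul]; simp only [smul_eq_mul]; ring

/-- Multiplication by an unused generator embeds the coefficients of `y` up to sign, so it loses no
information at monomials without that generator. -/
theorem exists_coord_insert_mul {b : Gen N} {K : Finset (Gen N)} (hb : b ∉ K) :
    ∃ s : ℂ, s ≠ 0 ∧ ∀ y, coord (insert b K) (zeta {b} * y) = s * coord K y := by
  classical
  have hd : ∀ {L : Finset (Gen N)}, b ∉ L → Disjoint {b} L := fun h =>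
    Finset.disjoint_singleton_left.mpr h
  obtain ⟨s, hs, hsK⟩ : ∃ s : ℂ, s ≠ 0 ∧ zeta {b} * zeta K = s • zeta (insert b K) := by
    rcases zeta_mul_zeta_of_disjoint (hd hb) with e | e
    · exact ⟨1, one_ne_zero, by rw [e, one_smul, Finset.insert_eq]⟩
    · exact ⟨-1, by norm_num, by rw [e, neg_one_smul, Finset.insert_eq]⟩
  refine ⟨s, hs, fun y => ?_⟩
  induction y using induction_zeta with
  | hz L =>
    by_cases hL : b ∈ L
    · rw [zeta_mul_zeta_of_not_disjoint (by simpa using hL), map_zero, coord_zeta, if_neg, mul_zero]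
      rintro rfl
      exact hb hL
    · by_cases e : L = K
      · rw [e, hsK, map_smul, coord_zeta, coord_zeta, if_pos rfl, if_pos rfl, smul_eq_mul]
      · have hne : {b} ∪ L ≠ insert b K := by
          rw [← Finset.insert_eq]
          intro h
          apply e
          rw [← Finset.erase_insert hL, h, Finset.erase_insert hb]
        rw [coord_zeta, if_neg e, mul_zero]
        rcases zeta_mul_zeta_of_disjoint (hd hL) with e | e
        · rw [e, coord_zeta, if_neg hne]
        · rw [e, map_neg, coord_zeta, if_neg hne, neg_zero]
  | h0 => simp
  | ha x y h1 h2 => rw [mul_add, map_add, h1, h2, map_add]; ring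
  | hs a x h => rw [mul_smul_comm, map_smul, h, map_smul]; simp only [smul_eq_mul]; ring

/-- The reason for restricting coefficients to the first N - 2 generators: two generators always
remain free. For finite N they are the last two; for infinite N the complement of a finite set is
infinite. -/
theorem exists_two_gens (hN : 1 < N) {K : Finset (Gen N)} (hK : IsLow 2 K) :
    ∃ a b : Gen N, a ≠ b ∧ a ∉ K ∧ b ∉ K := by
  induction N using ENat.recTopCoe with
  | top =>
    have hinf : Infinite (Gen ⊤) :=
      Infinite.of_injective (fun i : ℕ => (⟨i, ENat.natCast_lt_top i⟩ : Gen ⊤)) fun i j h => by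
        simpa using h
    obtain ⟨a, ha⟩ := Infinite.exists_notMem_finset K
    obtain ⟨b, hb⟩ := Infinite.exists_notMem_finset (insert a K)
    rw [Finset.mem_insert, not_or] at hb
    exact ⟨a, b, fun h => hb.1 h.symm, ha, hb.2⟩
  | coe N =>
    have hN' : 1 < N := by exact_mod_cast hN
    refine ⟨⟨N - 2, by exact_mod_cast (by omega : N - 2 < N)⟩,
      ⟨N - 1, by exact_mod_cast (by omega : N - 1 < N)⟩, ?_, fun h => ?_, fun h => ?_⟩
    · intro h
      have := congrArg Subtype.val h
      simp only at this
      omega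
    · have : N - 2 + 2 < N := by exact_mod_cast hK _ h
      omega
    · have : N - 1 + 2 < N := by exact_mod_cast hK _ h
      omega

/-- A generator. -/
def genOdd (b : Gen N) : oddPart N :=
  ⟨zeta {b}, Submodule.subset_span ⟨{b}, isLow_zero _, by simp, rfl⟩⟩

/-- A point with complex even coordinate. -/
def cpt (z : ℂ) (x y : oddPart N) : Point N := mkPt (cst z) x y

theorem body_cpt (z : ℂ) (x y : oddPart N) : (cpt z x y).body = z := body_algebraMap z

theorem ev4_cpt (a : Fin 4 → Grassmann N) (z : ℂ) (x y : oddPart N) :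
    ev4 a (cpt z x y) = a 0 + x * a 1 + y * a 2 + x * y * a 3 := rfl

/-- The four components are separated by inserting 0 or a free generator for each of θ⁺ and θ⁻. -/
theorem coord_ev4_ext (hN : 1 < N) {z : ℂ} {a b : Fin 4 → Grassmann N}
    (h : ∀ x y : oddPart N, ev4 a (cpt z x y) = ev4 b (cpt z x y)) {K : Finset (Gen N)}
    (hK : IsLow 2 K) (k : Fin 4) : coord K (a k) = coord K (b k) := by
  classical
  obtain ⟨i, j, hij, hi, hj⟩ := exists_two_gens hN hK
  have h0 : a 0 = b 0 := by simpa [ev4_cpt] using h 0 0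
  obtain ⟨s, hs, hsi⟩ := exists_coord_insert_mul hi
  obtain ⟨r, hr, hrj⟩ := exists_coord_insert_mul hj
  have h1 : zeta {i} * a 1 = zeta {i} * b 1 := by simpa [ev4_cpt, h0, genOdd] using h (genOdd i) 0
  have h2 : zeta {j} * a 2 = zeta {j} * b 2 := by simpa [ev4_cpt, h0, genOdd] using h 0 (genOdd j)
  have h3 : zeta {i} * (zeta {j} * a 3) = zeta {i} * (zeta {j} * b 3) := by
    have := h (genOdd i) (genOdd j)
    simp only [ev4_cpt, h0, genOdd, h1, h2] at this
    simpa [mul_assoc] using this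
  fin_cases k
  · exact congrArg _ h0
  · have := congrArg (coord (insert i K)) h1
    rw [hsi, hsi] at this
    exact mul_left_cancel₀ hs this
  · have := congrArg (coord (insert j K)) h2
    rw [hrj, hrj] at this
    exact mul_left_cancel₀ hr this
  · obtain ⟨q, hq, hqi⟩ := exists_coord_insert_mul (b := i) (K := insert j K)
      (by rw [Finset.mem_insert, not_or]; exact ⟨hij, hi⟩)
    have := congrArg (coord (insert i (insert j K))) h3
    rw [hqi, hqi, hrj, hrj] at this
    exact mul_left_cancel₀ hr (mul_left_cancel₀ hq this)

theorem coord_comp_eval (F : Comp N (ℂ → ℂ)) (z : ℂ) (K : Finset (Gen N)) :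
    coord K (Comp.eval F (algebraMap ℂ (Grassmann N) z)) = F K z := by
  classical
  rw [Comp.eval]
  simp only [ext_algebraMap, ← Algebra.smul_def]
  rw [Finsupp.sum, map_sum]
  simp only [map_smul, coord_zeta, smul_eq_mul, mul_ite, mul_one, mul_zero]
  rw [Finset.sum_ite_eq']
  split_ifs with h
  · rfl
  · rw [Finsupp.notMem_support_iff.mp h, Pi.zero_apply]

theorem coord_comp_eval_dz (F : SuperFn N (ℂ → ℂ)) (k : Fin 4) (z : ℂ) (K : Finset (Gen N)) :
    coord K (Comp.eval (F.dz k) (algebraMap ℂ (Grassmann N) z)) = deriv (F k K) z := by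
  rw [coord_comp_eval, SuperFn.dz, Finsupp.mapRange_apply]

theorem SuperFn.coeff_eq (hN : 1 < N) {F G : SuperFn N (ℂ → ℂ)}
    (hF : ∀ k, ∀ K ∈ (F k).support, IsLow 2 K) (hG : ∀ k, ∀ K ∈ (G k).support, IsLow 2 K) {z : ℂ}
    (h : ∀ p : Point N, p.body = z → F.eval p = G.eval p) (k : Fin 4) (K : Finset (Gen N)) :
    F k K z = G k K z := by
  by_cases hK : IsLow 2 K
  · have := coord_ev4_ext hN (z := z)
      (a := fun k => Comp.eval (F k) (algebraMap ℂ (Grassmann N) z))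
      (b := fun k => Comp.eval (G k) (algebraMap ℂ (Grassmann N) z))
      (fun x y => h (cpt z x y) (body_cpt z x y)) hK k
    rwa [coord_comp_eval, coord_comp_eval] at this
  · rw [Finsupp.notMem_support_iff.mp fun h => hK (hF k K h),
      Finsupp.notMem_support_iff.mp fun h => hK (hG k K h)]

theorem SuperFn.IsSuperanalyticOn.analyticAt {F : SuperFn N (ℂ → ℂ)} {V : Set ℂ}
    (hF : F.IsSuperanalyticOn V) {z : ℂ} (hz : z ∈ V) (k : Fin 4) (K : Finset (Gen N)) :
    AnalyticAt ℂ (F k K) z := by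
  by_cases h : K ∈ (F k).support
  · exact (hF k K h).2 z hz
  · rw [Finsupp.notMem_support_iff.mp h]
    exact analyticAt_const

end Coefficients

/-! ### Consequences of the superconformal equations -/

section ScalarEquations

variable {N : ℕ∞}

/-- The equations for coefficients that are linear. -/
def LinearEqs (G : Fin 3 → SuperFn N (ℂ → ℂ)) (K : Finset (Gen N)) (z : ℂ) : Prop :=
  G 2 1 K z = 0 ∧ G 1 2 K z = 0 ∧ G 2 3 K z = -deriv (G 2 0 K) z ∧ G 1 3 K z = deriv (G 1 0 K) z

/-- The quadratic equations for coefficients, at the body level. -/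
def BodyEqs (G : Fin 3 → SuperFn N (ℂ → ℂ)) (z : ℂ) : Prop :=
  G 0 3 ∅ z + deriv (G 0 0 ∅) z = G 2 2 ∅ z * G 1 1 ∅ z ∧
  deriv (G 0 0 ∅) z - G 0 3 ∅ z = G 1 1 ∅ z * G 2 2 ∅ z

/-- The quadratic equations for coefficients, at the first level above the body. -/
def OddEqs (G : Fin 3 → SuperFn N (ℂ → ℂ)) (b : Gen N) (z : ℂ) : Prop :=
  G 0 1 {b} z = G 2 0 {b} z * G 1 1 ∅ z ∧ G 0 2 {b} z = G 1 0 {b} z * G 2 2 ∅ z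

/-- D⁺θ̃⁻ = 0 and D⁻θ̃⁺ = 0 are linear and yield conditions for each monomial. The two quadratic
equations are needed only at the body and at first order in the generators, where
`coord_singleton_mul` keeps the products manageable. -/
theorem IsSuperconformalOn.scalar_equations (hN : 1 < N) {G : Fin 3 → SuperFn N (ℂ → ℂ)} {V : Set ℂ}
    (hG : IsSuperconformalOn G V) {z : ℂ} (hz : z ∈ V)
    (h1 : ∀ p : Point N, p.body = z → (G 1).eval p ∈ grPart N 0 1)
    (h2 : ∀ p : Point N, p.body = z → (G 2).eval p ∈ grPart N 0 1) :
    (∀ K, IsLow 2 K → LinearEqs G K z) ∧ BodyEqs G z ∧ ∀ b, OddEqs G b z := by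
  set v : Fin 3 → Fin 4 → Grassmann N := fun i k =>
    Comp.eval (G i k) (algebraMap ℂ (Grassmann N) z) with hv
  set v' : Fin 3 → Fin 4 → Grassmann N := fun i k =>
    Comp.eval ((G i).dz k) (algebraMap ℂ (Grassmann N) z) with hv'
  have cv : ∀ i k K, coord K (v i k) = G i k K z := fun i k K => coord_comp_eval _ _ _
  have cv' : ∀ i k K, coord K (v' i k) = deriv (G i k K) z := fun i k K =>
    coord_comp_eval_dz _ _ _ _
  have bv : ∀ i k, body (v i k) = G i k ∅ z := fun i k => by rw [← coord_empty, cv]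
  have bv' : ∀ i k, body (v' i k) = deriv (G i k ∅) z := fun i k => by rw [← coord_empty, cv']
  have hev : ∀ i (x y : oddPart N), (G i).eval (cpt z x y) = ev4 (v i) (cpt z x y) :=
    fun i x y => rfl
  have hP : ∀ i (x y : oddPart N),
      (G i).Dplus.eval (cpt z x y) = ev4 (compDplus (v i) (v' i)) (cpt z x y) := fun i x y =>
    SuperFn.eval_Dplus fun k K => (hG.1 i).analyticAt (by rwa [body_cpt]) k K
  have hM : ∀ i (x y : oddPart N),
      (G i).Dminus.eval (cpt z x y) = ev4 (compDminus (v i) (v' i)) (cpt z x y) := fun i x y =>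
    SuperFn.eval_Dminus fun k K => (hG.1 i).analyticAt (by rwa [body_cpt]) k K
  have hsc := fun x y : oddPart N => hG.2.1 (cpt z x y) (by rwa [body_cpt])
  simp only [hP, hM, hev] at hsc
  -- At vanishing odd coordinates θ̃⁺ takes the value `v 1 0`, which is odd and so has no body.
  have b1 : body (v 1 0) = 0 := body_odd (by
    have := h1 (cpt z 0 0) (body_cpt _ _ _)
    rwa [hev, ev4_cpt, show v 1 0 + ((0 : oddPart N) : Grassmann N) * v 1 1 +
      ((0 : oddPart N) : Grassmann N) * v 1 2 +
      ((0 : oddPart N) : Grassmann N) * ((0 : oddPart N) : Grassmann N) * v 1 3 = v 1 0 by simp]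
      at this)
  have b2 : body (v 2 0) = 0 := body_odd (by
    have := h2 (cpt z 0 0) (body_cpt _ _ _)
    rwa [hev, ev4_cpt, show v 2 0 + ((0 : oddPart N) : Grassmann N) * v 2 1 +
      ((0 : oddPart N) : Grassmann N) * v 2 2 +
      ((0 : oddPart N) : Grassmann N) * ((0 : oddPart N) : Grassmann N) * v 2 3 = v 2 0 by simp]
      at this)
  have q1 : v 0 1 = v 2 0 * v 1 1 := by
    have := (hsc 0 0).2.2.1
    simpa [ev4_cpt, compDplus, sub_eq_zero] using this
  have q2 : v 0 2 = v 1 0 * v 2 2 := by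
    have := (hsc 0 0).2.2.2
    simpa [ev4_cpt, compDminus, sub_eq_zero] using this
  refine ⟨fun K hK => ?_, ?_, fun b => ⟨?_, ?_⟩⟩
  · have e1 := fun k => coord_ev4_ext hN (a := compDplus (v 2) (v' 2)) (b := 0)
      (fun x y => by rw [(hsc x y).1]; simp [ev4_cpt]) hK k
    have e2 := fun k => coord_ev4_ext hN (a := compDminus (v 1) (v' 1)) (b := 0)
      (fun x y => by rw [(hsc x y).2.1]; simp [ev4_cpt]) hK k
    have a1 := e1 0
    have a2 := e1 2
    have a3 := e2 0
    have a4 := e2 1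
    simp only [compDplus, compDminus, Matrix.cons_val, Pi.zero_apply, map_add, map_sub, map_zero,
      cv, cv'] at a1 a2 a3 a4
    exact ⟨a1, a3, eq_neg_of_add_eq_zero_left a2, (sub_eq_zero.mp a4).symm⟩
  -- The generator b serves as a value of one odd coordinate. The coefficient of ζ_b then isolates
  -- the body of the corresponding component, once `q1` or `q2` has removed the constant term.
  · obtain ⟨b, -, -, -, -⟩ := exists_two_gens hN (isLow_empty (m := 2) (N := N))
    have cb : coord {b} (zeta {b} : Grassmann N) = 1 := by rw [coord_zeta, if_pos rfl]
    have bb : body (zeta {b} : Grassmann N) = 0 := body_zeta (Finset.singleton_nonempty b)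
    constructor
    · have := (hsc 0 (genOdd b)).2.2.1
      simp only [ev4_cpt, compDplus, Matrix.cons_val, genOdd, ZeroMemClass.coe_zero, zero_mul,
        add_zero, q1] at this
      have := congrArg (coord {b}) this
      simp only [map_add, map_sub, map_mul, coord_singleton_mul, cb, bb, b2, bv, bv', zero_mul,
        add_zero, zero_add, one_mul, map_zero] at this
      linear_combination this
    · have := (hsc (genOdd b) 0).2.2.2
      simp only [ev4_cpt, compDminus, Matrix.cons_val, genOdd, ZeroMemClass.coe_zero, zero_mul,
        add_zero, q2, mul_zero] at this
      have := congrArg (coord {b}) this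
      simp only [map_add, map_sub, map_mul, coord_singleton_mul, cb, bb, b1, bv, bv', zero_mul,
        add_zero, zero_add, one_mul, map_zero] at this
      linear_combination this
  · have := congrArg (coord {b}) q1
    rwa [coord_singleton_mul, b2, zero_mul, add_zero, cv, cv, bv] at this
  · have := congrArg (coord {b}) q2
    rwa [coord_singleton_mul, b1, zero_mul, add_zero, cv, cv, bv] at this

end ScalarEquations

/-! ### Linearization of families of automorphisms -/

section Linearization

variable {N : ℕ∞}

theorem SuperFn.at_apply (F : SuperFn N (ℂ → ℂ → ℂ)) (t : ℂ) (k : Fin 4) (K : Finset (Gen N)) :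
    F.at t k K = F k K t := Finsupp.mapRange_apply ..

theorem SuperFn.dt_apply (F : SuperFn N (ℂ → ℂ → ℂ)) (k : Fin 4) (K : Finset (Gen N)) (z : ℂ) :
    F.dt k K z = deriv (fun t => F k K t z) 0 := by
  rw [SuperFn.dt, Finsupp.mapRange_apply]

theorem comp_eval_single (g : ℂ → ℂ) (z : ℂ) :
    Comp.eval (Finsupp.single (∅ : Finset (Gen N)) g) (algebraMap ℂ (Grassmann N) z) =
      algebraMap ℂ _ (g z) := by
  rw [Comp.eval, Finsupp.sum_single_index, zeta_empty, mul_one, ext_algebraMap]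
  rw [ext_zero, zero_mul]

theorem CFn.eval_cpt (F : CFn) (z : ℂ) (x y : oddPart N) :
    F.eval (cpt z x y) = ev4 (fun k => algebraMap ℂ (Grassmann N) (F k z)) (cpt z x y) := by
  rw [CFn.eval, SuperFn.eval_eq_ev4]
  congr 1
  funext k
  exact comp_eval_single _ _

/-! ### Derivatives at t = 0 of the superconformal equations -/

section Family

variable {n : ℤ} {T : ℂ → Equiv.Perm (Sphere N n)} {α : Chart} {z₀ : ℂ} {r : ℝ}
  {H : Fin 3 → SuperFn N (ℂ → ℂ → ℂ)}

theorem IsLocalFamily.isLow (h : IsLocalFamily T α z₀ r H) (i : Fin 3) (t : ℂ) (k : Fin 4)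
    (K : Finset (Gen N)) (hK : K ∈ ((H i).at t k).support) : IsLow 2 K :=
  (h.2.1 i k K (Finsupp.support_mapRange hK)).1

theorem IsLocalFamily.analyticAt (h : IsLocalFamily T α z₀ r H) (i : Fin 3) (k : Fin 4)
    (K : Finset (Gen N)) {z : ℂ} (hz : ‖z - z₀‖ < r) :
    AnalyticAt ℂ (fun x : ℂ × ℂ => H i k K x.1 x.2) (0, z) := by
  refine analytic_coeff (h.2.1 i k) K (0, z) ?_
  rw [Metric.mem_ball, Prod.dist_eq, max_lt_iff, dist_self, dist_eq_norm]
  exact ⟨h.1, hz⟩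

/-- Being an automorphism provides some superfunctions `G` for each `t`, unrelated to the analytic
family `H`. Both represent the same map with low monomials, so their coefficients agree near z and
the equations pass to `H`. -/
theorem IsLocalFamily.scalar_equations (hN : 1 < N) (h : IsLocalFamily T α z₀ r H) {t : ℂ}
    (ht : ‖t‖ < r) (hT : T t ∈ Aut N n) {z : ℂ} (hz : ‖z - z₀‖ < r) :
    (∀ K, IsLow 2 K → LinearEqs (fun i => (H i).at t) K z) ∧ BodyEqs (fun i => (H i).at t) z ∧
      ∀ b, OddEqs (fun i => (H i).at t) b z := by
  have hne : ∃ p q : Point N, T t (chartInv α p) = chartInv α q := by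
    obtain ⟨q, hq, -⟩ := h.2.2 t ht (cpt z₀ 0 0) (by rw [body_cpt, sub_self, norm_zero]; exact h.1)
    exact ⟨_, q, hq⟩
  obtain ⟨V, hV, hdom, G, hG, hval⟩ := hT α α hne
  have hball : ∀ p : Point N, ‖p.body - z₀‖ < r → p.body ∈ V ∧
      ∀ i, (G i).eval p = ((H i).at t).eval p ∧ (G i).eval p ∈ grPart N 0 (coordParity i) := by
    intro p hp
    obtain ⟨q, hq, hqH⟩ := h.2.2 t ht p hp
    refine ⟨(hdom p).mp ⟨q, hq⟩, fun i => ?_⟩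
    rw [← hval p q hq i]
    refine ⟨hqH i, ?_⟩
    fin_cases i
    exacts [q.2.1, q.2.2.1, q.2.2.2]
  have hcoef : ∀ i k K w, ‖w - z₀‖ < r → G i k K w = (H i).at t k K w := fun i k K w hw =>
    SuperFn.coeff_eq hN (fun k K hK => (hG.1 i k K hK).1) (h.isLow i t)
      (fun p hp => ((hball p (by rwa [hp])).2 i).1) k K
  have hder : ∀ i k K, deriv (G i k K) z = deriv ((H i).at t k K) z := fun i k K => by
    refine Filter.EventuallyEq.deriv_eq ?_
    have : Metric.ball z₀ r ∈ 𝓝 z := Metric.isOpen_ball.mem_nhds (by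
      rwa [Metric.mem_ball, dist_eq_norm])
    filter_upwards [this] with w hw
    exact hcoef i k K w (by rwa [Metric.mem_ball, dist_eq_norm] at hw)
  have hzV : z ∈ V := by
    have := (hball (cpt z 0 0) (by rwa [body_cpt])).1
    rwa [body_cpt] at this
  have main := hG.scalar_equations hN hzV
    (fun p hp => ((hball p (by rwa [hp])).2 1).2) (fun p hp => ((hball p (by rwa [hp])).2 2).2)
  simpa only [LinearEqs, BodyEqs, OddEqs, hder, hcoef _ _ _ z hz] using main

/-- The coefficients of the identity map. -/
def idCoeff : Fin 3 → Fin 4 → ℂ → ℂ :=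
  ![![fun z => z, 0, 0, 0], ![0, 1, 0, 0], ![0, 0, 1, 0]]

theorem IsLocalFamily.coeff_zero (hN : 1 < N) (h : IsLocalFamily T α z₀ r H) (hT : T 0 = 1)
    {z : ℂ} (hz : ‖z - z₀‖ < r) (i : Fin 3) (k : Fin 4) {K : Finset (Gen N)} (hK : IsLow 2 K) :
    H i k K 0 z = if K = ∅ then idCoeff i k z else 0 := by
  have := coord_ev4_ext hN (z := z)
    (a := fun k => Comp.eval ((H i).at 0 k) (algebraMap ℂ (Grassmann N) z))
    (b := fun k => algebraMap ℂ (Grassmann N) (idCoeff i k z)) (fun x y => by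
      obtain ⟨q, hq, hqH⟩ := h.2.2 0 (by rw [norm_zero]; exact h.1) (cpt z x y) (by rwa [body_cpt])
      rw [hT] at hq
      have : cpt z x y = q := chartInv_injective α hq
      subst this
      refine (hqH i).symm.trans ?_
      fin_cases i <;> simp [ev4_cpt, idCoeff] <;> rfl) hK k
  rw [coord_comp_eval, SuperFn.at_apply] at this
  rw [this, Algebra.algebraMap_eq_smul_one, map_smul, ← zeta_empty, coord_zeta, smul_eq_mul]
  simp [eq_comm]

theorem IsLocalFamily.hasDerivAt (h : IsLocalFamily T α z₀ r H) {z : ℂ} (hz : ‖z - z₀‖ < r)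
    (i : Fin 3) (k : Fin 4) (K : Finset (Gen N)) :
    HasDerivAt (fun t => H i k K t z) ((H i).dt k K z) 0 := by
  rw [SuperFn.dt_apply]
  exact (analyticAt_fst (h.analyticAt i k K hz)).differentiableAt.hasDerivAt

theorem hasDerivAt_deriv {h : ℂ → ℂ → ℂ} {t x : ℂ}
    (hh : AnalyticAt ℂ (fun y : ℂ × ℂ => h y.1 y.2) (t, x)) :
    HasDerivAt (fun s => deriv (h s) x) (deriv (fun y => deriv (fun s => h s y) t) x) t := by
  rw [deriv_deriv_comm hh]
  refine DifferentiableAt.hasDerivAt ?_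
  have h1 : AnalyticAt ℂ (fun s => fderiv ℂ (fun y : ℂ × ℂ => h y.1 y.2) (s, x) (0, 1)) t :=
    analyticAt_fst (h := fun s x => fderiv ℂ (fun y : ℂ × ℂ => h y.1 y.2) (s, x) (0, 1))
      (analyticAt_clm_apply hh.fderiv _)
  refine h1.differentiableAt.congr_of_eventuallyEq ?_
  have : ∀ᶠ s in 𝓝 t, AnalyticAt ℂ (fun y : ℂ × ℂ => h y.1 y.2) (s, x) :=
    (Continuous.tendsto (by fun_prop : Continuous fun s : ℂ => (s, x)) t).eventually
      hh.eventually_analyticAt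
  filter_upwards [this] with s hs
  exact deriv_snd_eq hs

theorem IsLocalFamily.hasDerivAt_deriv (h : IsLocalFamily T α z₀ r H) {z : ℂ} (hz : ‖z - z₀‖ < r)
    (i : Fin 3) (k : Fin 4) (K : Finset (Gen N)) :
    HasDerivAt (fun t => deriv (H i k K t) z) (deriv ((H i).dt k K) z) 0 := by
  have := N2Sphere.hasDerivAt_deriv (h.analyticAt i k K hz)
  simpa only [← SuperFn.dt_apply] using this

theorem IsLocalFamily.analyticAt_dt (h : IsLocalFamily T α z₀ r H) {z : ℂ} (hz : ‖z - z₀‖ < r)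
    (i : Fin 3) (k : Fin 4) (K : Finset (Gen N)) : AnalyticAt ℂ ((H i).dt k K) z := by
  have := analyticAt_deriv_fst (h.analyticAt i k K hz)
  simpa only [← SuperFn.dt_apply] using this

theorem IsLocalFamily.eventually_norm_lt (h : IsLocalFamily T α z₀ r H) :
    ∀ᶠ t in 𝓝 (0 : ℂ), ‖t‖ < r := by
  have := Metric.ball_mem_nhds (0 : ℂ) h.1
  filter_upwards [this] with t ht
  rwa [mem_ball_zero_iff] at ht

theorem eq_of_hasDerivAt {f g : ℂ → ℂ} {a b x : ℂ} (hf : HasDerivAt f a x) (hg : HasDerivAt g b x)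
    (h : ∀ᶠ t in 𝓝 x, f t = g t) : a = b :=
  hf.unique (hg.congr_of_eventuallyEq h)


theorem IsLocalFamily.eventually_scalar_equations (hN : 1 < N) (h : IsLocalFamily T α z₀ r H)
    (hT : ∀ᶠ t in 𝓝 (0 : ℂ), T t ∈ Aut N n) {z : ℂ} (hz : ‖z - z₀‖ < r) :
    ∀ᶠ t in 𝓝 (0 : ℂ), (∀ K, IsLow 2 K → LinearEqs (fun i => (H i).at t) K z) ∧
      BodyEqs (fun i => (H i).at t) z ∧ ∀ b, OddEqs (fun i => (H i).at t) b z := by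
  filter_upwards [hT, h.eventually_norm_lt] with t ht htr
  exact h.scalar_equations hN htr ht hz

theorem IsLocalFamily.linearEqs_dt (hN : 1 < N) (h : IsLocalFamily T α z₀ r H)
    (hT : ∀ᶠ t in 𝓝 (0 : ℂ), T t ∈ Aut N n) {z : ℂ} (hz : ‖z - z₀‖ < r)
    {K : Finset (Gen N)} (hK : IsLow 2 K) : LinearEqs (fun i => (H i).dt) K z := by
  have hev := h.eventually_scalar_equations hN hT hz
  simp only [LinearEqs, SuperFn.at_apply] at hev ⊢
  have d := h.hasDerivAt hz
  have d' := h.hasDerivAt_deriv hz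
  refine ⟨eq_of_hasDerivAt (d 2 1 K) (hasDerivAt_const 0 (0 : ℂ)) ?_,
    eq_of_hasDerivAt (d 1 2 K) (hasDerivAt_const 0 (0 : ℂ)) ?_,
    eq_of_hasDerivAt (d 2 3 K) (d' 2 0 K).neg ?_, eq_of_hasDerivAt (d 1 3 K) (d' 1 0 K) ?_⟩ <;>
  filter_upwards [hev] with t ht
  exacts [(ht.1 K hK).1, (ht.1 K hK).2.1, (ht.1 K hK).2.2.1, (ht.1 K hK).2.2.2]

/-- At `t = 0` both factors on the right equal 1, so the product linearizes to a sum. -/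
theorem IsLocalFamily.bodyEqs_dt (hN : 1 < N) (h : IsLocalFamily T α z₀ r H) (hT0 : T 0 = 1)
    (hT : ∀ᶠ t in 𝓝 (0 : ℂ), T t ∈ Aut N n) {z : ℂ} (hz : ‖z - z₀‖ < r) :
    (H 0).dt 3 ∅ z + deriv ((H 0).dt 0 ∅) z = (H 1).dt 1 ∅ z + (H 2).dt 2 ∅ z ∧
    deriv ((H 0).dt 0 ∅) z - (H 0).dt 3 ∅ z = (H 1).dt 1 ∅ z + (H 2).dt 2 ∅ z := by
  have hev := h.eventually_scalar_equations hN hT hz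
  simp only [BodyEqs, SuperFn.at_apply] at hev
  have d := fun i k => h.hasDerivAt hz i k ∅
  have d' := h.hasDerivAt_deriv hz 0 0 ∅
  have h11 : H 1 1 ∅ 0 z = 1 := by
    simpa [idCoeff] using h.coeff_zero hN hT0 hz 1 1 (isLow_empty (m := 2))
  have h22 : H 2 2 ∅ 0 z = 1 := by
    simpa [idCoeff] using h.coeff_zero hN hT0 hz 2 2 (isLow_empty (m := 2))
  constructor
  · have := eq_of_hasDerivAt ((d 0 3).add d') ((d 2 2).mul (d 1 1)) (by
      filter_upwards [hev] with t ht using ht.2.1.1)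
    rw [h11, h22] at this
    linear_combination this
  · have := eq_of_hasDerivAt (d'.sub (d 0 3)) ((d 1 1).mul (d 2 2)) (by
      filter_upwards [hev] with t ht using ht.2.1.2)
    rw [h11, h22] at this
    linear_combination this

/-- One factor vanishes and the other is 1 at `t = 0`, so only the derivative of the first survives.
-/
theorem IsLocalFamily.oddEqs_dt (hN : 1 < N) (h : IsLocalFamily T α z₀ r H) (hT0 : T 0 = 1)
    (hT : ∀ᶠ t in 𝓝 (0 : ℂ), T t ∈ Aut N n) {z : ℂ} (hz : ‖z - z₀‖ < r) {b : Gen N}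
    (hb : IsLow 2 {b}) :
    (H 0).dt 1 {b} z = (H 2).dt 0 {b} z ∧ (H 0).dt 2 {b} z = (H 1).dt 0 {b} z := by
  have hev := h.eventually_scalar_equations hN hT hz
  simp only [OddEqs, SuperFn.at_apply] at hev
  have d := h.hasDerivAt hz
  have h11 : H 1 1 ∅ 0 z = 1 := by
    simpa [idCoeff] using h.coeff_zero hN hT0 hz 1 1 (isLow_empty (m := 2))
  have h22 : H 2 2 ∅ 0 z = 1 := by
    simpa [idCoeff] using h.coeff_zero hN hT0 hz 2 2 (isLow_empty (m := 2))
  have h10 : H 1 0 {b} 0 z = 0 := by simpa using h.coeff_zero hN hT0 hz 1 0 hb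
  have h20 : H 2 0 {b} 0 z = 0 := by simpa using h.coeff_zero hN hT0 hz 2 0 hb
  constructor
  · have := eq_of_hasDerivAt (d 0 1 {b}) ((d 2 0 {b}).mul (d 1 1 ∅)) (by
      filter_upwards [hev] with t ht using (ht.2.2 b).1)
    rw [h11, h20] at this
    linear_combination this
  · have := eq_of_hasDerivAt (d 0 2 {b}) ((d 1 0 {b}).mul (d 2 2 ∅)) (by
      filter_upwards [hev] with t ht using (ht.2.2 b).2)
    rw [h22, h10] at this
    linear_combination this

end Family

/-! ### The gluing relation for the body and first-order coefficients -/

theorem body_zp {x : evenPart N} (hx : IsUnit x) (k : ℤ) :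
    body (zp x k : Grassmann N) = body (x : Grassmann N) ^ k := by
  obtain ⟨u, rfl⟩ := hx
  rw [zp_unit]
  have h := Units.coe_map (body.toMonoidHom.comp (evenPart N).val.toMonoidHom) (u ^ k)
  rw [map_zpow, Units.val_zpow_eq_zpow_val] at h
  exact h.symm

theorem coord_flip {n : ℤ} {κ : ℂ} {q : Point N} (hq : IsUnit q.z) (b : Gen N) :
    body ((flip n κ q).1 0) = (body (q.1 0))⁻¹ ∧
    coord {b} ((flip n κ q).1 1) = κ * body (q.1 0) ^ (n - 1) * coord {b} (q.1 1) ∧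
    coord {b} ((flip n κ q).1 2) = κ * body (q.1 0) ^ (-n - 1) * coord {b} (q.1 2) := by
  have key : ∀ (k : ℤ) {y : Grassmann N}, y ∈ grPart N 0 1 →
      coord {b} ((cst κ * zp q.z k : evenPart N) * y : Grassmann N) =
        κ * body (q.1 0) ^ k * coord {b} y := by
    intro k y hy
    rw [coord_singleton_mul, body_odd hy, mul_zero, zero_add]
    congr 1
    change body (algebraMap ℂ (Grassmann N) κ * (zp q.z k : Grassmann N)) = _
    rw [map_mul, body_algebraMap, body_zp hq]
    rfl
  refine ⟨?_, key _ q.2.2.1, key _ q.2.2.2⟩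
  change body ((Ring.inverse q.z : evenPart N) : Grassmann N) = _
  have := congrArg (fun x : evenPart N => body (x : Grassmann N)) (Ring.mul_inverse_cancel _ hq)
  have h2 : body (q.1 0) * body ((Ring.inverse q.z : evenPart N) : Grassmann N) = 1 := by
    rw [← map_mul]
    exact this.trans (map_one _)
  exact eq_inv_of_mul_eq_one_right h2

theorem flip_cpt {n : ℤ} {κ w : ℂ} (hw : w ≠ 0) (x y : oddPart N) :
    flip n κ (cpt w x y) = cpt w⁻¹ (cst (N := N) (κ * w ^ (n - 1)) • x)
      (cst (N := N) (κ * w ^ (-n - 1)) • y) := by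
  obtain ⟨u, rfl⟩ : ∃ u : ℂˣ, (u : ℂ) = w := ⟨Units.mk0 w hw, rfl⟩
  have hu : cst (N := N) (u : ℂ) = ((Units.map (algebraMap ℂ (evenPart N)).toMonoidHom u :
    (evenPart N)ˣ) : evenPart N) := rfl
  have hz : ∀ k : ℤ, zp (cst (N := N) (u : ℂ)) k = cst ((u : ℂ) ^ k) := fun k => by
    rw [hu, zp_unit, ← map_zpow, Units.coe_map, Units.val_zpow_eq_zpow_val]
    rfl
  have hi : Ring.inverse (cst (N := N) (u : ℂ)) = cst ((u : ℂ)⁻¹) := by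
    rw [hu, Ring.inverse_unit, ← map_inv, Units.coe_map, Units.val_inv_eq_inv_val]
    rfl
  rw [flip, cpt, mkPt_z, mkPt_thP, mkPt_thM, hz, hz, hi, cpt, cst, cst, cst, cst, cst, map_mul, map_mul]


theorem SuperFn.body_eval_cpt (F : SuperFn N (ℂ → ℂ)) (z : ℂ) (x y : oddPart N) :
    body (F.eval (cpt z x y)) = F 0 ∅ z := by
  rw [SuperFn.eval_eq_ev4, ev4_cpt]
  simp only [map_add, map_mul, body_odd x.2, body_odd y.2, zero_mul, add_zero]
  rw [← coord_empty]
  exact coord_comp_eval _ _ _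

theorem SuperFn.coord_eval_cpt (F : SuperFn N (ℂ → ℂ)) (z : ℂ) (x : oddPart N) (b : Gen N) :
    coord {b} (F.eval (cpt z x 0)) = F 0 {b} z + coord {b} (x : Grassmann N) * F 1 ∅ z := by
  rw [SuperFn.eval_eq_ev4, ev4_cpt]
  simp only [ZeroMemClass.coe_zero, zero_mul, mul_zero, add_zero, map_add, coord_singleton_mul,
    body_odd x.2]
  rw [← coord_empty]
  congr 1
  · exact coord_comp_eval _ _ _
  · congr 1
    exact coord_comp_eval _ _ _

/-- An automorphism commutes with the change of charts: the southern image of the glued point is the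
flip of the northern image. The relation is read off at points (w, x, 0), with x = 0 for the
components without θ and x a generator for the θ⁺ component. -/
theorem glue_coeff (hN : 1 < N) {n : ℤ} {T : Equiv.Perm (Sphere N n)} {w : ℂ} (hw : w ≠ 0)
    {F G : Fin 3 → SuperFn N (ℂ → ℂ)}
    (hF : ∀ p : Point N, p.body = w → ∃ q : Point N, T (chartInv .north p) = chartInv .north q ∧
      ∀ i, q.1 i = (F i).eval p)
    (hG : ∀ p : Point N, p.body = w⁻¹ → ∃ q : Point N, T (chartInv .south p) = chartInv .south q ∧
      ∀ i, q.1 i = (G i).eval p) :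
    G 0 0 ∅ w⁻¹ = (F 0 0 ∅ w)⁻¹ ∧
    w ^ (n - 1) * G 1 1 ∅ w⁻¹ = F 0 0 ∅ w ^ (n - 1) * F 1 1 ∅ w ∧
    ∀ b, G 1 0 {b} w⁻¹ = Complex.I * F 0 0 ∅ w ^ (n - 1) * F 1 0 {b} w ∧
      G 2 0 {b} w⁻¹ = Complex.I * F 0 0 ∅ w ^ (-n - 1) * F 2 0 {b} w := by
  have key : ∀ x : oddPart N, (∀ b, (G 1 0 {b} w⁻¹ +
      coord {b} (cst (N := N) (Complex.I * w ^ (n - 1)) * x : Grassmann N) * G 1 1 ∅ w⁻¹ =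
        Complex.I * F 0 0 ∅ w ^ (n - 1) *
          (F 1 0 {b} w + coord {b} (x : Grassmann N) * F 1 1 ∅ w)) ∧
      (G 2 0 {b} w⁻¹ +
      coord {b} (cst (N := N) (Complex.I * w ^ (n - 1)) * x : Grassmann N) * G 2 1 ∅ w⁻¹ =
        Complex.I * F 0 0 ∅ w ^ (-n - 1) *
          (F 2 0 {b} w + coord {b} (x : Grassmann N) * F 2 1 ∅ w))) ∧
      G 0 0 ∅ w⁻¹ = (F 0 0 ∅ w)⁻¹ := by
    intro x
    obtain ⟨q', hq', hv'⟩ := hF (cpt w x 0) (body_cpt _ _ _)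
    obtain ⟨q, hq, hv⟩ := hG (flip n Complex.I (cpt w x 0)) (by rw [flip_cpt hw, body_cpt])
    have hu : IsUnit (cpt w x 0).z := isUnit_z_iff.mpr (by rwa [body_cpt])
    rw [← north_eq_south hu, hq', north_eq_south_iff] at hq
    obtain ⟨hqu, rfl⟩ := hq
    rw [flip_cpt hw, smul_zero] at hv
    have hb : body (q'.1 0) = F 0 0 ∅ w := by rw [hv', SuperFn.body_eval_cpt]
    refine ⟨fun b => ?_, ?_⟩
    · obtain ⟨-, c1, c2⟩ := coord_flip (n := n) (κ := Complex.I) hqu b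
      rw [hb, hv 1, hv' 1, SuperFn.coord_eval_cpt, SuperFn.coord_eval_cpt] at c1
      rw [hb, hv 2, hv' 2, SuperFn.coord_eval_cpt, SuperFn.coord_eval_cpt] at c2
      exact ⟨c1, c2⟩
    · rw [← SuperFn.body_eval_cpt (G 0) w⁻¹ (cst (N := N) (Complex.I * w ^ (n - 1)) • x) 0, ← hv,
        ← hb]
      change body ((Ring.inverse q'.z : evenPart N) : Grassmann N) = _
      have h2 : body (q'.1 0) * body ((Ring.inverse q'.z : evenPart N) : Grassmann N) = 1 := by
        rw [← map_mul]
        exact (congrArg (fun x : evenPart N => body (x : Grassmann N))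
          (Ring.mul_inverse_cancel _ hqu)).trans (map_one _)
      exact eq_inv_of_mul_eq_one_right h2
  have k0 := key 0
  simp only [ZeroMemClass.coe_zero, mul_zero, map_zero, zero_mul, add_zero] at k0
  obtain ⟨b, -, -, -, -⟩ := exists_two_gens hN (isLow_empty (m := 2) (N := N))
  refine ⟨k0.2, ?_, k0.1⟩
  have h1 := ((key (genOdd b)).1 b).1
  have cb : coord {b} (genOdd b : Grassmann N) = 1 := by rw [genOdd, coord_zeta, if_pos rfl]
  have h2 : coord {b} (cst (N := N) (Complex.I * w ^ (n - 1)) * genOdd b : Grassmann N) =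
      Complex.I * w ^ (n - 1) := by
    rw [coord_singleton_mul, cb, body_odd (genOdd b).2]
    change _ + body (algebraMap ℂ (Grassmann N) _) * _ = _
    rw [body_algebraMap, mul_zero, zero_add, mul_one]
  rw [h2, cb, (k0.1 b).1] at h1
  refine mul_left_cancel₀ Complex.I_ne_zero ?_
  linear_combination h1

end Linearization

/-! ### Necessary conditions on infinitesimal automorphisms -/

section Necessary

variable {N : ℕ∞} {n : ℤ}

/-- The sign `e` is the cost of moving ζ_K past an odd coordinate. It occurs twice in the θ⁺θ⁻
component, where it cancels. -/
theorem dt_coeff_eq (hN : 1 < N) {H : SuperFn N (ℂ → ℂ → ℂ)} {Y : CFn} {K : Finset (Gen N)}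
    (hK : IsLow 2 K) {e : ℂ} (he : e * e = 1)
    (hc : ∀ x : oddPart N, zeta K * (x : Grassmann N) = e • ((x : Grassmann N) * zeta K)) {z : ℂ}
    (h : ∀ p : Point N, p.body = z → H.dt.eval p = zeta K * Y.eval p) (k : Fin 4) :
    H.dt k K z = (![1, e, e, 1] : Fin 4 → ℂ) k * Y k z := by
  have := coord_ev4_ext hN (z := z)
    (a := fun k => Comp.eval (H.dt k) (algebraMap ℂ (Grassmann N) z))
    (b := fun k => ((![1, e, e, 1] : Fin 4 → ℂ) k * Y k z) • zeta K) (fun x y => by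
      refine (h (cpt z x y) (body_cpt z x y)).trans ?_
      rw [CFn.eval_cpt, ev4_cpt, ev4_cpt]
      have hm : ∀ (a : ℂ) (v : Grassmann N), v * algebraMap ℂ (Grassmann N) a = a • v :=
        fun a v => by rw [← Algebra.commutes, ← Algebra.smul_def]
      simp only [hm, Algebra.algebraMap_eq_smul_one, mul_add, mul_smul_comm, mul_one, hc,
        Matrix.cons_val, one_mul, ← mul_assoc, smul_mul_assoc, smul_smul]
      have : (x : Grassmann N) * zeta K * (y : Grassmann N) =
          e • ((x : Grassmann N) * (y : Grassmann N) * zeta K) := by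
        rw [mul_assoc, hc, mul_smul_comm, mul_assoc]
      rw [this, smul_smul, mul_assoc, he, mul_one, mul_comm (Y 1 z) e, mul_comm (Y 2 z) e]) hK k
  rw [coord_comp_eval] at this
  rw [this, map_smul, coord_zeta, if_pos rfl, smul_eq_mul, mul_one]

/-- Derivative of `glue_coeff` at `t = 0`. The northern family `F` near the pole is chosen once and
is continuous at 0, while the southern family `G` is chosen anew near each 1/w; so `F` controls the
growth of the field at infinity. -/
theorem IsTangent.south_north {W : Fin 3 → Point N → Grassmann N} (hN : 1 < N)
    (h : IsTangent N n W) : ∃ (r : ℝ) (F : Fin 3 → SuperFn N (ℂ → ℂ → ℂ)), 0 < r ∧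
      (∀ i k K, ContinuousAt ((F i).dt k K) 0) ∧ ∀ w : ℂ, w ≠ 0 → ‖w‖ < r →
      ∃ G : Fin 3 → SuperFn N (ℂ → ℂ → ℂ),
        (∀ p : Point N, p.body = w⁻¹ → ∀ i, (G i).dt.eval p = W i p) ∧
        w ^ 2 * (G 0).dt 0 ∅ w⁻¹ = -(F 0).dt 0 ∅ w ∧
        (G 1).dt 1 ∅ w⁻¹ + (n - 1) * w * (G 0).dt 0 ∅ w⁻¹ = (F 1).dt 1 ∅ w ∧
        ∀ b, IsLow 2 {b} → w ^ (1 - n) * (G 1).dt 0 {b} w⁻¹ = Complex.I * (F 1).dt 0 {b} w ∧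
          w ^ (n + 1) * (G 2).dt 0 {b} w⁻¹ = Complex.I * (F 2).dt 0 {b} w := by
  obtain ⟨T, hT0, hT, hn, hs⟩ := h
  obtain ⟨r, F, hF⟩ := hn 0
  refine ⟨r, F, hF.1, fun i k K => (hF.analyticAt_dt (by simpa using hF.1) i k K).continuousAt,
    fun w hw hwr => ?_⟩
  obtain ⟨s, G, hG, hGW⟩ := hs w⁻¹
  have hws : ‖w⁻¹ - w⁻¹‖ < s := by rw [sub_self, norm_zero]; exact hG.1
  have hwr' : ‖w - 0‖ < r := by rwa [sub_zero]
  refine ⟨G, fun p hp => hGW p (by rwa [hp]), ?_⟩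
  have hev := (hF.eventually_norm_lt.and hG.eventually_norm_lt).mono fun t ht =>
    glue_coeff hN hw (fun p hp => hF.2.2 t ht.1 p (by rwa [hp]))
      (fun p hp => hG.2.2 t ht.2 p (by rwa [hp]))
  simp only [SuperFn.at_apply] at hev
  have dF := hF.hasDerivAt hwr'
  have dG := hG.hasDerivAt hws
  have F00 : F 0 0 ∅ 0 w = w := by
    simpa [idCoeff] using hF.coeff_zero hN hT0 hwr' 0 0 (isLow_empty (m := 2))
  have F11 : F 1 1 ∅ 0 w = 1 := by
    simpa [idCoeff] using hF.coeff_zero hN hT0 hwr' 1 1 (isLow_empty (m := 2))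
  -- The power is differentiated at its value w for `t = 0`, where w ≠ 0 allows negative exponents.
  have hz : ∀ k : ℤ, HasDerivAt (fun t => F 0 0 ∅ t w ^ k) (k * w ^ (k - 1) * (F 0).dt 0 ∅ w) 0 := by
    intro k
    have h1 : HasDerivAt (fun x : ℂ => x ^ k) (k * w ^ (k - 1)) (F 0 0 ∅ 0 w) := by
      rw [F00]
      exact hasDerivAt_zpow k w (Or.inl hw)
    exact h1.comp 0 (dF 0 0 ∅)
  have hpow : ∀ k : ℤ, w ^ (k - 1) * w = w ^ k := fun k => by
    rw [← zpow_add_one₀ hw, sub_add_cancel]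
  have e1 : w ^ 2 * (G 0).dt 0 ∅ w⁻¹ = -(F 0).dt 0 ∅ w := by
    have := eq_of_hasDerivAt (dG 0 0 ∅) (hz (-1)) (by
      filter_upwards [hev] with t ht
      rw [ht.1, zpow_neg_one])
    rw [this]
    have h2 := hpow (-1)
    rw [zpow_neg_one] at h2
    generalize w ^ ((-1 : ℤ) - 1) = v at h2 ⊢
    have h4 : w⁻¹ * w = 1 := inv_mul_cancel₀ hw
    push_cast
    linear_combination (-(w * (F 0).dt 0 ∅ w)) * h2 - (F 0).dt 0 ∅ w * h4
  refine ⟨e1, ?_, fun b hb => ?_⟩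
  · have := eq_of_hasDerivAt ((dG 1 1 ∅).const_mul (w ^ (n - 1)))
      ((hz (n - 1)).mul (dF 1 1 ∅)) (by
        filter_upwards [hev] with t ht using ht.2.1)
    rw [F00, F11] at this
    have hne : w ^ (n - 1) ≠ 0 := zpow_ne_zero _ hw
    refine mul_left_cancel₀ hne ?_
    have h2 := hpow (n - 1)
    push_cast at this
    linear_combination this + (n - 1) * w ^ (n - 1 - 1) * e1 -
      (n - 1) * w * (G 0).dt 0 ∅ w⁻¹ * h2
  · have F10 : F 1 0 {b} 0 w = 0 := by simpa using hF.coeff_zero hN hT0 hwr' 1 0 hb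
    have F20 : F 2 0 {b} 0 w = 0 := by simpa using hF.coeff_zero hN hT0 hwr' 2 0 hb
    constructor
    · have := eq_of_hasDerivAt (dG 1 0 {b})
        (((hz (n - 1)).const_mul Complex.I).mul (dF 1 0 {b})) (by
          filter_upwards [hev] with t ht using (ht.2.2 b).1)
      rw [F00, F10, mul_zero, zero_add] at this
      have h3 : w ^ (1 - n) * w ^ (n - 1) = 1 := by
        rw [← zpow_add₀ hw]; simp
      rw [this]
      linear_combination Complex.I * (F 1).dt 0 {b} w * h3
    · have := eq_of_hasDerivAt (dG 2 0 {b})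
        (((hz (-n - 1)).const_mul Complex.I).mul (dF 2 0 {b})) (by
          filter_upwards [hev] with t ht using (ht.2.2 b).2)
      rw [F00, F20, mul_zero, zero_add] at this
      have h3 : w ^ (n + 1) * w ^ (-n - 1) = 1 := by
        rw [← zpow_add₀ hw]; simp
      rw [this]
      linear_combination Complex.I * (F 2).dt 0 {b} w * h3

theorem eventually_punctured {r : ℝ} (hr : 0 < r) : ∀ᶠ w : ℂ in 𝓝[≠] 0, w ≠ 0 ∧ ‖w‖ < r := by
  filter_upwards [self_mem_nhdsWithin, mem_nhdsWithin_of_mem_nhds (Metric.ball_mem_nhds (0 : ℂ) hr)]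
    with w hw hwr
  exact ⟨hw, by rwa [mem_ball_zero_iff] at hwr⟩

/-- The constant 1 is the monomial of the empty set, so only the body equations intervene. The
second part is regularity at the northern pole. -/
theorem IsTangent.even_conditions (hN : 1 < N) {Y : VField}
    (h : IsTangent N n fun i p => (1 : Grassmann N) * (Y i).eval p) :
    (∀ z, Y 2 1 z = 0 ∧ Y 1 2 z = 0 ∧ Y 0 3 z + deriv (Y 0 0) z = Y 1 1 z + Y 2 2 z ∧
      deriv (Y 0 0) z - Y 0 3 z = Y 1 1 z + Y 2 2 z) ∧
    ∃ Z₀ Z₁ : ℂ → ℂ, ContinuousAt Z₀ 0 ∧ ContinuousAt Z₁ 0 ∧ ∀ᶠ w in 𝓝[≠] 0,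
      w ^ 2 * Y 0 0 w⁻¹ = Z₀ w ∧ Y 1 1 w⁻¹ + (n - 1) * w * Y 0 0 w⁻¹ = Z₁ w := by
  rw [← zeta_empty] at h
  have hc : ∀ x : oddPart N, zeta ∅ * (x : Grassmann N) = (1 : ℂ) • ((x : Grassmann N) * zeta ∅) :=
    fun x => by rw [zeta_empty, one_mul, mul_one, one_smul]
  have hcoef : ∀ {H : Fin 3 → SuperFn N (ℂ → ℂ → ℂ)} {z : ℂ}, (∀ p : Point N, p.body = z → ∀ i,
      (H i).dt.eval p = zeta ∅ * (Y i).eval p) → ∀ i k, (H i).dt k ∅ z = Y i k z := by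
    intro H z hH i k
    have := dt_coeff_eq hN (isLow_empty (m := 2)) (one_mul 1) hc (fun p hp => hH p hp i) k
    rw [this]
    fin_cases k <;> simp
  constructor
  · intro z
    obtain ⟨T, hT0, hT, -, hs⟩ := h
    obtain ⟨s, G, hG, hGW⟩ := hs z
    have hzz : ‖z - z‖ < s := by rw [sub_self, norm_zero]; exact hG.1
    have hY : ∀ w, ‖w - z‖ < s → ∀ i k, (G i).dt k ∅ w = Y i k w := fun w hw =>
      hcoef fun p hp => hGW p (by rwa [hp])
    have hd : deriv ((G 0).dt 0 ∅) z = deriv (Y 0 0) z := by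
      refine Filter.EventuallyEq.deriv_eq ?_
      filter_upwards [Metric.ball_mem_nhds z hG.1] with w hw
      exact hY w (by rwa [Metric.mem_ball, dist_eq_norm] at hw) 0 0
    have h1 := hG.linearEqs_dt hN hT hzz (isLow_empty (m := 2))
    have h2 := hG.bodyEqs_dt hN hT0 hT hzz
    simp only [LinearEqs] at h1
    rw [hY z hzz, hY z hzz] at h1
    rw [hd, hY z hzz, hY z hzz, hY z hzz] at h2
    exact ⟨h1.1, h1.2.1, h2⟩
  · obtain ⟨r, F, hr, hcont, hw⟩ := h.south_north hN
    refine ⟨fun w => -(F 0).dt 0 ∅ w, fun w => (F 1).dt 1 ∅ w, (hcont 0 0 ∅).neg, hcont 1 1 ∅, ?_⟩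
    filter_upwards [eventually_punctured hr] with w hwr
    obtain ⟨G, hGW, e1, e2, -⟩ := hw w hwr.1 hwr.2
    have hY := hcoef hGW
    rw [hY] at e1
    rw [hY, hY] at e2
    exact ⟨e1, e2⟩

/-- A single generator is the simplest odd constant; its coefficient selects the linear equations
and those at first order. The signs in the first two conditions come from moving ζ_b past θ^±. -/
theorem IsTangent.odd_conditions (hN : 1 < N) {Y : VField} {b : Gen N} (hb : IsLow 2 {b})
    (h : IsTangent N n fun i p => zeta {b} * (Y i).eval p) :
    (∀ z, Y 0 1 z = -Y 2 0 z ∧ Y 0 2 z = -Y 1 0 z ∧ Y 2 3 z = -deriv (Y 2 0) z ∧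
      Y 1 3 z = deriv (Y 1 0) z) ∧
    ∃ Z₁ Z₂ : ℂ → ℂ, ContinuousAt Z₁ 0 ∧ ContinuousAt Z₂ 0 ∧ ∀ᶠ w in 𝓝[≠] 0,
      w ^ (1 - n) * Y 1 0 w⁻¹ = Z₁ w ∧ w ^ (n + 1) * Y 2 0 w⁻¹ = Z₂ w := by
  have hc : ∀ x : oddPart N,
      zeta {b} * (x : Grassmann N) = (-1 : ℂ) • ((x : Grassmann N) * zeta {b}) :=
    fun x => by rw [neg_one_smul]; exact odd_mul_odd (genOdd b).2 x.2
  have hcoef : ∀ {H : Fin 3 → SuperFn N (ℂ → ℂ → ℂ)} {z : ℂ}, (∀ p : Point N, p.body = z → ∀ i,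
      (H i).dt.eval p = zeta {b} * (Y i).eval p) → ∀ i k,
      (H i).dt k {b} z = (![1, -1, -1, 1] : Fin 4 → ℂ) k * Y i k z := fun hH i k =>
    dt_coeff_eq hN hb (by norm_num) hc (fun p hp => hH p hp i) k
  constructor
  · intro z
    obtain ⟨T, hT0, hT, -, hs⟩ := h
    obtain ⟨s, G, hG, hGW⟩ := hs z
    have hzz : ‖z - z‖ < s := by rw [sub_self, norm_zero]; exact hG.1
    have hY : ∀ w, ‖w - z‖ < s → ∀ i k,
        (G i).dt k {b} w = (![1, -1, -1, 1] : Fin 4 → ℂ) k * Y i k w := fun w hw =>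
      hcoef fun p hp => hGW p (by rwa [hp])
    have hd : ∀ i, deriv ((G i).dt 0 {b}) z = deriv (Y i 0) z := fun i => by
      refine Filter.EventuallyEq.deriv_eq ?_
      filter_upwards [Metric.ball_mem_nhds z hG.1] with w hw
      rw [hY w (by rwa [Metric.mem_ball, dist_eq_norm] at hw) i 0]
      simp
    have h1 := hG.linearEqs_dt hN hT hzz hb
    have h2 := hG.oddEqs_dt hN hT0 hT hzz hb
    simp only [LinearEqs, hd, hY z hzz, Matrix.cons_val, one_mul] at h1 h2
    refine ⟨?_, ?_, h1.2.2.1, h1.2.2.2⟩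
    · linear_combination -h2.1
    · linear_combination -h2.2
  · obtain ⟨r, F, hr, hcont, hw⟩ := h.south_north hN
    refine ⟨fun w => Complex.I * (F 1).dt 0 {b} w, fun w => Complex.I * (F 2).dt 0 {b} w,
      continuousAt_const.mul (hcont 1 0 {b}), continuousAt_const.mul (hcont 2 0 {b}), ?_⟩
    filter_upwards [eventually_punctured hr] with w hwr
    obtain ⟨G, hGW, -, -, e3⟩ := hw w hwr.1 hwr.2
    have hY := hcoef hGW
    have := e3 b hb
    simpa only [hY, Matrix.cons_val, one_mul] using this

end Necessary

/-! ### Entire functions of polynomial growth -/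

section Growth

open Polynomial

/-- The hypothesis says that f is O(|z|^(j-1)) at infinity. For j = 0 the function tends to zero and
vanishes by Liouville; otherwise the difference quotient at 0 is entire and has growth one degree
lower. -/
theorem exists_polynomial_of_growth (j : ℕ) {f : ℂ → ℂ} (hf : Differentiable ℂ f) {Z : ℂ → ℂ}
    (hZ : ContinuousAt Z 0) (h : ∀ᶠ w in 𝓝[≠] (0 : ℂ), w ^ j * f w⁻¹ = w * Z w) :
    ∃ p : ℂ[X], p.degree < j ∧ f = fun z => p.eval z := by
  induction j generalizing f Z with
  | zero =>
    have h1 : Filter.Tendsto (fun w : ℂ => f w⁻¹) (𝓝[≠] 0) (𝓝 0) := by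
      have h2 : Filter.Tendsto (fun w : ℂ => w * Z w) (𝓝[≠] 0) (𝓝 (0 * Z 0)) :=
        (continuousAt_id.mul hZ).tendsto.mono_left nhdsWithin_le_nhds
      rw [zero_mul] at h2
      refine h2.congr' ?_
      filter_upwards [h] with w hw
      rw [← hw, pow_zero, one_mul]
    have h3 : Filter.Tendsto f (Filter.cocompact ℂ) (𝓝 0) := by
      have h4 := h1.comp (Filter.tendsto_inv₀_cobounded' (α := ℂ))
      rw [Metric.cobounded_eq_cocompact] at h4
      simpa [Function.comp_def] using h4
    refine ⟨0, by simp, ?_⟩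
    funext z
    rw [hf.apply_eq_of_tendsto_cocompact z h3, eval_zero]
  | succ j ih =>
    have hg : Differentiable ℂ (dslope f 0) := by
      rw [← differentiableOn_univ] at hf ⊢
      exact (Complex.differentiableOn_dslope Filter.univ_mem).mpr hf
    obtain ⟨p, hp, hpf⟩ := ih hg (Z := fun w => Z w - w ^ j * f 0)
      (hZ.sub (by fun_prop)) (by
        filter_upwards [h, self_mem_nhdsWithin] with w hw hw0
        have hw0 : w ≠ 0 := hw0
        rw [dslope_of_ne _ (inv_ne_zero hw0), slope_def_field, sub_zero, div_inv_eq_mul]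
        linear_combination hw)
    refine ⟨X * p + C (f 0), ?_, ?_⟩
    · refine (degree_add_le _ _).trans_lt (max_lt ?_ ?_)
      · rcases eq_or_ne p 0 with rfl | h0
        · rw [mul_zero, degree_zero]
          exact bot_lt_iff_ne_bot.mpr (by simp)
        · rw [degree_eq_natDegree h0] at hp
          rw [degree_mul, degree_X, degree_eq_natDegree h0]
          have : p.natDegree < j := by exact_mod_cast hp
          exact_mod_cast (by omega : 1 + p.natDegree < j + 1)
      · exact degree_C_le.trans_lt (by exact_mod_cast Nat.succ_pos j)
    · funext z
      have h1 := congrFun hpf z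
      have h2 := sub_smul_dslope f 0 z
      rw [h1, sub_zero, smul_eq_mul] at h2
      simp only [eval_add, eval_mul, eval_X, eval_C]
      linear_combination -h2

theorem exists_polynomial_of_growth_int (m : ℤ) {f : ℂ → ℂ} (hf : Differentiable ℂ f) {Z : ℂ → ℂ}
    (hZ : ContinuousAt Z 0) (h : ∀ᶠ w in 𝓝[≠] (0 : ℂ), w ^ m * f w⁻¹ = Z w) :
    ∃ p : ℂ[X], (∀ k ∈ p.support, (k : ℤ) ≤ m) ∧ f = fun z => p.eval z := by
  -- For m < -1 the natural exponent is 0 and `l` = -m - 1 supplies the missing power of w; for m ≥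
  -- -1, `l` is 0. Thus negative m forces f = 0.
  obtain ⟨l, hl⟩ : ∃ l : ℕ, ((m + 1).toNat : ℤ) = m + (1 + l) :=
    ⟨((m + 1).toNat - m - 1).toNat, by omega⟩
  obtain ⟨p, hp, hpf⟩ := exists_polynomial_of_growth (m + 1).toNat hf
    (Z := fun w => w ^ l * Z w) ((by fun_prop : ContinuousAt (fun w : ℂ => w ^ l) 0).mul hZ) (by
      filter_upwards [h, self_mem_nhdsWithin] with w hw hw0
      have hw0 : w ≠ 0 := hw0
      have : w ^ (m + 1).toNat = w ^ m * (w * w ^ l) := by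
        rw [← zpow_natCast w (m + 1).toNat, hl, zpow_add₀ hw0, zpow_one_add₀ hw0, zpow_natCast]
      rw [this, ← hw]
      ring)
  refine ⟨p, fun k hk => ?_, hpf⟩
  have : (k : WithBot ℕ) < (m + 1).toNat := (le_degree_of_mem_supp k hk).trans_lt hp
  have : k < (m + 1).toNat := by exact_mod_cast this
  omega

end Growth

/-! ### Superconformal vector fields with polynomial coefficients -/

section PolynomialFields

open Polynomial

/-- Quadruples of polynomials. -/
abbrev Poly4 : Type := ℂ[X] × ℂ[X] × ℂ[X] × ℂ[X]

/-- A polynomial as a function. -/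
def evalFn : ℂ[X] →ₗ[ℂ] ℂ → ℂ where
  toFun p := fun z => p.eval z
  map_add' p q := by funext z; exact eval_add
  map_smul' a p := by funext z; simp

theorem evalFn_apply (p : ℂ[X]) (z : ℂ) : evalFn p z = p.eval z := rfl

theorem evalFn_mul (p q : ℂ[X]) : evalFn (p * q) = evalFn p * evalFn q := by
  funext z; exact eval_mul

theorem deriv_evalFn (p : ℂ[X]) : deriv (evalFn p) = evalFn (derivative p) := by
  funext z; exact p.deriv

theorem evalFn_injective : Function.Injective evalFn := fun p q h =>
  Polynomial.funext fun z => congrFun h z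

/-- The components of the superconformal field with even potential `f`, `g` and odd potential
`a`, `b`. -/
def polyField (q : Poly4) : Fin 3 → Fin 4 → ℂ[X] :=
  ![![q.1, -q.2.2.2, -q.2.2.1, 0], ![q.2.2.1, q.2.1, 0, derivative q.2.2.1],
    ![q.2.2.2, 0, derivative q.1 - q.2.1, -derivative q.2.2.2]]

/-- The vector field with given potentials. -/
def fld : Poly4 →ₗ[ℂ] VField where
  toFun q := fun i k => evalFn (polyField q i k)
  map_add' p q := by
    funext i k
    change evalFn _ = evalFn _ + evalFn _
    rw [← map_add]
    congr 1
    fin_cases i <;> fin_cases k <;> simp [polyField] <;> ring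
  map_smul' c q := by
    funext i k
    change evalFn _ = c • evalFn _
    rw [← map_smul]
    congr 1
    fin_cases i <;> fin_cases k <;> simp [polyField, smul_sub]

theorem fld_apply (q : Poly4) (i : Fin 3) (k : Fin 4) : fld q i k = evalFn (polyField q i k) := rfl

/-- Each potential is itself a component of the field. -/
theorem fld_injective : Function.Injective fld := by
  rintro ⟨f, g, a, b⟩ ⟨f', g', a', b'⟩ h
  have key := fun i k => evalFn_injective (congrFun (congrFun h i) k)
  have h1 := key 0 0
  have h2 := key 1 1
  have h3 := key 1 0
  have h4 := key 2 0
  simp only [polyField, Matrix.cons_val] at h1 h2 h3 h4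
  rw [h1, h2, h3, h4]

/-- Product of superfunctions with polynomial components. -/
def polyMul (F G : Fin 4 → ℂ[X]) : Fin 4 → ℂ[X] :=
  ![F 0 * G 0, F 0 * G 1 + F 1 * G 0, F 0 * G 2 + F 2 * G 0,
    F 0 * G 3 + F 3 * G 0 + F 1 * G 2 - F 2 * G 1]

theorem mul_evalFn (F G : Fin 4 → ℂ[X]) :
    CFn.mul (fun k => evalFn (F k)) (fun k => evalFn (G k)) = fun k => evalFn (polyMul F G k) := by
  funext k
  fin_cases k <;> simp [CFn.mul, polyMul, evalFn_mul]

/-- Action of a vector field with polynomial components. -/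
def polyApply (X : Fin 3 → Fin 4 → ℂ[X]) (F : Fin 4 → ℂ[X]) : Fin 4 → ℂ[X] :=
  polyMul (X 0) (fun k => derivative (F k)) + polyMul (X 1) (dThetaP F) + polyMul (X 2) (dThetaM F)

theorem apply_evalFn (X : Fin 3 → Fin 4 → ℂ[X]) (F : Fin 4 → ℂ[X]) :
    VField.apply (fun i k => evalFn (X i k)) (fun k => evalFn (F k)) =
      fun k => evalFn (polyApply X F k) := by
  have h1 : dThetaP (fun k => evalFn (F k)) = fun k => evalFn (dThetaP F k) := by
    funext k
    fin_cases k <;> simp [dThetaP]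
  have h2 : dThetaM (fun k => evalFn (F k)) = fun k => evalFn (dThetaM F k) := by
    funext k
    fin_cases k <;> simp [dThetaM]
  rw [VField.apply, h1, h2]
  simp only [deriv_evalFn]
  rw [mul_evalFn, mul_evalFn, mul_evalFn]
  funext k
  simp only [Pi.add_apply, polyApply, map_add]

theorem part_zero_fld (q : Poly4) : (fld q).part 0 = fld (q.1, q.2.1, 0, 0) := by
  funext i k
  rw [VField.part, fld_apply, fld_apply]
  have h2 : (1 : ZMod 2) ≠ 0 := by decide
  fin_cases i <;> fin_cases k <;> simp [compParity, coordParity, polyField]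

theorem part_one_fld (q : Poly4) : (fld q).part 1 = fld (0, 0, q.2.2) := by
  funext i k
  rw [VField.part, fld_apply, fld_apply]
  have h2 : (1 : ZMod 2) + 1 = 0 := by decide
  fin_cases i <;> fin_cases k <;> simp [compParity, coordParity, polyField, h2]

/-- The superbracket in terms of potentials. -/
def polyBracket (p q : Poly4) : Poly4 :=
  (p.1 * derivative q.1 - q.1 * derivative p.1 - 2 * (p.2.2.1 * q.2.2.2 + q.2.2.1 * p.2.2.2),
    p.1 * derivative q.2.1 - q.1 * derivative p.2.1 -
      2 * (p.2.2.2 * derivative q.2.2.1 + q.2.2.2 * derivative p.2.2.1),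
    p.1 * derivative q.2.2.1 - p.2.1 * q.2.2.1 - (q.1 * derivative p.2.2.1 - q.2.1 * p.2.2.1),
    p.1 * derivative q.2.2.2 - (derivative p.1 - p.2.1) * q.2.2.2 -
      (q.1 * derivative p.2.2.2 - (derivative q.1 - q.2.1) * p.2.2.2))

/-- Fields of this form are closed under the superbracket, so brackets of vector fields reduce to
bilinear identities between polynomials. -/
theorem bracket_fld (p q : Poly4) : VField.bracket (fld p) (fld q) = fld (polyBracket p q) := by
  have happ : ∀ (p q : Poly4) (i : Fin 3), (fld p).apply (fld q i) =
      fun k => evalFn (polyApply (polyField p) (polyField q i) k) := fun p q i =>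
    apply_evalFn (polyField p) (polyField q i)
  have v0 : ((0 : ZMod 2)).val = 0 := rfl
  have v1 : ((1 : ZMod 2)).val = 1 := rfl
  funext i k
  have hsum : ∀ g : ZMod 2 → CFn, ∑ a, g a = g 0 + g 1 := fun g => Fin.sum_univ_two g
  rw [VField.bracket, hsum, hsum, hsum]
  simp only [part_zero_fld, part_one_fld, happ, v0, v1, mul_zero, zero_mul, mul_one, pow_zero,
    pow_one, one_smul, neg_smul, sub_neg_eq_add, Pi.add_apply, Pi.sub_apply, fld_apply]
  rw [← map_sub, ← map_sub, ← map_sub, ← map_add, ← map_add, ← map_add, ← map_add]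
  congr 1
  obtain ⟨f, g, a, b⟩ := p
  obtain ⟨f', g', a', b'⟩ := q
  fin_cases i <;> fin_cases k <;>
    simp [polyApply, polyField, polyMul, dThetaP, dThetaM, polyBracket] <;> ring

theorem polyBracket_add_left (p p' q : Poly4) :
    polyBracket (p + p') q = polyBracket p q + polyBracket p' q := by
  ext1 <;> [skip; ext1 <;> [skip; ext1]] <;>
    simp only [polyBracket, Prod.fst_add, Prod.snd_add, map_add] <;> ring

theorem polyBracket_smul_left (c : ℂ) (p q : Poly4) :
    polyBracket (c • p) q = c • polyBracket p q := by
  ext1 <;> [skip; ext1 <;> [skip; ext1]] <;>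
    simp only [polyBracket, Prod.smul_fst, Prod.smul_snd, smul_eq_C_mul, derivative_C_mul] <;> ring

theorem polyBracket_add_right (p q q' : Poly4) :
    polyBracket p (q + q') = polyBracket p q + polyBracket p q' := by
  ext1 <;> [skip; ext1 <;> [skip; ext1]] <;>
    simp only [polyBracket, Prod.fst_add, Prod.snd_add, map_add] <;> ring

theorem polyBracket_smul_right (c : ℂ) (p q : Poly4) :
    polyBracket p (c • q) = c • polyBracket p q := by
  ext1 <;> [skip; ext1 <;> [skip; ext1]] <;>
    simp only [polyBracket, Prod.smul_fst, Prod.smul_snd, smul_eq_C_mul, derivative_C_mul] <;> ring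

end PolynomialFields

/-! ### The Neveu–Schwarz algebra -/

section NeveuSchwarz

open Polynomial NSBasis

/-- The bracket as a bilinear map. -/
def nsBilin : NS →ₗ[ℂ] NS →ₗ[ℂ] NS :=
  Finsupp.linearCombination ℂ fun a => Finsupp.linearCombination ℂ (nsBracketBasis a)

theorem nsBracket_eq (u v : NS) : nsBracket u v = nsBilin u v := by
  rw [nsBracket, nsBilin, Finsupp.linearCombination_apply, Finsupp.sum, Finsupp.sum,
    LinearMap.sum_apply]
  refine Finset.sum_congr rfl fun a _ => ?_
  rw [LinearMap.smul_apply, Finsupp.linearCombination_apply, Finsupp.smul_sum]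
  exact Finsupp.sum_congr fun b _ => by rw [mul_smul]

theorem nsBilin_e (a b : NSBasis) : nsBilin (e a) (e b) = nsBracketBasis a b := by
  simp [nsBilin, e]

theorem rep_e (b : NSBasis) : rep (e b) = repBasis b := by
  simp [rep, e]

/-- The potentials of `L_{p-1}`. -/
def potL (p : ℕ) : Poly4 := (-X ^ p, -(C (1 / 2) * derivative (X ^ p)), 0, 0)

theorem eval_derivative_X_pow (p : ℕ) (z : ℂ) :
    eval z (derivative (X ^ p)) = p * z ^ ((p : ℤ) - 1) := by
  rcases p with _ | p
  · simp
  · simp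

theorem repBasis_L (p : ℕ) : repBasis (L ((p : ℤ) - 1)) = fld (potL p) := by
  funext i k z
  rw [fld_apply, evalFn_apply]
  have h := eval_derivative_X_pow p z
  have h0 : z ^ ((p : ℤ) - 1 + 1) = z ^ p := by rw [sub_add_cancel, zpow_natCast]
  fin_cases i <;> fin_cases k <;>
    simp only [repBasis, mono, polyField, potL, Fin.zero_eta, Fin.mk_one, Fin.reduceFinMk,
      Matrix.cons_val, eval_neg, eval_sub, eval_mul, eval_C, eval_pow, eval_X, eval_zero, h, h0,
      map_neg, neg_zero, Pi.zero_apply, derivative_zero] <;>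
    (try (push_cast; ring))

theorem repBasis_J (p : ℕ) : repBasis (J p) = fld (0, -X ^ p, 0, 0) := by
  funext i k z
  rw [fld_apply, evalFn_apply]
  fin_cases i <;> fin_cases k <;>
    simp [repBasis, mono, polyField]

theorem repBasis_Gp (p : ℕ) : repBasis (Gp p) = fld (0, 0, -X ^ p, 0) := by
  funext i k z
  rw [fld_apply, evalFn_apply]
  have h := eval_derivative_X_pow p z
  fin_cases i <;> fin_cases k <;>
    simp only [repBasis, mono, polyField, Fin.zero_eta, Fin.mk_one, Fin.reduceFinMk,
      Matrix.cons_val, eval_neg, eval_sub, eval_mul, eval_C, eval_pow, eval_X, eval_zero, h,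
      map_neg, neg_zero, neg_neg, Pi.zero_apply, derivative_zero, sub_self, zpow_natCast] <;>
    (try (push_cast; ring))

theorem repBasis_Gm (p : ℕ) : repBasis (Gm p) = fld (0, 0, 0, -X ^ p) := by
  funext i k z
  rw [fld_apply, evalFn_apply]
  have h := eval_derivative_X_pow p z
  fin_cases i <;> fin_cases k <;>
    simp only [repBasis, mono, polyField, Fin.zero_eta, Fin.mk_one, Fin.reduceFinMk,
      Matrix.cons_val, eval_neg, eval_sub, eval_mul, eval_C, eval_pow, eval_X, eval_zero, h,
      map_neg, neg_zero, neg_neg, Pi.zero_apply, derivative_zero, sub_self, zpow_natCast] <;>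
    (try (push_cast; ring))

/-- The basis vectors that are represented by polynomial vector fields. -/
inductive IsPos : NSBasis → Prop
  | L (p : ℕ) : IsPos (L ((p : ℤ) - 1))
  | J (p : ℕ) : IsPos (J p)
  | Gp (p : ℕ) : IsPos (Gp p)
  | Gm (p : ℕ) : IsPos (Gm p)

/-- The span of these basis vectors. -/
def posSpan : Submodule ℂ NS := Submodule.span ℂ (e '' {b | IsPos b})

theorem rep_mem_range {u : NS} (hu : u ∈ posSpan) : ∃ q, rep u = fld q := by
  unfold posSpan at hu
  induction hu using Submodule.span_induction with
  | mem u h =>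
    obtain ⟨b, hb, rfl⟩ := h
    rw [rep_e]
    cases hb with
    | L p => exact ⟨_, repBasis_L p⟩
    | J p => exact ⟨_, repBasis_J p⟩
    | Gp p => exact ⟨_, repBasis_Gp p⟩
    | Gm p => exact ⟨_, repBasis_Gm p⟩
  | zero => exact ⟨0, by rw [map_zero, map_zero]⟩
  | add u v _ _ h1 h2 =>
    obtain ⟨p, hp⟩ := h1
    obtain ⟨q, hq⟩ := h2
    exact ⟨p + q, by rw [map_add, map_add, hp, hq]⟩
  | smul c u _ h =>
    obtain ⟨p, hp⟩ := h
    exact ⟨c • p, by rw [map_smul, map_smul, hp]⟩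

theorem X_pow_mul_derivative (p q : ℕ) :
    (X ^ p * derivative (X ^ q) : ℂ[X]) = C (q : ℂ) * X ^ (p + q - 1) := by
  rcases q with _ | q
  · simp
  · rw [derivative_X_pow]
    simp only [Nat.add_sub_cancel]
    rw [show p + (q + 1) - 1 = p + q by omega]
    push_cast
    ring

/-- The truncated exponent p + q - 1 is wrong only for p = q = 0, where the index would leave the
polynomial range; the structure constant vanishes there. The three lemmas that follow have the same
role. -/
theorem smul_repBasis_L (c : ℂ) (p q : ℕ) (h : p + q = 0 → c = 0) :
    c • repBasis (L ((p : ℤ) - 1 + ((q : ℤ) - 1))) = fld (c • potL (p + q - 1)) := by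
  by_cases h0 : p + q = 0
  · rw [h h0, zero_smul, zero_smul, map_zero]
  · rw [map_smul, ← repBasis_L]
    congr 3
    omega

theorem smul_repBasis_J (c : ℂ) (p q : ℕ) (h : p + q = 0 → c = 0) :
    c • repBasis (J ((p : ℤ) - 1 + q)) = fld (c • (0, -X ^ (p + q - 1), 0, 0)) := by
  by_cases h0 : p + q = 0
  · rw [h h0, zero_smul, zero_smul, map_zero]
  · rw [map_smul, ← repBasis_J]
    congr 3
    omega

theorem smul_repBasis_Gp (c : ℂ) (p q : ℕ) (h : p + q = 0 → c = 0) :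
    c • repBasis (Gp ((p : ℤ) - 1 + q)) = fld (c • (0, 0, -X ^ (p + q - 1), 0)) := by
  by_cases h0 : p + q = 0
  · rw [h h0, zero_smul, zero_smul, map_zero]
  · rw [map_smul, ← repBasis_Gp]
    congr 3
    omega

theorem smul_repBasis_Gm (c : ℂ) (p q : ℕ) (h : p + q = 0 → c = 0) :
    c • repBasis (Gm ((p : ℤ) - 1 + q)) = fld (c • (0, 0, 0, -X ^ (p + q - 1))) := by
  by_cases h0 : p + q = 0
  · rw [h h0, zero_smul, zero_smul, map_zero]
  · rw [map_smul, ← repBasis_Gm]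
    congr 3
    omega

theorem poly4_ext {p q : Poly4} (h1 : p.1 = q.1) (h2 : p.2.1 = q.2.1) (h3 : p.2.2.1 = q.2.2.1)
    (h4 : p.2.2.2 = q.2.2.2) : p = q :=
  Prod.ext h1 (Prod.ext h2 (Prod.ext h3 h4))

theorem rep_L_L (p q : ℕ) : rep (nsBracketBasis (L ((p : ℤ) - 1)) (L ((q : ℤ) - 1))) =
    fld (polyBracket (potL p) (potL q)) := by
  have h1 := X_pow_mul_derivative p q
  have h2 := X_pow_mul_derivative q p
  rw [add_comm q p] at h2
  have d1 := congrArg derivative h1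
  have d2 := congrArg derivative h2
  rw [derivative_mul, derivative_C_mul] at d1 d2
  rw [nsBracketBasis, map_add, map_smul, map_smul, rep_e, rep_e, smul_repBasis_L _ p q]
  · rw [show repBasis d = 0 from rfl, smul_zero, add_zero]
    congr 1
    apply poly4_ext
    · simp only [potL, polyBracket, Prod.smul_fst, smul_eq_C_mul, map_neg, map_sub, mul_zero,
        map_zero, Int.cast_sub, Int.cast_natCast, Int.cast_one, C_1]
      linear_combination h2 - h1
    · simp only [potL, polyBracket, Prod.smul_fst, Prod.smul_snd, smul_eq_C_mul, map_neg, map_sub,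
        mul_zero, map_zero, Int.cast_sub, Int.cast_natCast, Int.cast_one, C_1, derivative_C_mul]
      linear_combination C (1 / 2) * (d2 - d1)
    · simp [potL, polyBracket]
    · simp [potL, polyBracket]
  · intro h
    obtain ⟨rfl, rfl⟩ := Nat.add_eq_zero_iff.mp h
    simp

theorem polyBracket_potL_J (p q : ℕ) : polyBracket (potL p) (0, -X ^ q, 0, 0) =
    (-(q : ℂ)) • (0, -X ^ (p + q - 1), 0, 0) := by
  have h1 := X_pow_mul_derivative p q
  apply poly4_ext
  · simp [potL, polyBracket]
  · simp only [potL, polyBracket, Prod.smul_fst, Prod.smul_snd, smul_eq_C_mul, map_neg, mul_zero,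
      zero_mul, map_zero]
    linear_combination h1
  · simp [potL, polyBracket]
  · simp [potL, polyBracket]

theorem polyBracket_potL_Gp (p q : ℕ) : polyBracket (potL p) (0, 0, -X ^ q, 0) =
    ((p : ℂ) / 2 - q) • (0, 0, -X ^ (p + q - 1), 0) := by
  have h1 := X_pow_mul_derivative p q
  have h2 := X_pow_mul_derivative q p
  rw [add_comm q p] at h2
  have hC : C ((p : ℂ) / 2) = C (1 / 2 : ℂ) * C (p : ℂ) := by rw [← C_mul]; congr 1; ring
  apply poly4_ext
  · simp [potL, polyBracket]
  · simp [potL, polyBracket]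
  · simp only [potL, polyBracket, Prod.smul_fst, Prod.smul_snd, smul_eq_C_mul, map_neg, map_sub,
      mul_zero, zero_mul, map_zero, hC]
    linear_combination h1 - C (1 / 2) * h2
  · simp [potL, polyBracket]

theorem polyBracket_potL_Gm (p q : ℕ) : polyBracket (potL p) (0, 0, 0, -X ^ q) =
    ((p : ℂ) / 2 - q) • (0, 0, 0, -X ^ (p + q - 1)) := by
  have h1 := X_pow_mul_derivative p q
  have h2 := X_pow_mul_derivative q p
  rw [add_comm q p] at h2
  have hC : C ((p : ℂ) / 2) = C (1 / 2 : ℂ) * C (p : ℂ) := by rw [← C_mul]; congr 1; ring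
  have h3 : C (1 / 2 : ℂ) + C (1 / 2 : ℂ) = 1 := by rw [← C_add, ← C_1]; congr 1; norm_num
  apply poly4_ext
  · simp [potL, polyBracket]
  · simp [potL, polyBracket]
  · simp [potL, polyBracket]
  · simp only [potL, polyBracket, Prod.smul_snd, smul_eq_C_mul, map_neg, map_sub,
      mul_zero, zero_mul, map_zero, hC]
    linear_combination h1 - C (1 / 2) * h2 + X ^ q * derivative (X ^ p) * h3

theorem polyBracket_swap_of_even_left (f g : ℂ[X]) (q : Poly4) :
    polyBracket q (f, g, 0, 0) = -polyBracket (f, g, 0, 0) q := by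
  apply poly4_ext <;> simp only [polyBracket, Prod.fst_neg, Prod.snd_neg, map_zero] <;> ring

theorem rep_L_J (p q : ℕ) : rep (nsBracketBasis (L ((p : ℤ) - 1)) (J q)) =
    fld (polyBracket (potL p) (0, -X ^ q, 0, 0)) := by
  rw [nsBracketBasis, map_smul, rep_e, polyBracket_potL_J, ← smul_repBasis_J _ p q]
  · simp
  · intro h
    obtain ⟨rfl, rfl⟩ := Nat.add_eq_zero_iff.mp h
    simp

theorem rep_J_L (p q : ℕ) : rep (nsBracketBasis (J q) (L ((p : ℤ) - 1))) =
    fld (polyBracket (0, -X ^ q, 0, 0) (potL p)) := by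
  rw [potL, polyBracket_swap_of_even_left, ← potL, map_neg, ← rep_L_J, nsBracketBasis,
    nsBracketBasis, map_smul, map_smul, neg_smul, neg_neg]

theorem rep_L_Gp (p q : ℕ) : rep (nsBracketBasis (L ((p : ℤ) - 1)) (Gp q)) =
    fld (polyBracket (potL p) (0, 0, -X ^ q, 0)) := by
  rw [nsBracketBasis, map_smul, rep_e, polyBracket_potL_Gp, ← smul_repBasis_Gp _ p q]
  · congr 1
    push_cast
    ring
  · intro h
    obtain ⟨rfl, rfl⟩ := Nat.add_eq_zero_iff.mp h
    simp

theorem rep_Gp_L (p q : ℕ) : rep (nsBracketBasis (Gp q) (L ((p : ℤ) - 1))) =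
    fld (polyBracket (0, 0, -X ^ q, 0) (potL p)) := by
  rw [potL, polyBracket_swap_of_even_left, ← potL, map_neg, ← rep_L_Gp, nsBracketBasis,
    nsBracketBasis, map_smul, map_smul, neg_smul]

theorem rep_L_Gm (p q : ℕ) : rep (nsBracketBasis (L ((p : ℤ) - 1)) (Gm q)) =
    fld (polyBracket (potL p) (0, 0, 0, -X ^ q)) := by
  rw [nsBracketBasis, map_smul, rep_e, polyBracket_potL_Gm, ← smul_repBasis_Gm _ p q]
  · congr 1
    push_cast
    ring
  · intro h
    obtain ⟨rfl, rfl⟩ := Nat.add_eq_zero_iff.mp h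
    simp

theorem rep_Gm_L (p q : ℕ) : rep (nsBracketBasis (Gm q) (L ((p : ℤ) - 1))) =
    fld (polyBracket (0, 0, 0, -X ^ q) (potL p)) := by
  rw [potL, polyBracket_swap_of_even_left, ← potL, map_neg, ← rep_L_Gm, nsBracketBasis,
    nsBracketBasis, map_smul, map_smul, neg_smul]

theorem rep_J_J (p q : ℕ) : rep (nsBracketBasis (J p) (J q)) =
    fld (polyBracket (0, -X ^ p, 0, 0) (0, -X ^ q, 0, 0)) := by
  rw [nsBracketBasis, map_smul, rep_e, show repBasis d = 0 from rfl, smul_zero]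
  rw [show polyBracket (0, -X ^ p, 0, 0) (0, -X ^ q, 0, 0) = 0 by
    apply poly4_ext <;> simp [polyBracket], map_zero]

theorem rep_J_Gp (p q : ℕ) : rep (nsBracketBasis (J p) (Gp q)) =
    fld (polyBracket (0, -X ^ p, 0, 0) (0, 0, -X ^ q, 0)) := by
  rw [nsBracketBasis, rep_e, ← Nat.cast_add, repBasis_Gp]
  congr 1
  apply poly4_ext <;> simp [polyBracket, pow_add]

theorem rep_Gp_J (p q : ℕ) : rep (nsBracketBasis (Gp q) (J p)) =
    fld (polyBracket (0, 0, -X ^ q, 0) (0, -X ^ p, 0, 0)) := by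
  rw [polyBracket_swap_of_even_left, map_neg, ← rep_J_Gp, nsBracketBasis, nsBracketBasis, map_neg]

theorem rep_J_Gm (p q : ℕ) : rep (nsBracketBasis (J p) (Gm q)) =
    fld (polyBracket (0, -X ^ p, 0, 0) (0, 0, 0, -X ^ q)) := by
  rw [nsBracketBasis, map_neg, rep_e, ← Nat.cast_add, repBasis_Gm, ← map_neg]
  congr 1
  apply poly4_ext <;> simp [polyBracket, pow_add]

theorem rep_Gm_J (p q : ℕ) : rep (nsBracketBasis (Gm q) (J p)) =
    fld (polyBracket (0, 0, 0, -X ^ q) (0, -X ^ p, 0, 0)) := by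
  rw [polyBracket_swap_of_even_left, map_neg, ← rep_J_Gm, nsBracketBasis, nsBracketBasis, map_neg,
    neg_neg]

theorem rep_Gp_Gp (p q : ℕ) : rep (nsBracketBasis (Gp p) (Gp q)) =
    fld (polyBracket (0, 0, -X ^ p, 0) (0, 0, -X ^ q, 0)) := by
  rw [nsBracketBasis, map_zero, show polyBracket (0, 0, -X ^ p, 0) (0, 0, -X ^ q, 0) = 0 by
    apply poly4_ext <;> simp [polyBracket], map_zero]

theorem rep_Gm_Gm (p q : ℕ) : rep (nsBracketBasis (Gm p) (Gm q)) =
    fld (polyBracket (0, 0, 0, -X ^ p) (0, 0, 0, -X ^ q)) := by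
  rw [nsBracketBasis, map_zero, show polyBracket (0, 0, 0, -X ^ p) (0, 0, 0, -X ^ q) = 0 by
    apply poly4_ext <;> simp [polyBracket], map_zero]

theorem rep_Gp_Gm (p q : ℕ) : rep (nsBracketBasis (Gp p) (Gm q)) =
    fld (polyBracket (0, 0, -X ^ p, 0) (0, 0, 0, -X ^ q)) := by
  have h1 := X_pow_mul_derivative p q
  have h2 := X_pow_mul_derivative q p
  rw [add_comm q p] at h2
  have h3 : C (1 / 2 : ℂ) * 2 = 1 := by
    rw [show (2 : ℂ[X]) = C 2 from rfl, ← C_mul, ← C_1]; congr 1; norm_num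
  have hJ := smul_repBasis_J ((p : ℂ) - q) p q (fun h => by
    obtain ⟨rfl, rfl⟩ := Nat.add_eq_zero_iff.mp h
    simp)
  have e1 : (p : ℤ) + q - 1 = ((p + q : ℕ) : ℤ) - 1 := by push_cast; ring
  have e2 : (p : ℤ) - 1 + q = ((p + q : ℕ) : ℤ) - 1 := by push_cast; ring
  rw [e2] at hJ
  rw [nsBracketBasis, map_add, map_add, map_smul, map_smul, map_smul, rep_e, rep_e, rep_e,
    show repBasis d = 0 from rfl, smul_zero, add_zero, e1, repBasis_L, Int.cast_natCast,
    Int.cast_natCast, hJ, ← map_smul, ← map_add]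
  congr 1
  apply poly4_ext
  · simp only [potL, polyBracket, Prod.fst_add, Prod.smul_fst, smul_eq_C_mul, map_zero, mul_zero,
      show (C 2 : ℂ[X]) = 2 from rfl]
    ring
  · simp only [potL, polyBracket, Prod.fst_add, Prod.snd_add, Prod.smul_fst, Prod.smul_snd,
      smul_eq_C_mul, map_zero, mul_zero, map_neg, map_sub, pow_add, derivative_mul,
      show (C 2 : ℂ[X]) = 2 from rfl]
    linear_combination (-(X ^ p * derivative (X ^ q) + X ^ q * derivative (X ^ p))) * h3 - h1 + h2
  · simp [potL, polyBracket]
  · simp [potL, polyBracket]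

theorem rep_Gm_Gp (p q : ℕ) : rep (nsBracketBasis (Gm q) (Gp p)) =
    fld (polyBracket (0, 0, 0, -X ^ q) (0, 0, -X ^ p, 0)) := by
  rw [show nsBracketBasis (Gm q) (Gp p) = nsBracketBasis (Gp p) (Gm q) from rfl, rep_Gp_Gm]
  congr 1
  apply poly4_ext <;> simp only [polyBracket, map_zero] <;> ring

theorem rep_nsBracketBasis {a b : NSBasis} (ha : IsPos a) (hb : IsPos b) :
    rep (nsBracketBasis a b) = VField.bracket (repBasis a) (repBasis b) := by
  cases ha with
  | L p => cases hb with
    | L q => rw [repBasis_L, repBasis_L, bracket_fld, rep_L_L]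
    | J q => rw [repBasis_L, repBasis_J, bracket_fld, rep_L_J]
    | Gp q => rw [repBasis_L, repBasis_Gp, bracket_fld, rep_L_Gp]
    | Gm q => rw [repBasis_L, repBasis_Gm, bracket_fld, rep_L_Gm]
  | J p => cases hb with
    | L q => rw [repBasis_L, repBasis_J, bracket_fld, rep_J_L]
    | J q => rw [repBasis_J, repBasis_J, bracket_fld, rep_J_J]
    | Gp q => rw [repBasis_J, repBasis_Gp, bracket_fld, rep_J_Gp]
    | Gm q => rw [repBasis_J, repBasis_Gm, bracket_fld, rep_J_Gm]
  | Gp p => cases hb with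
    | L q => rw [repBasis_L, repBasis_Gp, bracket_fld, rep_Gp_L]
    | J q => rw [repBasis_J, repBasis_Gp, bracket_fld, rep_Gp_J]
    | Gp q => rw [repBasis_Gp, repBasis_Gp, bracket_fld, rep_Gp_Gp]
    | Gm q => rw [repBasis_Gp, repBasis_Gm, bracket_fld, rep_Gp_Gm]
  | Gm p => cases hb with
    | L q => rw [repBasis_L, repBasis_Gm, bracket_fld, rep_Gm_L]
    | J q => rw [repBasis_J, repBasis_Gm, bracket_fld, rep_Gm_J]
    | Gp q => rw [repBasis_Gm, repBasis_Gp, bracket_fld, rep_Gm_Gp]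
    | Gm q => rw [repBasis_Gm, repBasis_Gm, bracket_fld, rep_Gm_Gm]

/-- Extension by bilinearity from the basis. It passes through potentials because the superbracket
involves `deriv`, which is additive only on differentiable functions. -/
theorem rep_nsBracket {u v : NS} (hu : u ∈ posSpan) (hv : v ∈ posSpan) :
    rep (nsBracket u v) = VField.bracket (rep u) (rep v) := by
  rw [nsBracket_eq]
  have zl : ∀ q, polyBracket 0 q = 0 := fun q => by simpa using polyBracket_smul_left 0 0 q
  have zr : ∀ q, polyBracket q 0 = 0 := fun q => by simpa using polyBracket_smul_right 0 q 0
  unfold posSpan at hu hv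
  induction hu, hv using Submodule.span_induction₂ with
  | mem_mem u v hu hv =>
    obtain ⟨a, ha, rfl⟩ := hu
    obtain ⟨b, hb, rfl⟩ := hv
    rw [nsBilin_e, rep_e, rep_e, rep_nsBracketBasis ha hb]
  | zero_left v hv =>
    obtain ⟨q, hq⟩ := rep_mem_range hv
    rw [map_zero, LinearMap.zero_apply, map_zero, hq, ← map_zero fld, bracket_fld, zl]
  | zero_right u hu =>
    obtain ⟨q, hq⟩ := rep_mem_range hu
    rw [map_zero, map_zero, hq, ← map_zero fld, bracket_fld, zr]
  | add_left u u' v hu hu' hv h1 h2 =>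
    obtain ⟨p, hp⟩ := rep_mem_range hu
    obtain ⟨p', hp'⟩ := rep_mem_range hu'
    obtain ⟨q, hq⟩ := rep_mem_range hv
    rw [map_add, LinearMap.add_apply, map_add, h1, h2, map_add, hp, hp', hq, ← map_add, bracket_fld,
      bracket_fld, bracket_fld, polyBracket_add_left, map_add]
  | add_right u v v' hu hv hv' h1 h2 =>
    obtain ⟨p, hp⟩ := rep_mem_range hu
    obtain ⟨q, hq⟩ := rep_mem_range hv
    obtain ⟨q', hq'⟩ := rep_mem_range hv'
    rw [map_add, map_add, h1, h2, map_add, hp, hq, hq', ← map_add, bracket_fld,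
      bracket_fld, bracket_fld, polyBracket_add_right, map_add]
  | smul_left c u v hu hv h =>
    obtain ⟨p, hp⟩ := rep_mem_range hu
    obtain ⟨q, hq⟩ := rep_mem_range hv
    rw [map_smul, LinearMap.smul_apply, map_smul, h, map_smul, hp, hq, ← map_smul, bracket_fld,
      bracket_fld, polyBracket_smul_left, map_smul]
  | smul_right c u v hu hv h =>
    obtain ⟨p, hp⟩ := rep_mem_range hu
    obtain ⟨q, hq⟩ := rep_mem_range hv
    rw [map_smul, map_smul, h, map_smul, hp, hq, ← map_smul, bracket_fld,
      bracket_fld, polyBracket_smul_right, map_smul]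

end NeveuSchwarz

/-! ### The generators -/

section Generators

open Polynomial NSBasis

/-- The cases in `oddSet` follow one rule, 0 ≤ k ≤ 1 - n for `Gp` and 0 ≤ k ≤ n + 1 for `Gm`, which
are the degree bounds of the odd potentials. -/
theorem mem_oddSet_Gp {n k : ℤ} : Gp k ∈ oddSet n ↔ 0 ≤ k ∧ k ≤ 1 - n := by
  unfold oddSet
  split_ifs <;> simp <;> omega

theorem mem_oddSet_Gm {n k : ℤ} : Gm k ∈ oddSet n ↔ 0 ≤ k ∧ k ≤ n + 1 := by
  unfold oddSet
  split_ifs <;> simp <;> omega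

theorem eq_of_mem_oddSet {n : ℤ} {b : NSBasis} (hb : b ∈ oddSet n) :
    (∃ k : ℕ, b = Gp k ∧ (k : ℤ) ≤ 1 - n) ∨ (∃ k : ℕ, b = Gm k ∧ (k : ℤ) ≤ n + 1) := by
  cases b with
  | Gp k =>
    obtain ⟨h1, h2⟩ := mem_oddSet_Gp.mp hb
    exact .inl ⟨k.toNat, by rw [Int.toNat_of_nonneg h1], by rwa [Int.toNat_of_nonneg h1]⟩
  | Gm k =>
    obtain ⟨h1, h2⟩ := mem_oddSet_Gm.mp hb
    exact .inr ⟨k.toNat, by rw [Int.toNat_of_nonneg h1], by rwa [Int.toNat_of_nonneg h1]⟩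
  | _ =>
    revert hb
    unfold oddSet
    split_ifs <;> simp

theorem card_oddSet (n : ℤ) : ((oddSet n).card : ℤ) = max 4 (|n| + 2) := by
  unfold oddSet
  split_ifs with h1 h2 h3 h4
  · subst h1; rfl
  · subst h2; rfl
  · subst h3; rfl
  · rw [Finset.card_image_of_injective _ (fun a b h => by simpa using h), Int.card_Icc,
      abs_of_nonneg (by omega)]
    omega
  · rw [Finset.card_image_of_injective _ (fun a b h => by simpa using h), Int.card_Icc,
      abs_of_nonpos (by omega)]
    omega

/-- The span of all the generators. -/
def genSpan (n : ℤ) : Submodule ℂ NS := evenSpan n ⊔ oddSpan n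

theorem genSpan_eq (n : ℤ) : genSpan n = Submodule.span ℂ (Set.range (gen n)) := by
  rw [genSpan, evenSpan, oddSpan, ← Submodule.span_union, gen, Set.Sum.elim_range]
  congr 2
  ext x
  simp

theorem evenGen_mem (n : ℤ) (i : Fin 4) : evenGen n i ∈ genSpan n :=
  Submodule.mem_sup_left (Submodule.subset_span ⟨i, rfl⟩)

theorem e_mem_genSpan {n : ℤ} {b : NSBasis} (hb : b ∈ oddSet n) : e b ∈ genSpan n :=
  Submodule.mem_sup_right (Submodule.subset_span ⟨b, hb, rfl⟩)

theorem e_L_zero_mem (n : ℤ) : e (L 0) ∈ genSpan n := by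
  have := (genSpan n).add_mem (evenGen_mem n 1) ((genSpan n).smul_mem ((n : ℂ) / 2) (evenGen_mem n 3))
  simpa [evenGen] using this

theorem smul_Gp_mem {n k : ℤ} {a : ℂ} (h : ¬ (0 ≤ k ∧ k ≤ 1 - n) → a = 0) :
    a • e (Gp k) ∈ genSpan n := by
  by_cases hk : 0 ≤ k ∧ k ≤ 1 - n
  · exact Submodule.smul_mem _ _ (e_mem_genSpan (mem_oddSet_Gp.mpr hk))
  · rw [h hk, zero_smul]
    exact Submodule.zero_mem _

theorem smul_Gm_mem {n k : ℤ} {a : ℂ} (h : ¬ (0 ≤ k ∧ k ≤ n + 1) → a = 0) :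
    a • e (Gm k) ∈ genSpan n := by
  by_cases hk : 0 ≤ k ∧ k ≤ n + 1
  · exact Submodule.smul_mem _ _ (e_mem_genSpan (mem_oddSet_Gm.mpr hk))
  · rw [h hk, zero_smul]
    exact Submodule.zero_mem _

/-- The lowering coefficient -k vanishes at k = 0 and the raising coefficient 1 - k - n at k = 1 -
n, so the range of `Gp` is stable. For `Gm` the raising coefficient vanishes at k = n + 1. -/
theorem nsBilin_evenGen_e_Gp (n : ℤ) (i : Fin 4) (k : ℤ) : nsBilin (evenGen n i) (e (Gp k)) =
    ![(-k : ℂ) • e (Gp (k - 1)), (1 / 2 - k - n / 2 : ℂ) • e (Gp k),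
      (1 - k - n : ℂ) • e (Gp (k + 1)), e (Gp k)] i := by
  have h1 : -1 + k = k - 1 := by ring
  have h2 : 1 + k = k + 1 := by ring
  fin_cases i <;>
    simp only [evenGen, nsBilin_e, nsBracketBasis, map_sub, map_smul, LinearMap.sub_apply,
      LinearMap.smul_apply, h1, h2, zero_add, Fin.zero_eta, Fin.mk_one, Fin.reduceFinMk,
      Matrix.cons_val] <;>
    (try push_cast) <;> module

theorem nsBilin_evenGen_e_Gm (n : ℤ) (i : Fin 4) (k : ℤ) : nsBilin (evenGen n i) (e (Gm k)) =
    ![(-k : ℂ) • e (Gm (k - 1)), (1 / 2 - k + n / 2 : ℂ) • e (Gm k),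
      (1 - k + n : ℂ) • e (Gm (k + 1)), -e (Gm k)] i := by
  have h1 : -1 + k = k - 1 := by ring
  have h2 : 1 + k = k + 1 := by ring
  fin_cases i <;>
    simp only [evenGen, nsBilin_e, nsBracketBasis, map_sub, map_smul, LinearMap.sub_apply,
      LinearMap.smul_apply, h1, h2, zero_add, Fin.zero_eta, Fin.mk_one, Fin.reduceFinMk,
      Matrix.cons_val] <;>
    (try push_cast) <;> module

/-- The relations of gl₂. No central term appears, as m³ - m vanishes for |m| ≤ 1 and no J-bracket
in the span has a nonzero index with sum zero. -/
theorem nsBilin_evenGen_evenGen (n : ℤ) (i j : Fin 4) : nsBilin (evenGen n i) (evenGen n j) =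
    ![![0, -evenGen n 0, (-2 : ℂ) • evenGen n 1, 0], ![evenGen n 0, 0, -evenGen n 2, 0],
      ![(2 : ℂ) • evenGen n 1, evenGen n 2, 0, 0], ![0, 0, 0, 0]] i j := by
  fin_cases i <;> fin_cases j <;>
    simp [evenGen, nsBilin_e, nsBracketBasis] <;> module

theorem nsBracketBasis_L_right (m : ℤ) (b : NSBasis) :
    nsBracketBasis b (L m) = -nsBracketBasis (L m) b := by
  cases b with
  | L k =>
    rw [nsBracketBasis, nsBracketBasis, add_comm k m]
    split_ifs with h
    · obtain rfl : k = -m := by omega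
      push_cast
      module
    · module
  | d => simp [nsBracketBasis]
  | J k => simp [nsBracketBasis]
  | _ => rw [nsBracketBasis, nsBracketBasis, neg_smul]

theorem nsBracketBasis_J_right (m : ℤ) (b : NSBasis) :
    nsBracketBasis b (J m) = -nsBracketBasis (J m) b := by
  cases b with
  | J k =>
    rw [nsBracketBasis, nsBracketBasis, add_comm k m]
    split_ifs with h
    · obtain rfl : k = -m := by omega
      push_cast
      module
    · module
  | _ => simp [nsBracketBasis]

theorem nsBilin_swap {b : NSBasis} (h : ∀ a, nsBracketBasis a b = -nsBracketBasis b a) (v : NS) :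
    nsBilin v (e b) = -nsBilin (e b) v := by
  induction v using Finsupp.induction_linear with
  | zero => simp
  | add u v h1 h2 => rw [map_add, map_add, LinearMap.add_apply, h1, h2, neg_add]
  | single a c =>
    have : Finsupp.single a c = c • e a := by simp [e]
    rw [this, map_smul, map_smul, LinearMap.smul_apply, nsBilin_e, nsBilin_e, h, smul_neg]

theorem nsBilin_evenGen_right (n : ℤ) (i : Fin 4) (v : NS) :
    nsBilin v (evenGen n i) = -nsBilin (evenGen n i) v := by
  have hL := fun m => nsBilin_swap (nsBracketBasis_L_right m) v
  have hJ := fun m => nsBilin_swap (nsBracketBasis_J_right m) v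
  fin_cases i <;> simp [evenGen, hL, hJ] <;> module

theorem nsBilin_evenGen_mem (n : ℤ) (i : Fin 4) {v : NS} (hv : v ∈ genSpan n) :
    nsBilin (evenGen n i) v ∈ genSpan n := by
  rw [genSpan_eq] at hv
  induction hv using Submodule.span_induction with
  | mem v hv =>
    obtain ⟨j | ⟨b, hb⟩, rfl⟩ := hv
    · change nsBilin (evenGen n i) (evenGen n j) ∈ _
      rw [nsBilin_evenGen_evenGen]
      have h := evenGen_mem n
      have h0 := (genSpan n).zero_mem
      have h2 := fun c i => (genSpan n).smul_mem c (h i)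
      have h3 := fun i => (genSpan n).neg_mem (h i)
      fin_cases i <;> fin_cases j <;>
        first | exact h0 | exact h 0 | exact h 2 | exact h3 0 | exact h3 2 | exact h2 _ 1
    · change nsBilin (evenGen n i) (e b) ∈ _
      obtain ⟨k, rfl, hk⟩ | ⟨k, rfl, hk⟩ := eq_of_mem_oddSet hb
      · rw [nsBilin_evenGen_e_Gp]
        fin_cases i
        · refine smul_Gp_mem fun h => ?_
          obtain rfl : k = 0 := by omega
          simp
        · exact Submodule.smul_mem _ _ (e_mem_genSpan hb)
        · refine smul_Gp_mem fun h => ?_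
          obtain rfl : n = 1 - k := by omega
          simp
        · exact e_mem_genSpan hb
      · rw [nsBilin_evenGen_e_Gm]
        fin_cases i
        · refine smul_Gm_mem fun h => ?_
          obtain rfl : k = 0 := by omega
          simp
        · exact Submodule.smul_mem _ _ (e_mem_genSpan hb)
        · refine smul_Gm_mem fun h => ?_
          obtain rfl : n = k - 1 := by omega
          simp
        · exact Submodule.neg_mem _ (e_mem_genSpan hb)
  | zero => rw [map_zero]; exact Submodule.zero_mem _
  | add u v _ _ h1 h2 => rw [map_add]; exact Submodule.add_mem _ h1 h2
  | smul c v _ h => rw [map_smul]; exact Submodule.smul_mem _ _ h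

/-- The bounds force k + l ≤ 2. For k + l = 2 both are attained, and the coefficient k - l = -2n of
J₁ is the one in 2(L₁ - nJ₁). The central term occurs only for k + l = 1, where k² = k. -/
theorem nsBracketBasis_Gp_Gm_mem {n : ℤ} {k l : ℕ} (hk : (k : ℤ) ≤ 1 - n) (hl : (l : ℤ) ≤ n + 1) :
    nsBracketBasis (Gp k) (Gm l) ∈ genSpan n := by
  have h := evenGen_mem n
  have hkl : k + l = 0 ∨ (k = 0 ∧ l = 1) ∨ (k = 1 ∧ l = 0) ∨ k + l = 2 := by omega
  obtain h0 | ⟨rfl, rfl⟩ | ⟨rfl, rfl⟩ | h2 := hkl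
  · obtain ⟨rfl, rfl⟩ := Nat.add_eq_zero_iff.mp h0
    have : nsBracketBasis (Gp (0 : ℕ)) (Gm (0 : ℕ)) = (2 : ℂ) • evenGen n 0 := by
      simp [nsBracketBasis, evenGen]
    rw [this]
    exact Submodule.smul_mem _ _ (h 0)
  · have : nsBracketBasis (Gp (0 : ℕ)) (Gm (1 : ℕ)) = (2 : ℂ) • e (L 0) - evenGen n 3 := by
      simp [nsBracketBasis, evenGen]
      module
    rw [this]
    exact Submodule.sub_mem _ (Submodule.smul_mem _ _ (e_L_zero_mem n)) (h 3)
  · have : nsBracketBasis (Gp (1 : ℕ)) (Gm (0 : ℕ)) = (2 : ℂ) • e (L 0) + evenGen n 3 := by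
      simp [nsBracketBasis, evenGen]
    rw [this]
    exact Submodule.add_mem _ (Submodule.smul_mem _ _ (e_L_zero_mem n)) (h 3)
  · have hk' : (k : ℤ) = 1 - n := by omega
    have hl' : (l : ℤ) = n + 1 := by omega
    have : nsBracketBasis (Gp k) (Gm l) = (2 : ℂ) • evenGen n 2 := by
      rw [hk', hl']
      simp only [nsBracketBasis, evenGen, Matrix.cons_val, show 1 - n + (n + 1) = 2 by ring,
        show (2 : ℤ) - 1 = 1 by norm_num, show ¬ ((2 : ℤ) = 1) by norm_num, if_false]
      push_cast
      module
    rw [this]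
    exact Submodule.smul_mem _ _ (h 2)

theorem nsBracket_mem_genSpan (n : ℤ) {u v : NS} (hu : u ∈ genSpan n) (hv : v ∈ genSpan n) :
    nsBracket u v ∈ genSpan n := by
  have hgen : ∀ i, gen n i ∈ genSpan n := fun i => by
    rw [genSpan_eq]; exact Submodule.subset_span ⟨i, rfl⟩
  rw [nsBracket_eq]
  rw [genSpan_eq] at hu hv
  induction hu, hv using Submodule.span_induction₂ with
  | mem_mem u v hu hv =>
    obtain ⟨i | ⟨a, ha⟩, rfl⟩ := hu
    · obtain ⟨j, rfl⟩ := hv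
      exact nsBilin_evenGen_mem n i (hgen j)
    · obtain ⟨j | ⟨b, hb⟩, rfl⟩ := hv
      · change nsBilin _ (evenGen n j) ∈ _
        rw [nsBilin_evenGen_right]
        exact Submodule.neg_mem _ (nsBilin_evenGen_mem n j (hgen (.inr ⟨a, ha⟩)))
      · change nsBilin (e a) (e b) ∈ _
        rw [nsBilin_e]
        obtain ⟨k, rfl, hk⟩ | ⟨k, rfl, hk⟩ := eq_of_mem_oddSet ha <;>
          obtain ⟨l, rfl, hl⟩ | ⟨l, rfl, hl⟩ := eq_of_mem_oddSet hb
        · exact Submodule.zero_mem _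
        · exact nsBracketBasis_Gp_Gm_mem hk hl
        · exact nsBracketBasis_Gp_Gm_mem hl hk
        · exact Submodule.zero_mem _
  | zero_left v hv => simp
  | zero_right u hu => simp
  | add_left u u' v hu hu' hv h1 h2 =>
    rw [map_add, LinearMap.add_apply]; exact Submodule.add_mem _ h1 h2
  | add_right u v v' hu hv hv' h1 h2 => rw [map_add]; exact Submodule.add_mem _ h1 h2
  | smul_left c u v hu hv h =>
    rw [map_smul, LinearMap.smul_apply]; exact Submodule.smul_mem _ _ h
  | smul_right c u v hu hv h => rw [map_smul]; exact Submodule.smul_mem _ _ h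

theorem e_mem_posSpan {b : NSBasis} (hb : IsPos b) : e b ∈ posSpan :=
  Submodule.subset_span ⟨b, hb, rfl⟩

theorem genSpan_le_posSpan (n : ℤ) : genSpan n ≤ posSpan := by
  have h0 : e (L (-1)) ∈ posSpan := e_mem_posSpan (IsPos.L 0)
  have h1 : e (L 0) ∈ posSpan := e_mem_posSpan (IsPos.L 1)
  have h2 : e (L 1) ∈ posSpan := e_mem_posSpan (IsPos.L 2)
  have h3 : e (J 0) ∈ posSpan := e_mem_posSpan (IsPos.J 0)
  have h4 : e (J 1) ∈ posSpan := e_mem_posSpan (IsPos.J 1)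
  rw [genSpan_eq, Submodule.span_le]
  rintro _ ⟨i | ⟨b, hb⟩, rfl⟩
  · fin_cases i
    · exact h0
    · exact Submodule.sub_mem _ h1 (Submodule.smul_mem _ _ h3)
    · exact Submodule.sub_mem _ h2 (Submodule.smul_mem _ _ h4)
    · exact h3
  · obtain ⟨k, rfl, hk⟩ | ⟨k, rfl, hk⟩ := eq_of_mem_oddSet hb
    · exact e_mem_posSpan (IsPos.Gp k)
    · exact e_mem_posSpan (IsPos.Gm k)

/-! ### Linear independence, injectivity and dimensions -/

/-- The potentials of the generators. -/
def genPot (n : ℤ) : Fin 4 ⊕ {b // b ∈ oddSet n} → Poly4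
  | .inl i => ![(-1, 0, 0, 0), (-X, -C ((1 - n : ℂ) / 2), 0, 0), (-X ^ 2, -(C (1 - n : ℂ) * X), 0, 0),
      (0, -1, 0, 0)] i
  | .inr ⟨Gp k, _⟩ => (0, 0, -X ^ k.toNat, 0)
  | .inr ⟨Gm k, _⟩ => (0, 0, 0, -X ^ k.toNat)
  | .inr _ => 0

theorem rep_gen (n : ℤ) (i : Fin 4 ⊕ {b // b ∈ oddSet n}) : rep (gen n i) = fld (genPot n i) := by
  have h0 : repBasis (L (-1)) = _ := repBasis_L 0
  have h1 : repBasis (L 0) = _ := repBasis_L 1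
  have h2 : repBasis (L 1) = _ := repBasis_L 2
  have h3 : repBasis (J 0) = _ := repBasis_J 0
  have h4 : repBasis (J 1) = _ := repBasis_J 1
  rcases i with i | ⟨b, hb⟩
  · fin_cases i
    · change rep (e (L (-1))) = _
      rw [rep_e, h0]
      congr 1
      apply poly4_ext <;> simp [genPot, potL]
    · change rep (e (L 0) - ((n : ℂ) / 2) • e (J 0)) = _
      rw [map_sub, map_smul, rep_e, rep_e, h1, h3, ← map_smul, ← map_sub]
      congr 1
      apply poly4_ext
      · simp [genPot, potL]
      · simp only [genPot, potL, Prod.fst_sub, Prod.snd_sub, Prod.smul_fst, Prod.smul_snd,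
          smul_eq_C_mul, Fin.mk_one, Matrix.cons_val, pow_one, derivative_X, pow_zero, sub_div,
          C_sub]
        ring
      · simp [genPot, potL]
      · simp [genPot, potL]
    · change rep (e (L 1) - (n : ℂ) • e (J 1)) = _
      rw [map_sub, map_smul, rep_e, rep_e, h2, h4, ← map_smul, ← map_sub]
      congr 1
      have hC : C (1 / 2 : ℂ) * C 2 = 1 := by rw [← C_mul, ← C_1]; congr 1; norm_num
      apply poly4_ext
      · simp [genPot, potL]
      · simp only [genPot, potL, Prod.fst_sub, Prod.snd_sub, Prod.smul_fst, Prod.smul_snd,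
          smul_eq_C_mul, Fin.reduceFinMk, Matrix.cons_val, pow_one, derivative_X_pow, C_sub, C_1]
        norm_num only
        linear_combination -X * hC
      · simp [genPot, potL]
      · simp [genPot, potL]
    · change rep (e (J 0)) = _
      rw [rep_e, h3]
      congr 1
  · change rep (e b) = _
    rw [rep_e]
    obtain ⟨k, rfl, hk⟩ | ⟨k, rfl, hk⟩ := eq_of_mem_oddSet hb
    · exact repBasis_Gp k
    · exact repBasis_Gm k

/-- Functionals dual to the potentials of the generators. -/
def genDual (n : ℤ) : Fin 4 ⊕ {b // b ∈ oddSet n} → Module.Dual ℂ Poly4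
  | .inl i => ![-lcoeff ℂ 0 ∘ₗ LinearMap.fst ℂ _ _, -lcoeff ℂ 1 ∘ₗ LinearMap.fst ℂ _ _,
      -lcoeff ℂ 2 ∘ₗ LinearMap.fst ℂ _ _,
      -- The second summand cancels the even potential `g` carried by L₀ - (n/2)J₀.
      -lcoeff ℂ 0 ∘ₗ LinearMap.fst ℂ _ _ ∘ₗ LinearMap.snd ℂ _ _ +
        ((1 - n : ℂ) / 2) • lcoeff ℂ 1 ∘ₗ LinearMap.fst ℂ _ _] i
  | .inr ⟨Gp k, _⟩ =>
    -lcoeff ℂ k.toNat ∘ₗ LinearMap.fst ℂ _ _ ∘ₗ LinearMap.snd ℂ _ _ ∘ₗ LinearMap.snd ℂ _ _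
  | .inr ⟨Gm k, _⟩ =>
    -lcoeff ℂ k.toNat ∘ₗ LinearMap.snd ℂ _ _ ∘ₗ LinearMap.snd ℂ _ _ ∘ₗ LinearMap.snd ℂ _ _
  | .inr _ => 0

theorem genDual_self (n : ℤ) (i : Fin 4 ⊕ {b // b ∈ oddSet n}) : genDual n i (genPot n i) = 1 := by
  rcases i with i | ⟨b, hb⟩
  · fin_cases i <;> simp [genDual, genPot]
  · obtain ⟨k, rfl, hk⟩ | ⟨k, rfl, hk⟩ := eq_of_mem_oddSet hb <;> simp [genDual, genPot]

theorem genDual_of_ne (n : ℤ) {i j : Fin 4 ⊕ {b // b ∈ oddSet n}} (h : i ≠ j) :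
    genDual n i (genPot n j) = 0 := by
  rcases i with i | ⟨b, hb⟩ <;> rcases j with j | ⟨b', hb'⟩
  · fin_cases i <;> fin_cases j <;>
      first
      | exact absurd rfl h
      | simp [genDual, genPot, coeff_X, coeff_one, coeff_C]
  · obtain ⟨k, rfl, hk⟩ | ⟨k, rfl, hk⟩ := eq_of_mem_oddSet hb' <;> fin_cases i <;>
      simp [genDual, genPot]
  · obtain ⟨k, rfl, hk⟩ | ⟨k, rfl, hk⟩ := eq_of_mem_oddSet hb <;> fin_cases j <;>
      simp [genDual, genPot]
  · obtain ⟨k, rfl, hk⟩ | ⟨k, rfl, hk⟩ := eq_of_mem_oddSet hb <;>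
      obtain ⟨l, rfl, hl⟩ | ⟨l, rfl, hl⟩ := eq_of_mem_oddSet hb'
    all_goals
      simp [genDual, genPot, coeff_X_pow]
      try
        rintro rfl
        exact h rfl

theorem linearIndependent_genPot (n : ℤ) : LinearIndependent ℂ (genPot n) :=
  LinearIndependent.of_pairwise_dual_eq_zero_one _ (genDual n) (fun _ _ h => genDual_of_ne n h)
    (genDual_self n)

theorem linearIndependent_rep_gen (n : ℤ) : LinearIndependent ℂ fun i => rep (gen n i) := by
  simp only [rep_gen]
  exact (linearIndependent_genPot n).map' fld (LinearMap.ker_eq_bot.mpr fld_injective)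

/-- The images of the generators are independent, so their span meets the kernel only in zero. -/
theorem injOn_rep (n : ℤ) : Set.InjOn rep (genSpan n) := by
  have h : Disjoint (Submodule.span ℂ (Set.range (gen n))) (LinearMap.ker rep) :=
    Submodule.range_ker_disjoint (linearIndependent_rep_gen n)
  rw [← genSpan_eq] at h
  exact LinearMap.injOn_of_disjoint_ker le_rfl h

theorem map_rep_evenSpan (n : ℤ) :
    (evenSpan n).map rep = Submodule.span ℂ (Set.range fun i => rep (gen n (.inl i))) := by
  rw [evenSpan, Submodule.map_span, ← Set.range_comp]
  rfl

theorem map_rep_oddSpan (n : ℤ) :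
    (oddSpan n).map rep = Submodule.span ℂ (Set.range fun i => rep (gen n (.inr i))) := by
  rw [oddSpan, Submodule.map_span, ← Set.image_comp]
  congr 1
  ext x
  simp [gen]

theorem finrank_map_evenSpan (n : ℤ) : Module.finrank ℂ ((evenSpan n).map rep) = 4 := by
  rw [map_rep_evenSpan, finrank_span_eq_card (b := fun i => rep (gen n (.inl i)))
    ((linearIndependent_rep_gen n).comp Sum.inl Sum.inl_injective), Fintype.card_fin]

theorem finrank_map_oddSpan (n : ℤ) :
    (Module.finrank ℂ ((oddSpan n).map rep) : ℤ) = max 4 (|n| + 2) := by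
  rw [map_rep_oddSpan, finrank_span_eq_card (b := fun i => rep (gen n (.inr i)))
    ((linearIndependent_rep_gen n).comp Sum.inr Sum.inr_injective), Fintype.card_coe, card_oddSet]

/-- The even potentials of infinitesimal automorphisms. -/
def evenPot (n : ℤ) (a b d e : ℂ) : Poly4 :=
  (C a + C b * X + C d * X ^ 2, C e + C ((1 - n) * d) * X, 0, 0)

theorem mem_map_evenSpan {n : ℤ} {Y : VField} :
    Y ∈ (evenSpan n).map rep ↔ ∃ a b d e, Y = fld (evenPot n a b d e) := by
  rw [map_rep_evenSpan, Submodule.mem_span_range_iff_exists_fun]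
  have key : ∀ c : Fin 4 → ℂ, ∑ i, c i • rep (gen n (.inl i)) =
      fld (evenPot n (-c 0) (-c 1) (-c 2) (-((1 - n) / 2 * c 1) - c 3)) := fun c => by
    simp only [rep_gen, ← map_smul, ← map_sum, Fin.sum_univ_four]
    congr 1
    apply poly4_ext
    · simp only [genPot, evenPot, Matrix.cons_val, Prod.fst_add, Prod.smul_fst, smul_eq_C_mul, C_neg]
      ring
    · simp only [genPot, evenPot, Matrix.cons_val, Prod.fst_add, Prod.snd_add, Prod.smul_fst,
        Prod.smul_snd, smul_eq_C_mul, C_neg, C_sub, C_mul, mul_neg]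
      ring
    · simp [genPot, evenPot]
    · simp [genPot, evenPot]
  constructor
  · rintro ⟨c, rfl⟩
    exact ⟨_, _, _, _, key c⟩
  · rintro ⟨a, b, d, e, rfl⟩
    refine ⟨![-a, -b, -d, (1 - n) / 2 * b - e], ?_⟩
    rw [key]
    congr 2 <;> simp

theorem mem_map_oddSpan {n : ℤ} {Y : VField} :
    Y ∈ (oddSpan n).map rep ↔ ∃ a b : ℂ[X], (∀ k ∈ a.support, (k : ℤ) ≤ 1 - n) ∧
      (∀ k ∈ b.support, (k : ℤ) ≤ n + 1) ∧ Y = fld (0, 0, a, b) := by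
  constructor
  · intro hY
    rw [map_rep_oddSpan] at hY
    induction hY using Submodule.span_induction with
    | mem Y hY =>
      obtain ⟨⟨b, hb⟩, rfl⟩ := hY
      obtain ⟨k, rfl, hk⟩ | ⟨k, rfl, hk⟩ := eq_of_mem_oddSet hb
      · refine ⟨-X ^ k, 0, ?_, by simp, rep_gen n _⟩
        simp [coeff_X_pow, hk]
      · refine ⟨0, -X ^ k, by simp, ?_, rep_gen n _⟩
        simp [coeff_X_pow, hk]
    | zero => exact ⟨0, 0, by simp, by simp, (map_zero fld).symm⟩
    | add Y Y' _ _ h h' =>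
      obtain ⟨a, b, ha, hb, rfl⟩ := h
      obtain ⟨a', b', ha', hb', rfl⟩ := h'
      refine ⟨a + a', b + b', fun k hk => ?_, fun k hk => ?_, ?_⟩
      · exact (Finset.mem_union.mp (support_add hk)).elim (ha k) (ha' k)
      · exact (Finset.mem_union.mp (support_add hk)).elim (hb k) (hb' k)
      · rw [← map_add]
        congr 1
        simp
    | smul c Y _ h =>
      obtain ⟨a, b, ha, hb, rfl⟩ := h
      refine ⟨c • a, c • b, fun k hk => ha k (support_smul c a hk),
        fun k hk => hb k (support_smul c b hk), ?_⟩
      rw [← map_smul]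
      congr 1
      simp
  · rintro ⟨a, b, ha, hb, rfl⟩
    have h1 : ∀ k ∈ a.support, fld (0, 0, X ^ k, 0) ∈ (oddSpan n).map rep := fun k hk => by
      have : fld (0, 0, X ^ k, 0) = rep (-e (Gp k)) := by
        rw [map_neg, rep_e, repBasis_Gp, ← map_neg]
        congr 1
        simp
      rw [this]
      exact Submodule.mem_map_of_mem (Submodule.neg_mem _ (Submodule.subset_span
        ⟨_, mem_oddSet_Gp.mpr ⟨by omega, ha k hk⟩, rfl⟩))
    have h2 : ∀ k ∈ b.support, fld (0, 0, 0, X ^ k) ∈ (oddSpan n).map rep := fun k hk => by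
      have : fld (0, 0, 0, X ^ k) = rep (-e (Gm k)) := by
        rw [map_neg, rep_e, repBasis_Gm, ← map_neg]
        congr 1
        simp
      rw [this]
      exact Submodule.mem_map_of_mem (Submodule.neg_mem _ (Submodule.subset_span
        ⟨_, mem_oddSet_Gm.mpr ⟨by omega, hb k hk⟩, rfl⟩))
    have h3 : ((0, 0, a, b) : Poly4) = ∑ k ∈ a.support, a.coeff k • ((0, 0, X ^ k, 0) : Poly4) +
        ∑ k ∈ b.support, b.coeff k • ((0, 0, 0, X ^ k) : Poly4) := by
      have s : ∀ p : ℂ[X], ∑ k ∈ p.support, p.coeff k • (X ^ k : ℂ[X]) = p := fun p => by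
        conv_rhs => rw [p.as_sum_support_C_mul_X_pow]
        simp only [smul_eq_C_mul]
      apply poly4_ext <;> simp [Prod.fst_sum, Prod.snd_sum, s]
    rw [h3, map_add, map_sum, map_sum]
    refine Submodule.add_mem _ (Submodule.sum_mem _ fun k hk => ?_)
      (Submodule.sum_mem _ fun k hk => ?_)
    · rw [map_smul]
      exact Submodule.smul_mem _ _ (h1 k hk)
    · rw [map_smul]
      exact Submodule.smul_mem _ _ (h2 k hk)

end Generators

/-! ### Infinitesimal automorphisms -/

section InfinitesimalAutomorphisms

open Polynomial

variable {N : ℕ∞} {n : ℤ}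

theorem extE_evalFn (q : ℂ[X]) (z : evenPart N) : extE (evalFn q) z = aeval z q := by
  have han : ∀ (q : ℂ[X]) (x : ℂ), AnalyticAt ℂ (evalFn q) x := fun q x =>
    q.differentiable.analyticAt x
  induction q using Polynomial.induction_on' with
  | add p q hp hq => rw [map_add, map_add, extE_add (han _ _) (han _ _), hp, hq]
  | monomial k a =>
    induction k with
    | zero =>
      have : evalFn (monomial 0 a) = fun _ => a := by
        funext x
        simp [evalFn_apply]
      rw [this, extE_const, monomial_zero_left, aeval_C]
    | succ k ih =>
      have hX : evalFn X = fun x => x := by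
        funext x
        simp [evalFn_apply]
      rw [← monomial_mul_X, evalFn_mul, extE_mul (han _ _) (han _ _), ih, hX, extE_id, map_mul,
        aeval_X]

theorem eval_fld (q : Poly4) (i : Fin 3) (p : Point N) : (fld q i).eval p =
    ev4 (fun k => ((aeval p.z (polyField q i k) : evenPart N) : Grassmann N)) p := by
  have key : ∀ k, Comp.eval (Finsupp.single (∅ : Finset (Gen N)) (fld q i k)) (p.1 0) =
      ((aeval p.z (polyField q i k) : evenPart N) : Grassmann N) := fun k => by
    rw [Comp.eval, Finsupp.sum_single_index (by rw [ext_zero, zero_mul]), zeta_empty, mul_one,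
      ← extE_evalFn]
    rfl
  rw [CFn.eval, SuperFn.eval, key, key, key, key]
  rfl

theorem isTangent_fld_evenPot {c : Grassmann N} (hc : c ∈ grPart N 2 0) (a b d e : ℂ) :
    IsTangent N n fun i p => c * (fld (evenPot n a b d e) i).eval p := by
  refine isTangent_of_even n hc a b d e _ (fun p => ?_) (fun p => ?_) (fun p => ?_) <;>
    rw [eval_fld] <;>
    simp only [ev4, polyField, evenPot, Matrix.cons_val, map_zero, neg_zero, ZeroMemClass.coe_zero,
      mul_zero, add_zero, zero_add, mul_coe_even]
  · simp [cst]
  · simp [cst]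
  · congr 2
    simp [cst]
    ring

/-- Moving c to the right past θ⁺ and θ⁻ turns the components of the field into `oddVel`; this fixes
the signs of the odd potentials in `polyField`. -/
theorem isTangent_fld_oddPot {c : Grassmann N} (hc : c ∈ grPart N 2 1) {a b : ℂ[X]}
    (ha : ∀ k ∈ a.support, (k : ℤ) ≤ 1 - n) (hb : ∀ k ∈ b.support, (k : ℤ) ≤ n + 1) :
    IsTangent N n fun i p => c * (fld (0, 0, a, b) i).eval p := by
  refine isTangent_of_odd n hc ha hb _ fun i p => ?_
  have h1 : c * p.1 1 = -(p.1 1 * c) := odd_mul_odd (grPart_le_zero 1 hc) p.2.2.1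
  have h2 : c * p.1 2 = -(p.1 2 * c) := odd_mul_odd (grPart_le_zero 1 hc) p.2.2.2
  have h3 : c * (p.1 1 * p.1 2) = p.1 1 * p.1 2 * c := by
    rw [← mul_assoc, h1, neg_mul, mul_assoc, h2, mul_neg, neg_neg, mul_assoc]
  rw [eval_fld]
  fin_cases i <;>
    simp only [ev4, polyField, oddVel, Fin.zero_eta, Fin.mk_one, Fin.reduceFinMk, Matrix.cons_val,
      map_zero, map_neg, neg_zero, sub_zero, ZeroMemClass.coe_zero, mul_zero, add_zero, zero_add,
      derivative_zero, mul_add, ← mul_assoc, NegMemClass.coe_neg, mul_neg, neg_smul, smul_neg,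
      mul_coe_even, h1, h2, h3, neg_neg, mul_smul_comm]

theorem fld_mem_infAut (a b d e : ℂ) {g h : ℂ[X]} (hg : ∀ k ∈ g.support, (k : ℤ) ≤ 1 - n)
    (hh : ∀ k ∈ h.support, (k : ℤ) ≤ n + 1) :
    fld (evenPot n a b d e + (0, 0, g, h)) ∈ infAut N n := by
  refine ⟨fun i k => ?_, fun j c hc => ?_⟩
  · rw [fld_apply]
    exact Polynomial.differentiable _
  · obtain rfl | rfl : j = 0 ∨ j = 1 := by
      clear hc
      revert j
      decide
    · rw [part_zero_fld]
      convert isTangent_fld_evenPot (n := n) hc a b d e using 6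
      simp [evenPot]
    · rw [part_one_fld]
      convert isTangent_fld_oddPot (n := n) hc hg hh using 6
      simp [evenPot]

theorem part_apply_eq_zero (X : VField) {j : ZMod 2} {i : Fin 3} {k : Fin 4}
    (h : compParity k ≠ j + coordParity i) : X.part j i k = 0 := by
  rw [VField.part, if_neg h]

theorem part_zero_add_part_one (X : VField) : X.part 0 + X.part 1 = X := by
  funext i k
  rw [Pi.add_apply, Pi.add_apply, VField.part, VField.part]
  fin_cases i <;> fin_cases k <;>
    simp [compParity, coordParity, show (1 : ZMod 2) + 1 = 0 by decide]

theorem differentiable_part {X : VField} (hX : ∀ i k, Differentiable ℂ (X i k)) (j : ZMod 2)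
    (i : Fin 3) (k : Fin 4) : Differentiable ℂ (X.part j i k) := by
  rw [VField.part]
  split_ifs
  · exact hX i k
  · exact differentiable_const 0

/-- Regularity at the pole bounds the degree of f by 2 and determines g up to a constant; the
linearized equations then give all other components. -/
theorem part_zero_mem_of_mem_infAut (hN : 1 < N) {V : VField} (hV : V ∈ infAut N n) :
    V.part 0 ∈ (evenSpan n).map rep := by
  rw [mem_map_evenSpan]
  have hd := differentiable_part hV.1 0
  obtain ⟨h, Z₀, Z₁, hZ₀, hZ₁, hZ⟩ := (hV.2 0 1 one_mem_grPart).even_conditions hN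
  have hpar : ∀ {i : Fin 3} {k : Fin 4}, compParity k ≠ 0 + coordParity i → V.part 0 i k = 0 :=
    part_apply_eq_zero V
  set Y := V.part 0
  obtain ⟨f, hf, hf'⟩ := exists_polynomial_of_growth_int 2 (hd 0 0) hZ₀
    (hZ.mono fun w hw => by exact_mod_cast hw.1)
  have hfe : f = C (f.coeff 0) + C (f.coeff 1) * X + C (f.coeff 2) * X ^ 2 := by
    have : f.natDegree ≤ 2 := natDegree_le_iff_coeff_eq_zero.mpr fun k hk => by
      by_contra h0
      have := hf k (mem_support_iff.mpr h0)
      omega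
    ext k
    rcases k with _ | _ | _ | k
    · simp
    · simp [coeff_X, coeff_C]
    · simp [coeff_X, coeff_C]
    · rw [coeff_eq_zero_of_natDegree_lt (by omega)]
      simp [coeff_X, coeff_C, coeff_X_pow]
  set a := f.coeff 0
  set b := f.coeff 1
  set d := f.coeff 2
  have hY00 : ∀ z, Y 0 0 z = a + b * z + d * z ^ 2 := fun z => by
    rw [hf', hfe]
    simp
  -- Subtracting (1-n)dz removes the pole of (n-1)w f(1/w) at w = 0; the rest is bounded, hence
  -- constant.
  obtain ⟨g, hg, hg'⟩ := exists_polynomial_of_growth_int (f := fun z => Y 1 1 z - (1 - n) * d * z)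
    (Z := fun w => Z₁ w - (n - 1) * (w * a + b)) 0
    ((hd 1 1).sub ((differentiable_const _).mul differentiable_id)) (by fun_prop) (by
      filter_upwards [hZ, self_mem_nhdsWithin] with w hw hw0
      rw [← hw.2, hY00]
      have : w ≠ 0 := hw0
      field_simp
      ring)
  have hge : g = C (g.coeff 0) := by
    refine eq_C_of_natDegree_eq_zero (Nat.le_zero.mp ?_)
    refine natDegree_le_iff_coeff_eq_zero.mpr fun k hk => ?_
    by_contra h0
    have := hg k (mem_support_iff.mpr h0)
    omega
  have hY11 : ∀ z, Y 1 1 z = g.coeff 0 + (1 - n) * d * z := fun z => by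
    have := congrFun hg' z
    rw [hge, eval_C] at this
    linear_combination this
  have hdf : ∀ z, deriv (Y 0 0) z = (derivative f).eval z := fun z => by
    rw [hf']
    exact f.deriv
  have hfd : ∀ z, (derivative f).eval z = b + 2 * d * z := fun z => by
    rw [hfe]
    simp
    ring
  refine ⟨a, b, d, g.coeff 0, ?_⟩
  funext i k z
  obtain ⟨h21, h12, h3, h4⟩ := h z
  rw [hdf, hfd] at h3 h4
  rw [hY11] at h3 h4
  rw [fld_apply, evalFn_apply]
  -- Difference and sum of the two body equations.
  have hY03 : Y 0 3 z = 0 := by linear_combination (h3 - h4) / 2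
  have hY22 : Y 2 2 z = b + 2 * d * z - (g.coeff 0 + (1 - n) * d * z) := by
    linear_combination -(h3 + h4) / 2
  have p01 : Y 0 1 = 0 := hpar (by decide)
  have p02 : Y 0 2 = 0 := hpar (by decide)
  have p10 : Y 1 0 = 0 := hpar (by decide)
  have p13 : Y 1 3 = 0 := hpar (by decide)
  have p20 : Y 2 0 = 0 := hpar (by decide)
  have p23 : Y 2 3 = 0 := hpar (by decide)
  fin_cases i <;> fin_cases k <;>
    simp [polyField, evenPot, hY00, hY11, hY03, hY22, p01, p02, p10, p13, p20, p23, h21, h12]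
  ring

theorem isLow_singleton_zero (hN : 2 < N) :
    IsLow (N := N) 2 {⟨0, lt_of_le_of_lt (by simp) hN⟩} := by
  intro k hk
  obtain rfl := Finset.mem_singleton.mp hk
  simpa using hN

/-- With N ≥ 3 the first generator is an admissible odd constant. The growth conditions bound the
degrees of a and b, and the linear equations express the remaining components through them. -/
theorem part_one_mem_of_mem_infAut (hN : 2 < N) {X : VField} (hX : X ∈ infAut N n) :
    X.part 1 ∈ (oddSpan n).map rep := by
  rw [mem_map_oddSpan]
  have hlow := isLow_singleton_zero hN
  have hd := differentiable_part hX.1 1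
  obtain ⟨h, Z₁, Z₂, hZ₁, hZ₂, hZ⟩ := (hX.2 1 _ (Submodule.subset_span
    ⟨_, hlow, by simp, rfl⟩)).odd_conditions (lt_trans (by norm_num) hN) hlow
  have hpar : ∀ {i : Fin 3} {k : Fin 4}, compParity k ≠ 1 + coordParity i → X.part 1 i k = 0 :=
    part_apply_eq_zero X
  set Y := X.part 1
  obtain ⟨a, ha, ha'⟩ := exists_polynomial_of_growth_int (1 - n) (hd 1 0) hZ₁
    (hZ.mono fun w hw => hw.1)
  obtain ⟨b, hb, hb'⟩ := exists_polynomial_of_growth_int (n + 1) (hd 2 0) hZ₂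
    (hZ.mono fun w hw => hw.2)
  refine ⟨a, b, ha, hb, ?_⟩
  funext i k z
  obtain ⟨h01, h02, h23, h13⟩ := h z
  have hda : deriv (Y 1 0) z = (derivative a).eval z := by rw [ha']; exact a.deriv
  have hdb : deriv (Y 2 0) z = (derivative b).eval z := by rw [hb']; exact b.deriv
  have ha0 : Y 1 0 z = a.eval z := congrFun ha' z
  have hb0 : Y 2 0 z = b.eval z := congrFun hb' z
  rw [hda] at h13
  rw [hdb] at h23
  rw [hb0] at h01
  rw [ha0] at h02
  have p00 : Y 0 0 = 0 := hpar (by decide)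
  have p03 : Y 0 3 = 0 := hpar (by decide)
  have p11 : Y 1 1 = 0 := hpar (by decide)
  have p12 : Y 1 2 = 0 := hpar (by decide)
  have p21 : Y 2 1 = 0 := hpar (by decide)
  have p22 : Y 2 2 = 0 := hpar (by decide)
  rw [fld_apply, evalFn_apply]
  fin_cases i <;> fin_cases k <;>
    simp [polyField, ha0, hb0, h01, h02, h23, h13, p00, p03, p11, p12, p21, p22]

theorem mem_infAut_of_mem_map {X : VField} (hX : X ∈ (evenSpan n ⊔ oddSpan n).map rep) :
    X ∈ infAut N n := by
  rw [Submodule.map_sup] at hX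
  obtain ⟨Y, hY, Y', hY', rfl⟩ := Submodule.mem_sup.mp hX
  obtain ⟨a, b, d, e, rfl⟩ := mem_map_evenSpan.mp hY
  obtain ⟨g, h, hg, hh, rfl⟩ := mem_map_oddSpan.mp hY'
  rw [← map_add]
  exact fld_mem_infAut a b d e hg hh

theorem part_zero_of_mem {X : VField} (hX : X ∈ (evenSpan n).map rep) : X.part 0 = X := by
  obtain ⟨a, b, d, e, rfl⟩ := mem_map_evenSpan.mp hX
  rw [part_zero_fld]
  rfl

theorem part_one_of_mem {X : VField} (hX : X ∈ (oddSpan n).map rep) : X.part 1 = X := by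
  obtain ⟨g, h, hg, hh, rfl⟩ := mem_map_oddSpan.mp hX
  rw [part_one_fld]

theorem infAut_even_eq (hN : 1 < N) :
    {X ∈ infAut N n | X.part 0 = X} = ((evenSpan n).map rep : Submodule ℂ VField) := by
  ext X
  constructor
  · rintro ⟨h1, h2⟩
    rw [← h2]
    exact part_zero_mem_of_mem_infAut hN h1
  · intro h
    exact ⟨mem_infAut_of_mem_map (Submodule.map_mono le_sup_left h), part_zero_of_mem h⟩

theorem infAut_odd_eq (hN : 2 < N) :
    {X ∈ infAut N n | X.part 1 = X} = ((oddSpan n).map rep : Submodule ℂ VField) := by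
  ext X
  constructor
  · rintro ⟨h1, h2⟩
    rw [← h2]
    exact part_one_mem_of_mem_infAut hN h1
  · intro h
    exact ⟨mem_infAut_of_mem_map (Submodule.map_mono le_sup_right h), part_one_of_mem h⟩

theorem infAut_eq (hN : 2 < N) :
    infAut N n = ((evenSpan n ⊔ oddSpan n).map rep : Submodule ℂ VField) := by
  ext X
  refine ⟨fun h => ?_, mem_infAut_of_mem_map⟩
  rw [← part_zero_add_part_one X, Submodule.map_sup]
  exact Submodule.add_mem_sup (part_zero_mem_of_mem_infAut (lt_trans (by norm_num) hN) h)
    (part_one_mem_of_mem_infAut hN h)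

end InfinitesimalAutomorphisms
end

end N2Sphere

open N2Sphere in
theorem theorem5p1 (N : ℕ∞) (hN : 1 < N) (n : ℤ) :
    -- the span of the generators is a sub Lie superalgebra of the Neveu-Schwarz algebra,
    (∀ u ∈ evenSpan n ⊔ oddSpan n, ∀ v ∈ evenSpan n ⊔ oddSpan n,
      nsBracket u v ∈ evenSpan n ⊔ oddSpan n) ∧
    -- on which the representation by superderivations preserves brackets
    (∀ u ∈ evenSpan n ⊔ oddSpan n, ∀ v ∈ evenSpan n ⊔ oddSpan n,
      rep (nsBracket u v) = VField.bracket (rep u) (rep v)) ∧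
    -- and is injective; the generators are mapped to a linearly independent family,
    Set.InjOn rep (evenSpan n ⊔ oddSpan n : Submodule ℂ NS) ∧
    LinearIndependent ℂ (fun i => rep (gen n i)) ∧
    -- of the following numbers of even and odd elements
    Module.finrank ℂ ((evenSpan n).map rep) = 4 ∧
    (Module.finrank ℂ ((oddSpan n).map rep) : ℤ) = max 4 (|n| + 2) ∧
    -- the image is the Lie superalgebra of infinitesimal automorphisms, with its even part
    {X ∈ infAut N n | X.part 0 = X} = ((evenSpan n).map rep : Submodule ℂ VField) ∧
    -- and, as soon as there are nonzero odd constants, its odd part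
    (2 < N →
      infAut N n = ((evenSpan n ⊔ oddSpan n).map rep : Submodule ℂ VField) ∧
      {X ∈ infAut N n | X.part 1 = X} = ((oddSpan n).map rep : Submodule ℂ VField)) := by
  exact ⟨fun _ hu _ hv => nsBracket_mem_genSpan n hu hv,
    fun _ hu _ hv => rep_nsBracket (genSpan_le_posSpan n hu) (genSpan_le_posSpan n hv),
    injOn_rep n, linearIndependent_rep_gen n, finrank_map_evenSpan n, finrank_map_oddSpan n,
    infAut_even_eq hN, fun h => ⟨infAut_eq h, infAut_odd_eq h⟩⟩
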